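/- **Conventions.** All manifolds and maps are smooth and finite-dimensional; object spaces of Lie groupoids and base spaces of bundles are Hausdorff and second countable. (Arrow spaces, with Hausdorff $s$-fibres, and total spaces of bundles need not be; if the total space of the bibundle below is Hausdorff and second countable, then so are all arrow spaces and total spaces that occur.) A *Pfaffian groupoid* $(\Sigma,\omega,E)$ over $\mathbf X$ is a Lie groupoid $\Sigma\rightrightarrows\mathbf X$ (source $s$, target $t$, multiplication $m$) with a representation $E\to\mathbf X$ and a form $\omega\in\Omega^1(\Sigma,t^*E)$ of constant rank such that $(m^*\omega)_{(g,h)}=(\mathrm{pr}_1^*\omega)_{(g,h)}+g\cdot(\mathrm{pr}_2^*\omega)_{(g,h)}$, $T\Sigma=\ker\omega+\ker ds$, $\ker\omega\cap\ker ds$ is involutive, and $\ker\omega\cap\ker dt=\ker\omega\cap\ker ds$. A *principal $(\Sigma,\omega,E)$-bundle* $(P,\theta)$ over $M$ is a left principal $\Sigma$-bundle $\pi:P\to M$ (free and proper action, transitive on the fibres of the surjective submersion $\pi$) whose moment map $\mu:P\to\mathbf X$ is a surjective submersion, together with $\theta\in\Omega^1(P,\mu^*E)$ such that, with $m_P$ the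 action map, $(m_P^*\theta)_{(g,p)}=(\mathrm{pr}_1^*\omega)_{(g,p)}+g\cdot(\mathrm{pr}_2^*\theta)_{(g,p)}$ and $\ker d\mu\cap\ker\theta=\ker d\pi\cap\ker\theta$. *Right* principal $(\Sigma,\omega,E)$-bundles are defined analogously, with $(m_P^*\theta)_{(p,g)}=g^{-1}\cdot(\mathrm{pr}_1^*\theta)_{(p,g)}+g^{-1}\cdot(\mathrm{pr}_2^*\omega)_{(p,g)}$. An *isomorphism* of principal $(\Sigma,\omega,E)$-bundles over $M$ is a $\Sigma$-equivariant diffeomorphism over $M$, compatible with the moment maps, that pulls back the second form to the first. A *principal Pfaffian bibundle* $(P,\theta,\Phi)$ between $(\Sigma_1,\omega_1,E_1)$ and $(\Sigma_2,\omega_2,E_2)$ consists of a left principal $(\Sigma_1,\omega_1,E_1)$-bundle $(P,\theta)$ over $\mathbf X_2$ with moment map $\mu_1$ and projection $\mu_2$, and an isomorphism of vector bundles $\Phi:\mu_1^*E_1\to\mu_2^*E_2$ over $P$, such that $(P,\Phi\circ\theta)$ is a right principal $(\Sigma_2,\omega_2,E_2)$-bundle over $\mathbf X_1$ with moment map $\mu_2$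 and projection $\mu_1$, the two actions commute, $\Phi_{g_1\cdot p}(g_1\cdot\alpha)=\Phi_p(\alpha)$ and $\Phi_{p\cdot g_2}(\alpha)=g_2^{-1}\cdot\Phi_p(\alpha)$. Two Pfaffian groupoids are *Pfaffian Morita equivalent* if there is a principal Pfaffian bibundle between them. **Theorem.** Let $(\Sigma_1,\omega_1,E_1)$ and $(\Sigma_2,\omega_2,E_2)$ be Pfaffian Morita equivalent Pfaffian groupoids, and let $(P,\theta,\Phi)$ be any principal Pfaffian bibundle between them. Then, for every manifold $M$, there is a bijection $$\{\text{principal }(\Sigma_1,\omega_1,E_1)\text{-bundles over }M\}/\!\cong\ \ \longleftrightarrow\ \ \{\text{principal }(\Sigma_2,\omega_2,E_2)\text{-bundles over }M\}/\!\cong$$ with the following property: the class of $(P_1,\theta_1)$, with projection $\pi_1$ and moment map $\tau_1$, corresponds to the class of $(P_2,\theta_2)$, with projection $\pi_2$ and moment map $\tau_2$, if and only if there is a surjective submersion $q:P_1\times_{\mathbf X_1}P\to P_2$ whose fibres are exactly the orbits of the diagonal $\Sigma_1$-action, with $\pi_2(q(p_1,p))=\pi_1(p_1)$, $\tau_2(q(p_1,p))=\mu_2(p)$,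 $q(p_1,p\cdot g_2)=g_2^{-1}\cdot q(p_1,p)$, and $$-\,q^*\theta_2=\Phi\circ(\mathrm{pr}_2^*\theta-\mathrm{pr}_1^*\theta_1).$$ In other words, $P_2$ is the quotient $(P_1\times_{\mathbf X_1}P)/\Sigma_1$, the form $\Phi\circ(\mathrm{pr}_2^*\theta-\mathrm{pr}_1^*\theta_1)$ is basic and descends to a form that makes the quotient a right principal $(\Sigma_2,\omega_2,E_2)$-bundle, and this is turned into a left one by letting $g$ act as $g^{-1}$ and changing the sign of the form. -/

import Mathlib

universe u

noncomputable section

namespace Pfaffian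

open scoped Manifold ContDiff
open Bundle

/-! ### Manifolds -/

/-- A smooth manifold without boundary of dimension `dim`. Neither the Hausdorff property nor second
countability is built in: these are imposed separately where they are required. -/
structure Mfd where
  carrier : Type u
  [top : TopologicalSpace carrier]
  dim : ℕ
  [charted : ChartedSpace (EuclideanSpace ℝ (Fin dim)) carrier]
  [isMfd : IsManifold (𝓡 dim) ∞ carrier]

instance : CoeSort Mfd.{u} (Type u) := ⟨Mfd.carrier⟩

attribute [instance] Mfd.top Mfd.charted Mfd.isMfd

/-- The tangent space of `A` at `a`. -/
abbrev Mfd.T (A : Mfd.{u}) (a : A) : Type := TangentSpace (𝓡 A.dim) a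

/-- Smooth maps. -/
abbrev Smooth {A B : Mfd.{u}} (f : A → B) : Prop := ContMDiff (𝓡 A.dim) (𝓡 B.dim) ∞ f

/-- The differential of a map at a point. -/
abbrev diff {A B : Mfd.{u}} (f : A → B) (a : A) : A.T a →L[ℝ] B.T (f a) :=
  mfderiv (𝓡 A.dim) (𝓡 B.dim) f a

/-- Surjective submersions. -/
structure IsSurjSubmersion {A B : Mfd.{u}} (f : A → B) : Prop where
  smooth : Smooth f
  surj : Function.Surjective f
  submersive : ∀ a, Function.Surjective (diff f a)

/-- The fibred product `A ×_X B` of two maps `f : A → X`, `g : B → X`, as a subset of `A × B`. -/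
def fibProd {A B X : Type u} (f : A → X) (g : B → X) : Set (A × B) := {x | f x.1 = g x.2}

/-- Smoothness of a map defined on a subset `S` of `A × B`. (It is used for fibred products along
submersions, which are embedded submanifolds; values outside `S` are irrelevant.) -/
abbrev SmoothOn {A B C : Mfd.{u}} (m : A × B → C) (S : Set (A × B)) : Prop :=
  ContMDiffOn ((𝓡 A.dim).prod (𝓡 B.dim)) (𝓡 C.dim) ∞ m S

/-- The differential at `(a, b) ∈ S` of a map defined on a subset `S` of `A × B`, evaluated at
`(v, w)`. It is only ever used for an embedded submanifold `S` and for `(v, w)` tangent to `S`; there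
it is the differential of `m` restricted to `S` and depends on `m` on `S` only. -/
def diffOn {A B C : Mfd.{u}} (m : A × B → C) (S : Set (A × B)) (a : A) (b : B)
    (v : A.T a) (w : B.T b) : C.T (m (a, b)) :=
  mfderivWithin ((𝓡 A.dim).prod (𝓡 B.dim)) (𝓡 C.dim) m S (a, b) (v, w)

/-- The pair `(v, w)` of tangent vectors at `a` and `b` is tangent to the fibred product of `f` and
`g`: `df v = dg w` as elements of the tangent bundle of `X`. -/
def TangentToFib {A B X : Mfd.{u}} (f : A → X) (g : B → X) {a : A} {b : B} (v : A.T a)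
    (w : B.T b) : Prop :=
  (⟨f a, diff f a v⟩ : TangentBundle (𝓡 X.dim) X) = ⟨g b, diff g b w⟩

/-- A family of tangent subspaces is involutive: the Lie bracket of any two smooth vector fields on
an open set that are tangent to it is again tangent to it. -/
def Involutive {A : Mfd.{u}} (D : ∀ a : A, Submodule ℝ (A.T a)) : Prop :=
  ∀ (U : Set A), IsOpen U → ∀ V W : ∀ a : A, A.T a,
    ContMDiffOn (𝓡 A.dim) (𝓡 A.dim).tangent ∞
      (fun a => (⟨a, V a⟩ : TangentBundle (𝓡 A.dim) A)) U →
    ContMDiffOn (𝓡 A.dim) (𝓡 A.dim).tangent ∞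
      (fun a => (⟨a, W a⟩ : TangentBundle (𝓡 A.dim) A)) U →
    (∀ a ∈ U, V a ∈ D a) → (∀ a ∈ U, W a ∈ D a) →
    ∀ a ∈ U, VectorField.mlieBracket (𝓡 A.dim) V W a ∈ D a

/-! ### Vector bundles and forms with values in a pulled back vector bundle -/

/-- A smooth real vector bundle of finite rank over `X`. -/
structure VBundle (X : Mfd.{u}) where
  rank : ℕ
  fib : X → Type u
  [acg : ∀ x, AddCommGroup (fib x)]
  [mod : ∀ x, Module ℝ (fib x)]
  [topFib : ∀ x, TopologicalSpace (fib x)]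
  [topTot : TopologicalSpace (TotalSpace (EuclideanSpace ℝ (Fin rank)) fib)]
  [fiberBundle : FiberBundle (EuclideanSpace ℝ (Fin rank)) fib]
  [vectorBundle : VectorBundle ℝ (EuclideanSpace ℝ (Fin rank)) fib]
  [smoothBundle : ContMDiffVectorBundle ∞ (EuclideanSpace ℝ (Fin rank)) fib (𝓡 X.dim)]

attribute [instance] VBundle.acg VBundle.mod VBundle.topFib VBundle.topTot VBundle.fiberBundle
  VBundle.vectorBundle VBundle.smoothBundle

/-- The total space of a vector bundle. -/
abbrev VBundle.Tot {X : Mfd.{u}} (E : VBundle X) : Type u :=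
  TotalSpace (EuclideanSpace ℝ (Fin E.rank)) E.fib

/-- The model of the total space of a vector bundle, as a manifold. -/
abbrev VBundle.model {X : Mfd.{u}} (E : VBundle X) :=
  (𝓡 X.dim).prod (𝓡 E.rank)

/-- The identification of the fibres over equal points. -/
def VBundle.tr {X : Mfd.{u}} (E : VBundle X) {x y : X} (h : x = y) : E.fib x →ₗ[ℝ] E.fib y :=
  h ▸ LinearMap.id

@[simp] theorem VBundle.tr_rfl {X : Mfd.{u}} (E : VBundle X) (x : X) :
    E.tr (rfl : x = x) = LinearMap.id := rfl

/-- A 1-form on `P`, not necessarily smooth, with values in the pullback `f^*E`. -/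
abbrev FormOn (P : Mfd.{u}) {X : Mfd.{u}} (f : P → X) (E : VBundle X) : Type u :=
  ∀ p : P, P.T p →ₗ[ℝ] E.fib (f p)

/-- The form `θ` at `p`, with values in the fibre over `x = f p`. -/
def FormOn.val {P X : Mfd.{u}} {f : P → X} {E : VBundle X} (θ : FormOn P f E) (p : P) {x : X}
    (h : f p = x) : P.T p →ₗ[ℝ] E.fib x :=
  (E.tr h).comp (θ p)

/-- Smoothness of a 1-form `θ` with values in `f^*E`: smoothness of the bundle map `TP → E`
over `f`. -/
def FormOn.IsSmooth {P X : Mfd.{u}} {f : P → X} {E : VBundle X} (θ : FormOn P f E) : Prop :=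
  ContMDiff (𝓡 P.dim).tangent E.model ∞
    (fun v : TangentBundle (𝓡 P.dim) P => (⟨f v.1, θ v.1 v.2⟩ : E.Tot))

/-- A fibrewise linear map `f^*E → g^*F` over `P`, seen as a map on `P × E`
(given by zero outside of `f^*E = P ×_X E`). -/
def linTot {P X Y : Mfd.{u}} {f : P → X} {g : P → Y} {E : VBundle X} {F : VBundle Y}
    (L : ∀ p : P, E.fib (f p) →ₗ[ℝ] F.fib (g p)) (x : P × E.Tot) : F.Tot :=
  open Classical in
  ⟨g x.1, if h : x.2.proj = f x.1 then L x.1 (E.tr h x.2.snd) else 0⟩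

/-- A family of linear maps `L p : E_{f p} → F_{g p}` is a smooth morphism `f^*E → g^*F` of vector
bundles over `P`, where `f^*E` is the submanifold `P ×_X E` of `P × E`. -/
def IsSmoothLin {P X Y : Mfd.{u}} {f : P → X} {g : P → Y} {E : VBundle X} {F : VBundle Y}
    (L : ∀ p : P, E.fib (f p) →ₗ[ℝ] F.fib (g p)) : Prop :=
  ContMDiffOn ((𝓡 P.dim).prod E.model) F.model ∞ (linTot L) {x | f x.1 = x.2.proj}

/-! ### Lie groupoids and their representations -/

/-- A Lie groupoid. The product `mul g h = g h` is meaningful when `s g = t h`; its other values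
are irrelevant. -/
structure LieGroupoid where
  /-- the objects -/
  X : Mfd.{u}
  /-- the arrows -/
  arr : Mfd.{u}
  [hausdorff : T2Space X]
  [secondCountable : SecondCountableTopology X]
  s : arr → X
  t : arr → X
  one : X → arr
  inv : arr → arr
  mul : arr → arr → arr
  s_submersion : IsSurjSubmersion s
  s_fibre_hausdorff : ∀ x : X, T2Space (s ⁻¹' {x})
  t_smooth : Smooth t
  one_smooth : Smooth one
  inv_smooth : Smooth inv
  mul_smooth : SmoothOn (fun x => mul x.1 x.2) (fibProd s t)
  s_one : ∀ x, s (one x) = x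
  t_one : ∀ x, t (one x) = x
  s_inv : ∀ g, s (inv g) = t g
  t_inv : ∀ g, t (inv g) = s g
  s_mul : ∀ g h, s g = t h → s (mul g h) = s h
  t_mul : ∀ g h, s g = t h → t (mul g h) = t g
  mul_assoc : ∀ g h k, s g = t h → s h = t k → mul (mul g h) k = mul g (mul h k)
  one_mul : ∀ g, mul (one (t g)) g = g
  mul_one : ∀ g, mul g (one (s g)) = g
  mul_inv : ∀ g, mul g (inv g) = one (t g)
  inv_mul : ∀ g, mul (inv g) g = one (s g)

attribute [instance] LieGroupoid.hausdorff LieGroupoid.secondCountable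

/-- Given linear maps `ρ g : E_{s g} → E_{t g}`, the map `ρ g` seen as a map `E_x → E_y` for
`x = s g`, `y = t g`. -/
def repVal {G : LieGroupoid.{u}} {E : VBundle G.X}
    (ρ : ∀ g : G.arr, E.fib (G.s g) →ₗ[ℝ] E.fib (G.t g)) (g : G.arr) {x y : G.X}
    (hx : G.s g = x) (hy : G.t g = y) : E.fib x →ₗ[ℝ] E.fib y :=
  (E.tr hy).comp ((ρ g).comp (E.tr hx.symm))

/-- A representation of a Lie groupoid: a vector bundle over its objects with a smooth, fibrewise
linear action along the bundle projection. -/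
structure Representation (G : LieGroupoid.{u}) where
  E : VBundle G.X
  ρ : ∀ g : G.arr, E.fib (G.s g) →ₗ[ℝ] E.fib (G.t g)
  smooth : IsSmoothLin ρ
  rep_one : ∀ x, repVal ρ (G.one x) (G.s_one x) (G.t_one x) = LinearMap.id
  rep_mul : ∀ g h (hgh : G.s g = G.t h),
    repVal ρ (G.mul g h) (G.s_mul g h hgh) (G.t_mul g h hgh) =
      (repVal ρ g hgh rfl).comp (repVal ρ h rfl rfl)

/-- The action `E_x → E_y` of an arrow `g` with source `x` and target `y`. -/
def Representation.act {G : LieGroupoid.{u}} (R : Representation G) (g : G.arr) {x y : G.X}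
    (hx : G.s g = x) (hy : G.t g = y) : R.E.fib x →ₗ[ℝ] R.E.fib y :=
  repVal R.ρ g hx hy

/-! ### Pfaffian groupoids -/

/-- A Pfaffian groupoid `(Σ, ω, E)`. -/
structure PfaffianGroupoid where
  G : LieGroupoid.{u}
  R : Representation G
  form : FormOn G.arr G.t R.E
  form_smooth : form.IsSmooth
  /-- `m^*ω = pr₁^*ω + g · pr₂^*ω` on composable arrows -/
  multiplicative : ∀ (g h : G.arr) (hgh : G.s g = G.t h) (v : G.arr.T g) (w : G.arr.T h),
    TangentToFib G.s G.t v w →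
    form.val (G.mul g h) (G.t_mul g h hgh)
        (diffOn (fun x => G.mul x.1 x.2) (fibProd G.s G.t) g h v w) =
      form g v + R.act g hgh rfl (form h w)
  constant_rank : ∃ r : ℕ, ∀ g, Module.finrank ℝ (LinearMap.range (form g)) = r
  s_transversal : ∀ g, LinearMap.ker (form g) ⊔ LinearMap.ker (diff G.s g).toLinearMap = ⊤
  symbol_involutive :
    Involutive (fun g => LinearMap.ker (form g) ⊓ LinearMap.ker (diff G.s g).toLinearMap)
  ker_t_eq_ker_s : ∀ g, LinearMap.ker (form g) ⊓ LinearMap.ker (diff G.t g).toLinearMap =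
    LinearMap.ker (form g) ⊓ LinearMap.ker (diff G.s g).toLinearMap

/-! ### Principal bundles -/

/-- A left principal `G`-bundle `π : P → M` with moment map `μ : P → X`, which is a surjective
submersion. The action `act g p = g · p` is meaningful when `s g = μ p`; its other values are
irrelevant. -/
structure IsLeftPrincipal (G : LieGroupoid.{u}) {P M : Mfd.{u}} (μ : P → G.X) (proj : P → M)
    (act : G.arr → P → P) : Prop where
  moment_submersion : IsSurjSubmersion μ
  proj_submersion : IsSurjSubmersion proj
  act_smooth : SmoothOn (fun x => act x.1 x.2) (fibProd G.s μ)
  moment_act : ∀ g p, G.s g = μ p → μ (act g p) = G.t g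
  act_one : ∀ p, act (G.one (μ p)) p = p
  act_act : ∀ g h p, G.s g = G.t h → G.s h = μ p → act g (act h p) = act (G.mul g h) p
  proj_act : ∀ g p, G.s g = μ p → proj (act g p) = proj p
  transitive : ∀ p q, proj p = proj q → ∃ g, G.s g = μ p ∧ q = act g p
  free : ∀ g p, G.s g = μ p → act g p = p → g = G.one (μ p)
  proper : IsProperMap (fun x : fibProd G.s μ => (act x.1.1 x.1.2, x.1.2))

/-- A right principal `G`-bundle `π : P → M` with moment map `μ : P → X`, which is a surjective
submersion. The action `act p g = p · g` is meaningful when `μ p = t g`; its other values are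
irrelevant. -/
structure IsRightPrincipal (G : LieGroupoid.{u}) {P M : Mfd.{u}} (μ : P → G.X) (proj : P → M)
    (act : P → G.arr → P) : Prop where
  moment_submersion : IsSurjSubmersion μ
  proj_submersion : IsSurjSubmersion proj
  act_smooth : SmoothOn (fun x => act x.1 x.2) (fibProd μ G.t)
  moment_act : ∀ p g, μ p = G.t g → μ (act p g) = G.s g
  act_one : ∀ p, act p (G.one (μ p)) = p
  act_act : ∀ p g h, μ p = G.t g → G.s g = G.t h → act (act p g) h = act p (G.mul g h)
  proj_act : ∀ p g, μ p = G.t g → proj (act p g) = proj p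
  transitive : ∀ p q, proj p = proj q → ∃ g, μ p = G.t g ∧ q = act p g
  free : ∀ p g, μ p = G.t g → act p g = p → g = G.one (μ p)
  proper : IsProperMap (fun x : fibProd μ G.t => (act x.1.1 x.1.2, x.1.1))

/-- The conditions on a form `θ` that make a left principal bundle a left principal
`(Σ, ω, E)`-bundle (apart from smoothness of `θ`). -/
structure IsLeftPfaffian (Γ : PfaffianGroupoid.{u}) {P M : Mfd.{u}} (μ : P → Γ.G.X) (proj : P → M)
    (act : Γ.G.arr → P → P) (θ : FormOn P μ Γ.R.E) : Prop where
  /-- `m^*θ = pr₁^*ω + g · pr₂^*θ` on `Σ ×_X P` -/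
  multiplicative : ∀ (g : Γ.G.arr) (p : P) (hg : Γ.G.s g = μ p) (hm : μ (act g p) = Γ.G.t g)
    (w : Γ.G.arr.T g) (v : P.T p), TangentToFib Γ.G.s μ w v →
    θ.val (act g p) hm (diffOn (fun x => act x.1 x.2) (fibProd Γ.G.s μ) g p w v) =
      Γ.form g w + Γ.R.act g hg rfl (θ p v)
  ker_eq : ∀ p, LinearMap.ker (diff μ p).toLinearMap ⊓ LinearMap.ker (θ p) =
    LinearMap.ker (diff proj p).toLinearMap ⊓ LinearMap.ker (θ p)

/-- The conditions on a form `θ` that make a right principal bundle a right principal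
`(Σ, ω, E)`-bundle (apart from smoothness of `θ`). -/
structure IsRightPfaffian (Γ : PfaffianGroupoid.{u}) {P M : Mfd.{u}} (μ : P → Γ.G.X) (proj : P → M)
    (act : P → Γ.G.arr → P) (θ : FormOn P μ Γ.R.E) : Prop where
  /-- `m^*θ = g⁻¹ · pr₁^*θ + g⁻¹ · pr₂^*ω` on `P ×_X Σ` -/
  multiplicative : ∀ (p : P) (g : Γ.G.arr) (hg : μ p = Γ.G.t g) (hm : μ (act p g) = Γ.G.s g)
    (v : P.T p) (w : Γ.G.arr.T g), TangentToFib μ Γ.G.t v w →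
    θ.val (act p g) hm (diffOn (fun x => act x.1 x.2) (fibProd μ Γ.G.t) p g v w) =
      Γ.R.act (Γ.G.inv g) (Γ.G.s_inv g) (Γ.G.t_inv g) (θ.val p hg v) +
      Γ.R.act (Γ.G.inv g) (Γ.G.s_inv g) (Γ.G.t_inv g) (Γ.form g w)
  ker_eq : ∀ p, LinearMap.ker (diff μ p).toLinearMap ⊓ LinearMap.ker (θ p) =
    LinearMap.ker (diff proj p).toLinearMap ⊓ LinearMap.ker (θ p)

/-- A (left) principal `(Σ, ω, E)`-bundle `(P, θ)` over `M`. -/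
structure PrincipalPfaffianBundle (Γ : PfaffianGroupoid.{u}) (M : Mfd.{u}) where
  P : Mfd.{u}
  μ : P → Γ.G.X
  proj : P → M
  act : Γ.G.arr → P → P
  principal : IsLeftPrincipal Γ.G μ proj act
  θ : FormOn P μ Γ.R.E
  θ_smooth : θ.IsSmooth
  isPfaffian : IsLeftPfaffian Γ μ proj act θ

/-- Isomorphism of principal `(Σ, ω, E)`-bundles over `M`: there is a diffeomorphism `F` over `M`,
equivariant for the actions, with `F^*θ₂ = θ₁`. -/
def PrincipalPfaffianBundle.Iso {Γ : PfaffianGroupoid.{u}} {M : Mfd.{u}}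
    (B₁ B₂ : PrincipalPfaffianBundle Γ M) : Prop :=
  ∃ F : B₁.P ≃ₘ⟮𝓡 B₁.P.dim, 𝓡 B₂.P.dim⟯ B₂.P,
    (∀ p, B₂.proj (F p) = B₁.proj p) ∧
    (∀ g p, Γ.G.s g = B₁.μ p → F (B₁.act g p) = B₂.act g (F p)) ∧
    ∃ hμ : ∀ p, B₂.μ (F p) = B₁.μ p,
      ∀ p v, B₂.θ.val (F p) (hμ p) (diff F p v) = B₁.θ p v

/-- A form with values in `f^*E` as a map `TP → E`. -/
def FormOn.tot {P X : Mfd.{u}} {f : P → X} {E : VBundle X} (θ : FormOn P f E)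
    (v : TangentBundle (𝓡 P.dim) P) : E.Tot := ⟨f v.1, θ v.1 v.2⟩

theorem FormOn.val_eq_iff {P X : Mfd.{u}} {f : P → X} {E : VBundle X} (θ : FormOn P f E) (p : P)
    (v : P.T p) {x : X} (hx : f p = x) (e : E.fib x) :
    θ.val p hx v = e ↔ θ.tot ⟨p, v⟩ = ⟨x, e⟩ := by
  subst hx
  simp [FormOn.val, FormOn.tot]

theorem PrincipalPfaffianBundle.iso_iff {Γ : PfaffianGroupoid.{u}} {M : Mfd.{u}}
    (B₁ B₂ : PrincipalPfaffianBundle Γ M) : B₁.Iso B₂ ↔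
    ∃ F : B₁.P ≃ₘ⟮𝓡 B₁.P.dim, 𝓡 B₂.P.dim⟯ B₂.P,
      (∀ p, B₂.proj (F p) = B₁.proj p) ∧
      (∀ g p, Γ.G.s g = B₁.μ p → F (B₁.act g p) = B₂.act g (F p)) ∧
      (∀ p, B₂.μ (F p) = B₁.μ p) ∧
      ∀ v, B₂.θ.tot (tangentMap (𝓡 B₁.P.dim) (𝓡 B₂.P.dim) F v) = B₁.θ.tot v := by
  refine exists_congr fun F => and_congr Iff.rfl (and_congr Iff.rfl ?_)
  constructor
  · rintro ⟨h, h'⟩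
    exact ⟨h, fun ⟨p, v⟩ => (B₂.θ.val_eq_iff (F p) _ (h p) _).1 (h' p v)⟩
  · rintro ⟨h, h'⟩
    exact ⟨h, fun p v => (B₂.θ.val_eq_iff (F p) _ (h p) _).2 (h' ⟨p, v⟩)⟩

theorem PrincipalPfaffianBundle.iso_equivalence (Γ : PfaffianGroupoid.{u}) (M : Mfd.{u}) :
    Equivalence (PrincipalPfaffianBundle.Iso (Γ := Γ) (M := M)) where
  refl B := by
    rw [PrincipalPfaffianBundle.iso_iff]
    refine ⟨Diffeomorph.refl _ _ _, fun _ => rfl, fun _ _ _ => rfl, fun _ => rfl, fun v => ?_⟩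
    rw [Diffeomorph.coe_refl, tangentMap_id]
    rfl
  symm {B₁ B₂} h := by
    rw [PrincipalPfaffianBundle.iso_iff] at h ⊢
    obtain ⟨F, h1, h2, h3, h4⟩ := h
    refine ⟨F.symm, fun p => ?_, fun g p hg => ?_, fun p => ?_, fun v => ?_⟩
    · rw [← h1, F.apply_symm_apply]
    · apply F.injective
      change F (F.symm _) = F _
      rw [F.apply_symm_apply, h2 g _ (by rw [hg, ← h3, F.apply_symm_apply]), F.apply_symm_apply]
    · rw [← h3, F.apply_symm_apply]
    · rw [← h4, ← Function.comp_apply (f := tangentMap _ _ F), ← tangentMap_comp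
        (F.contMDiff.mdifferentiable (by simp)) (F.symm.contMDiff.mdifferentiable (by simp))]
      have : (F ∘ F.symm : B₂.P → B₂.P) = id := by
        funext x; simp
      rw [this, tangentMap_id]
      rfl
  trans {B₁ B₂ B₃} h h' := by
    rw [PrincipalPfaffianBundle.iso_iff] at h h' ⊢
    obtain ⟨F, h1, h2, h3, h4⟩ := h
    obtain ⟨F', h1', h2', h3', h4'⟩ := h'
    refine ⟨F.trans F', fun p => ?_, fun g p hg => ?_, fun p => ?_, fun v => ?_⟩
    · exact (h1' _).trans (h1 _)
    · change F' (F _) = _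
      rw [h2 g p hg, h2' g _ (by rw [hg, h3])]
      rfl
    · exact (h3' _).trans (h3 _)
    · rw [Diffeomorph.coe_trans, tangentMap_comp
        (F'.contMDiff.mdifferentiable (by simp)) (F.contMDiff.mdifferentiable (by simp)),
        Function.comp_apply, h4', h4]

instance PrincipalPfaffianBundle.setoid (Γ : PfaffianGroupoid.{u}) (M : Mfd.{u}) :
    Setoid (PrincipalPfaffianBundle Γ M) where
  r := PrincipalPfaffianBundle.Iso
  iseqv := PrincipalPfaffianBundle.iso_equivalence Γ M

/-- Isomorphism classes of principal `(Σ, ω, E)`-bundles over `M`. -/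
def IsoClasses (Γ : PfaffianGroupoid.{u}) (M : Mfd.{u}) : Type (u + 1) :=
  Quotient (PrincipalPfaffianBundle.setoid Γ M)

/-- The isomorphism class of a principal `(Σ, ω, E)`-bundle over `M`. -/
def PrincipalPfaffianBundle.cls {Γ : PfaffianGroupoid.{u}} {M : Mfd.{u}}
    (B : PrincipalPfaffianBundle Γ M) : IsoClasses Γ M :=
  Quotient.mk _ B

/-! ### Pfaffian Morita equivalences -/

/-- A principal Pfaffian bibundle `(P, θ, Φ)` between two Pfaffian groupoids, that is, a Pfaffian
Morita equivalence. -/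
structure PfaffianBibundle (Γ₁ Γ₂ : PfaffianGroupoid.{u}) where
  P : Mfd.{u}
  μ₁ : P → Γ₁.G.X
  μ₂ : P → Γ₂.G.X
  lact : Γ₁.G.arr → P → P
  ract : P → Γ₂.G.arr → P
  left_principal : IsLeftPrincipal Γ₁.G μ₁ μ₂ lact
  right_principal : IsRightPrincipal Γ₂.G μ₂ μ₁ ract
  commute : ∀ g p h, Γ₁.G.s g = μ₁ p → μ₂ p = Γ₂.G.t h →
    ract (lact g p) h = lact g (ract p h)
  θ : FormOn P μ₁ Γ₁.R.E
  θ_smooth : θ.IsSmooth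
  left_pfaffian : IsLeftPfaffian Γ₁ μ₁ μ₂ lact θ
  /-- the isomorphism `μ₁^*E₁ → μ₂^*E₂` of vector bundles over `P` -/
  Φ : ∀ p : P, Γ₁.R.E.fib (μ₁ p) ≃ₗ[ℝ] Γ₂.R.E.fib (μ₂ p)
  Φ_smooth : IsSmoothLin (fun p => (Φ p).toLinearMap)
  Φ_symm_smooth : IsSmoothLin (fun p => (Φ p).symm.toLinearMap)
  right_pfaffian : IsRightPfaffian Γ₂ μ₂ μ₁ ract (fun p => (Φ p).toLinearMap.comp (θ p))
  /-- `Φ_{g·p}(g · α) = Φ_p(α)` -/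
  Φ_left : ∀ (g : Γ₁.G.arr) (p : P) (hg : Γ₁.G.s g = μ₁ p) (α : Γ₁.R.E.fib (μ₁ p)),
    Φ (lact g p)
        (Γ₁.R.act g hg (left_principal.moment_act g p hg).symm α) =
      Γ₂.R.E.tr (left_principal.proj_act g p hg).symm (Φ p α)
  /-- `Φ_{p·g}(α) = g⁻¹ · Φ_p(α)` -/
  Φ_right : ∀ (p : P) (g : Γ₂.G.arr) (hg : μ₂ p = Γ₂.G.t g) (α : Γ₁.R.E.fib (μ₁ p)),
    Φ (ract p g) (Γ₁.R.E.tr (right_principal.proj_act p g hg).symm α) =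
      Γ₂.R.act (Γ₂.G.inv g) ((Γ₂.G.s_inv g).trans hg.symm)
        ((Γ₂.G.t_inv g).trans (right_principal.moment_act p g hg).symm) (Φ p α)

/-- The fibred product `P₁ ×_{X₁} P`. -/
abbrev PfaffianBibundle.fib {Γ₁ Γ₂ : PfaffianGroupoid.{u}} (Q : PfaffianBibundle Γ₁ Γ₂)
    {M : Mfd.{u}} (B₁ : PrincipalPfaffianBundle Γ₁ M) : Set (B₁.P × Q.P) :=
  fibProd B₁.μ Q.μ₁

/-- The map `q : P₁ ×_{X₁} P → P₂` exhibits the principal `(Σ₂, ω₂, E₂)`-bundle `(P₂, θ₂)` over `M`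
as the transport of the principal `(Σ₁, ω₁, E₁)`-bundle `(P₁, θ₁)` over `M` through the bibundle
`(P, θ, Φ)`: `q` is a quotient map of manifolds for the diagonal action of `Σ₁`, it is compatible
with the projections, the moment maps and the action of `Σ₂` on `P`, and the form on `P₂`
is the one that descends from `Φ ∘ (pr₂^*θ - pr₁^*θ₁)`. The latter makes `P₂` a *right* principal
Pfaffian bundle; turning it into a left one means letting `g` act by `g⁻¹` and, because
`i^*ω = - g⁻¹ · ω` for the inversion `i`, changing the sign of the form. -/
structure PfaffianBibundle.IsQuotientMap {Γ₁ Γ₂ : PfaffianGroupoid.{u}}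
    (Q : PfaffianBibundle Γ₁ Γ₂) {M : Mfd.{u}} (B₁ : PrincipalPfaffianBundle Γ₁ M)
    (B₂ : PrincipalPfaffianBundle Γ₂ M) (q : B₁.P × Q.P → B₂.P) : Prop where
  smooth : SmoothOn q (Q.fib B₁)
  surj : ∀ y, ∃ x ∈ Q.fib B₁, q x = y
  submersive : ∀ (p₁ : B₁.P) (p : Q.P) (_ : B₁.μ p₁ = Q.μ₁ p) (w : B₂.P.T (q (p₁, p))),
    ∃ (v₁ : B₁.P.T p₁) (v : Q.P.T p), TangentToFib B₁.μ Q.μ₁ v₁ v ∧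
      diffOn q (Q.fib B₁) p₁ p v₁ v = w
  /-- the fibres of `q` are the orbits of the diagonal action of `Σ₁` -/
  orbits : ∀ x ∈ Q.fib B₁, ∀ y ∈ Q.fib B₁, q x = q y ↔
    ∃ g, Γ₁.G.s g = B₁.μ x.1 ∧ y = (B₁.act g x.1, Q.lact g x.2)
  proj_eq : ∀ x ∈ Q.fib B₁, B₂.proj (q x) = B₁.proj x.1
  moment_eq : ∀ x ∈ Q.fib B₁, B₂.μ (q x) = Q.μ₂ x.2
  equivariant : ∀ x ∈ Q.fib B₁, ∀ g, Q.μ₂ x.2 = Γ₂.G.t g →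
    q (x.1, Q.ract x.2 g) = B₂.act (Γ₂.G.inv g) (q x)
  form_eq : ∀ (p₁ : B₁.P) (p : Q.P) (hp : B₁.μ p₁ = Q.μ₁ p) (hm : B₂.μ (q (p₁, p)) = Q.μ₂ p)
    (v₁ : B₁.P.T p₁) (v : Q.P.T p), TangentToFib B₁.μ Q.μ₁ v₁ v →
    - B₂.θ.val (q (p₁, p)) hm (diffOn q (Q.fib B₁) p₁ p v₁ v) =
      Q.Φ p (Q.θ p v - B₁.θ.val p₁ hp v₁)

end Pfaffian

end

namespace Pfaffian

open scoped Manifold ContDiff Topology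
open Bundle Set Filter Module

/-! ### Local normal form of submersions -/

section NormedSpace

variable {E E' F : Type*} [NormedAddCommGroup E] [NormedSpace ℝ E] [FiniteDimensional ℝ E]
  [NormedAddCommGroup E'] [NormedSpace ℝ E'] [FiniteDimensional ℝ E']
  [NormedAddCommGroup F] [NormedSpace ℝ F] [FiniteDimensional ℝ F]

/-! A bibundle `Q` defines a relation between bundles over `M`: `B₁` is related to `B₂` when some
`q` exhibits `B₂` as the quotient of `P₁ ×_{X₁} P` by the diagonal action (`Transports`). The
theorem says that this relation is the graph of a bijection on isomorphism classes. Three facts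
suffice: every `B₁` has a transport (`exists_transports`), two transports of the same `B₁` are
isomorphic (`IsQuotientMap.iso`), and transport through the opposite bibundle `(P, -Φ ∘ θ, Φ⁻¹)` is
the inverse relation (`IsQuotientMap.op`, with `of_op_op` for the way back). Existence and
uniqueness for the opposite then give surjectivity and injectivity.

Analytically, everything rests on the division map of a principal bundle, which takes `(p, p')` in
one fibre to the arrow `g` with `g · p = p'`. Freeness and properness make it continuous. For
smoothness, consider the orbit map of a point on a source fibre. It is injective, its differential
has a kernel at all points or at none because arrows translate one point to another, and it is
locally onto because its inverse is continuous. An injective smooth map is an immersion somewhere,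
so this one is an immersion everywhere; being locally onto, it cannot raise dimension, so its
differential is invertible (`bijective_fderiv_orbit`). The inverse function theorem with the point
as a parameter gives `div_smooth`.

Over a local section `σ` of `P₁ → M`, division moves each pair `(p₁, p)` to one whose first entry
lies on `σ`, so the quotient looks locally like the pullback of `P → X₁` along the moment map of
`σ`. This gives charts and local lifts (`exists_sliceChart`, `exists_quotient_mfd`). The action of
`Σ₂` on `P` descends to a principal action (`DiagonalQuotient.principal`).

The form descends because two lifts of one curve differ by a differentiable curve of arrows. By
multiplicativity `θ` and `θ₁` change by the same `ω₁`-term, which cancels in `θ - θ₁`, and `Φ`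
absorbs the remaining action (`diagForm_basic`). Multiplicativity for `Σ₂` comes from that of `Φ ∘
θ`. For the kernel condition, a tangent vector of the quotient that is killed by the form and by one
of the two maps lifts so that one component of the pair is constant; the kernel condition of the
other factor then applies.

For the inverse relation, `(p₁, p) ↦ (q(p₁, p), p)` identifies `P₁ ×_{X₁} P` with `P₂ ×_{X₂} P`. The
first projection, read on the second space, is the quotient map `rev` by `Σ₂`, and the equation of
forms is solved for `θ₁` instead of `θ₂`.

Differentials on fibred products are computed throughout with curves that are differentiable at `0`
and lie in the fibred product near `0`. -/

theorem exists_localInverse {G : E → F} {U : Set E} (hU : IsOpen U) {a : E} (ha : a ∈ U)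
    (hG : ContDiffOn ℝ ∞ G U) (hbij : Function.Bijective (fderiv ℝ G a)) :
    ∃ e : OpenPartialHomeomorph E F, a ∈ e.source ∧ e.source ⊆ U ∧ (∀ x, e x = G x) ∧
      ContDiffOn ℝ ∞ e.symm e.target := by
  have : CompleteSpace E := FiniteDimensional.complete ℝ E
  have : CompleteSpace F := FiniteDimensional.complete ℝ F
  let f' : E ≃L[ℝ] F := ContinuousLinearEquiv.ofBijective (fderiv ℝ G a)
    (LinearMap.ker_eq_bot.2 hbij.1) (LinearMap.range_eq_top.2 hbij.2)
  have hGa : ContDiffAt ℝ ∞ G a := hG.contDiffAt (hU.mem_nhds ha)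
  have hf' : HasFDerivAt G (f' : E →L[ℝ] F) a :=
    (hGa.differentiableAt (by simp)).hasFDerivAt
  have hcont : ContinuousOn (fderiv ℝ G) U := hG.continuousOn_fderiv_of_isOpen hU (by simp)
  -- The inverse function theorem gives smoothness of the inverse at one point only. Restricting to
  -- the open set where the differential of `G` is invertible makes it apply at every point of the
  -- target.
  have hopen := hcont.isOpen_inter_preimage hU
    (ContinuousLinearEquiv.isOpen (𝕜 := ℝ) (E := E) (F := F))
  set V : Set E := U ∩ fderiv ℝ G ⁻¹' range ((↑) : (E ≃L[ℝ] F) → E →L[ℝ] F) with hV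
  set e₀ := hGa.toOpenPartialHomeomorph G hf' (by simp) with he₀
  refine ⟨e₀.restrOpen V hopen, ?_, ?_, fun x => rfl, ?_⟩
  · rw [OpenPartialHomeomorph.restrOpen_source]
    exact ⟨hGa.mem_toOpenPartialHomeomorph_source hf' (by simp), ha, f', rfl⟩
  · rw [OpenPartialHomeomorph.restrOpen_source]
    exact fun x hx => hx.2.1
  · intro z hz
    have hz' : (e₀.restrOpen V hopen).symm z ∈ (e₀.restrOpen V hopen).source :=
      (e₀.restrOpen V hopen).map_target hz
    rw [OpenPartialHomeomorph.restrOpen_source] at hz'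
    obtain ⟨f₁, hf₁⟩ := hz'.2.2
    have h1 : ContDiffAt ℝ ∞ G ((e₀.restrOpen V hopen).symm z) :=
      hG.contDiffAt (hU.mem_nhds hz'.2.1)
    refine (OpenPartialHomeomorph.contDiffAt_symm (e₀.restrOpen V hopen) (f₀' := f₁) hz ?_
      h1).contDiffWithinAt
    rw [hf₁]
    exact (h1.differentiableAt (by simp)).hasFDerivAt

/-- `L` is a linear retraction onto `ker f` followed by an isomorphism of `ker f` with `F`. A vector
killed by `f` and by `L` is its own retraction, hence zero; dimensions do the rest. -/
theorem exists_complementary_map {f : E →L[ℝ] E'} (hf : Function.Surjective f)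
    (hF : finrank ℝ E' + finrank ℝ F = finrank ℝ E) :
    ∃ L : E →L[ℝ] F, Function.Bijective (f.prod L) := by
  obtain ⟨r, hr⟩ := LinearMap.exists_leftInverse_of_injective
    (LinearMap.ker f.toLinearMap).subtype (Submodule.ker_subtype _)
  have hdim : finrank ℝ (LinearMap.ker f.toLinearMap) = finrank ℝ F := by
    have h1 := LinearMap.finrank_range_add_finrank_ker f.toLinearMap
    rw [LinearMap.range_eq_top.2 hf, finrank_top] at h1
    omega
  let i := LinearEquiv.ofFinrankEq _ _ hdim
  refine ⟨LinearMap.toContinuousLinearMap (i.toLinearMap.comp r), ?_⟩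
  have hinj : Function.Injective (f.prod (LinearMap.toContinuousLinearMap
      (i.toLinearMap.comp r))).toLinearMap := by
    refine LinearMap.ker_eq_bot.1 (LinearMap.ker_eq_bot'.2 fun x hx => ?_)
    have hx1 : f x = 0 := congrArg Prod.fst hx
    have hx2 : i (r x) = 0 := congrArg Prod.snd hx
    have hx3 : r x = 0 := by simpa using hx2
    have := LinearMap.congr_fun hr ⟨x, hx1⟩
    simp only [LinearMap.comp_apply, Submodule.subtype_apply, LinearMap.id_apply, hx3] at this
    exact (congrArg Subtype.val this).symm
  exact ⟨hinj, (LinearMap.injective_iff_surjective_of_finrank_eq_finrank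
    (by rw [finrank_prod, hF])).1 hinj⟩

theorem exists_straightening_normed {f : E → E'} {U : Set E} (hU : IsOpen U) {a : E} (ha : a ∈ U)
    (hf : ContDiffOn ℝ ∞ f U) (hsurj : Function.Surjective (fderiv ℝ f a))
    (hF : finrank ℝ E' + finrank ℝ F = finrank ℝ E) :
    ∃ (L : E →L[ℝ] F) (e : OpenPartialHomeomorph E (E' × F)), a ∈ e.source ∧ e.source ⊆ U ∧
      (∀ x, e x = (f x, L x)) ∧ ContDiffOn ℝ ∞ e.symm e.target := by
  obtain ⟨L, hL⟩ := exists_complementary_map hsurj hF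
  have hd : HasFDerivAt f (fderiv ℝ f a) a :=
    ((hf.contDiffAt (hU.mem_nhds ha)).differentiableAt (by simp)).hasFDerivAt
  obtain ⟨e, h1, h2, h3, h4⟩ := exists_localInverse (G := fun x => (f x, L x)) hU ha
    (hf.prodMk L.contDiff.contDiffOn) (by rwa [(hd.prodMk L.hasFDerivAt).fderiv])
  exact ⟨L, e, h1, h2, h3, h4⟩

end NormedSpace

section Manifold

variable {E H N E' H' X F : Type*} [NormedAddCommGroup E] [NormedSpace ℝ E] [FiniteDimensional ℝ E]
  [NormedAddCommGroup E'] [NormedSpace ℝ E'] [FiniteDimensional ℝ E']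
  [NormedAddCommGroup F] [NormedSpace ℝ F] [FiniteDimensional ℝ F]
  [TopologicalSpace H] [TopologicalSpace H'] [TopologicalSpace N] [TopologicalSpace X]
  [ChartedSpace H N] [ChartedSpace H' X]
  {I : ModelWithCorners ℝ E H} {J : ModelWithCorners ℝ E' H'} [I.Boundaryless]
  [IsManifold I ∞ N] [IsManifold J ∞ X]

/-- Near a point where its differential is onto, a smooth map `f` is, up to a diffeomorphism
`n ↦ (f n, y n)` with inverse `Ψ`, the projection of a product. -/
theorem exists_straightening {f : N → X} {U : Set N} (hU : IsOpen U) {a : N} (ha : a ∈ U)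
    (hf : ContMDiffOn I J ∞ f U) (hsurj : Function.Surjective (mfderiv I J f a))
    (hF : finrank ℝ E' + finrank ℝ F = finrank ℝ E) :
    ∃ (y : N → F) (Ψ : X × F → N) (W : Set N) (V : Set (X × F)), IsOpen W ∧ a ∈ W ∧ W ⊆ U ∧
      IsOpen V ∧ ContMDiffOn I 𝓘(ℝ, F) ∞ y W ∧ ContMDiffOn (J.prod 𝓘(ℝ, F)) I ∞ Ψ V ∧
      (∀ n ∈ W, (f n, y n) ∈ V ∧ Ψ (f n, y n) = n) ∧
      ∀ z ∈ V, Ψ z ∈ W ∧ f (Ψ z) = z.1 ∧ y (Ψ z) = z.2 := by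
  set φ := extChartAt I a with hφ
  set ψ := extChartAt J (f a) with hψ
  have hsrcI : φ.source = (chartAt H a).source := extChartAt_source I a
  have hsrcJ : ψ.source = (chartAt H' (f a)).source := extChartAt_source J (f a)
  have hU₁ : IsOpen (U ∩ f ⁻¹' ψ.source) :=
    hf.continuousOn.isOpen_inter_preimage hU (isOpen_extChartAt_source (I := J) (f a))
  have htarget : IsOpen φ.target := isOpen_extChartAt_target (I := I) a
  have hφs : ContMDiffOn 𝓘(ℝ, E) I ∞ φ.symm φ.target := contMDiffOn_extChartAt_symm a
  have hφc : ContMDiffOn I 𝓘(ℝ, E) ∞ φ φ.source := hsrcI ▸ contMDiffOn_extChartAt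
  have hψc : ContMDiffOn J 𝓘(ℝ, E') ∞ ψ ψ.source := hsrcJ ▸ contMDiffOn_extChartAt
  have hU₂ : IsOpen (φ.target ∩ φ.symm ⁻¹' (U ∩ f ⁻¹' ψ.source)) :=
    hφs.continuousOn.isOpen_inter_preimage htarget hU₁
  set U₂ := φ.target ∩ φ.symm ⁻¹' (U ∩ f ⁻¹' ψ.source) with hU₂d
  have hfhat : ContDiffOn ℝ ∞ (ψ ∘ f ∘ φ.symm) U₂ := by
    rw [← contMDiffOn_iff_contDiffOn]
    refine hψc.comp (hf.comp (hφs.mono fun x hx => hx.1) fun x hx => hx.2.1) fun x hx => hx.2.2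
  have haφ : φ a ∈ U₂ := by
    refine ⟨mem_extChartAt_target a, ?_⟩
    simp only [mem_preimage, hφ, extChartAt_to_inv]
    exact ⟨ha, mem_extChartAt_source (I := J) (f a)⟩
  have hmd : MDifferentiableAt I J f a :=
    (hf.contMDiffAt (hU.mem_nhds ha)).mdifferentiableAt (by simp)
  -- The manifold differential is by definition the derivative of the chart expression within the
  -- range of `I`, and this range is everything for a manifold without boundary.
  have hs : Function.Surjective (fderiv ℝ (ψ ∘ f ∘ φ.symm) (φ a)) := by
    have h := hmd.mfderiv
    rw [I.range_eq_univ, fderivWithin_univ] at h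
    rw [h] at hsurj
    exact hsurj
  obtain ⟨L, e, he1, he2, he3, he4⟩ := exists_straightening_normed (F := F) hU₂ haφ hfhat hs hF
  have hW : IsOpen (φ.source ∩ φ ⁻¹' e.source) :=
    hφc.continuousOn.isOpen_inter_preimage (isOpen_extChartAt_source a) e.open_source
  have hg : ContMDiffOn (J.prod 𝓘(ℝ, F)) 𝓘(ℝ, E' × F) ∞ (fun z : X × F => (ψ z.1, z.2))
      (ψ.source ×ˢ univ) := by
    rw [modelWithCornersSelf_prod, ← chartedSpaceSelf_prod]
    exact (hψc.comp contMDiffOn_fst fun z hz => hz.1).prodMk contMDiffOn_snd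
  have hV : IsOpen ((ψ.source ×ˢ univ) ∩ (fun z : X × F => (ψ z.1, z.2)) ⁻¹' e.target) :=
    hg.continuousOn.isOpen_inter_preimage
      ((isOpen_extChartAt_source (I := J) (f a)).prod isOpen_univ) e.open_target
  refine ⟨fun n => L (φ n), fun z => φ.symm (e.symm (ψ z.1, z.2)), _, _, hW,
    ⟨mem_extChartAt_source a, he1⟩, ?_, hV, ?_, ?_, ?_, ?_⟩
  · intro n hn
    have := (he2 hn.2).2.1
    rwa [φ.left_inv hn.1] at this
  · exact (L.contDiff.contMDiff (n := ∞)).comp_contMDiffOn (hφc.mono fun n hn => hn.1)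
  · refine hφs.comp ((contMDiffOn_iff_contDiffOn.2 he4).comp (hg.mono fun z hz => hz.1)
      fun z hz => hz.2) fun z hz => (he2 (e.map_target hz.2)).1
  · intro n hn
    have hn2 := (he2 hn.2).2
    rw [mem_preimage, φ.left_inv hn.1] at hn2
    have key : (ψ (f n), L (φ n)) = e (φ n) := by
      rw [he3]; simp [φ.left_inv hn.1]
    refine ⟨⟨⟨hn2.2, mem_univ _⟩, ?_⟩, ?_⟩
    · simp only [mem_preimage, key]
      exact e.map_source hn.2
    · simp only [key, e.left_inv hn.2, φ.left_inv hn.1]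
  · rintro ⟨x, v⟩ ⟨⟨hx, -⟩, hz⟩
    simp only at hx
    have h1 := e.map_target hz
    have h2 := he2 h1
    have h3 := e.right_inv hz
    simp only at h1 h2 h3 ⊢
    rw [he3] at h3
    have h4 : φ (φ.symm (e.symm (ψ x, v))) = e.symm (ψ x, v) := φ.right_inv h2.1
    refine ⟨⟨φ.map_target h2.1, ?_⟩, ?_, ?_⟩
    · rw [mem_preimage, h4]; exact h1
    · exact ψ.injOn h2.2.2 hx (congrArg Prod.fst h3)
    · rw [h4]; exact congrArg Prod.snd h3

/-- A submersion has smooth local lifts `(n, x) ↦ lam (n, x)` that send `(n, f n)` to `n`. -/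
theorem exists_submersion_lift {f : N → X} {U : Set N} (hU : IsOpen U) {a : N} (ha : a ∈ U)
    (hf : ContMDiffOn I J ∞ f U) (hsurj : Function.Surjective (mfderiv I J f a)) :
    ∃ (lam : N × X → N) (W : Set (N × X)), IsOpen W ∧ (a, f a) ∈ W ∧
      ContMDiffOn (I.prod J) I ∞ lam W ∧ (∀ z ∈ W, lam z ∈ U ∧ f (lam z) = z.2) ∧
      ∀ n, (n, f n) ∈ W → lam (n, f n) = n := by
  have hle : finrank ℝ E' ≤ finrank ℝ E :=
    LinearMap.finrank_le_finrank_of_surjective (f := (mfderiv I J f a : E →L[ℝ] E').toLinearMap)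
      hsurj
  obtain ⟨y, Ψ, W, V, hW, haW, hWU, hV, hy, hΨ, h1, h2⟩ := exists_straightening
    (F := EuclideanSpace ℝ (Fin (finrank ℝ E - finrank ℝ E'))) hU ha hf hsurj (by simp; omega)
  have hg : ContMDiffOn (I.prod J) (J.prod (𝓡 (finrank ℝ E - finrank ℝ E'))) ∞
      (fun z : N × X => (z.2, y z.1)) (W ×ˢ univ) :=
    contMDiffOn_snd.prodMk (hy.comp contMDiffOn_fst fun z hz => hz.1)
  -- The lift keeps the transverse coordinate `y n` and replaces the base coordinate `f n` by `x`.
  refine ⟨fun z => Ψ (z.2, y z.1), _,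
    hg.continuousOn.isOpen_inter_preimage (hW.prod isOpen_univ) hV,
    ⟨⟨haW, mem_univ _⟩, (h1 a haW).1⟩, hΨ.comp (hg.mono fun z hz => hz.1) fun z hz => hz.2,
    fun z hz => ⟨hWU (h2 _ hz.2).1, (h2 _ hz.2).2.1⟩, fun n hn => (h1 n hn.1.1).2⟩

theorem exists_local_section {f : N → X} {U : Set N} (hU : IsOpen U) {a : N} (ha : a ∈ U)
    (hf : ContMDiffOn I J ∞ f U) (hsurj : Function.Surjective (mfderiv I J f a)) :
    ∃ (σ : X → N) (O : Set X), IsOpen O ∧ f a ∈ O ∧ ContMDiffOn J I ∞ σ O ∧ σ (f a) = a ∧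
      ∀ x ∈ O, σ x ∈ U ∧ f (σ x) = x := by
  obtain ⟨lam, W, hW, haW, hlam, h1, h2⟩ := exists_submersion_lift hU ha hf hsurj
  exact ⟨fun x => lam (a, x), (fun x => (a, x)) ⁻¹' W, hW.preimage (by fun_prop), haW,
    hlam.comp (contMDiffOn_const.prodMk contMDiffOn_id) fun x hx => hx, h2 a haW,
    fun x hx => h1 _ hx⟩

end Manifold

/-! ### Velocities of curves -/

section Velocity

variable {E H N E' H' N' E'' H'' N'' : Type*} [NormedAddCommGroup E] [NormedSpace ℝ E]
  [NormedAddCommGroup E'] [NormedSpace ℝ E'] [NormedAddCommGroup E''] [NormedSpace ℝ E'']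
  [TopologicalSpace H] [TopologicalSpace H'] [TopologicalSpace H'']
  [TopologicalSpace N] [TopologicalSpace N'] [TopologicalSpace N'']
  [ChartedSpace H N] [ChartedSpace H' N'] [ChartedSpace H'' N'']
  {I : ModelWithCorners ℝ E H} {J : ModelWithCorners ℝ E' H'} {K : ModelWithCorners ℝ E'' H''}

/-- The curve `c` has velocity `v` at time `0`. Tangent spaces are all definitionally the model
space, in which `v` is taken. -/
def HasVel (I : ModelWithCorners ℝ E H) (c : ℝ → N) (v : E) : Prop :=
  HasMFDerivAt 𝓘(ℝ, ℝ) I c 0 ((1 : ℝ →L[ℝ] ℝ).smulRight v : ℝ →L[ℝ] E)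

theorem hasVel_of_hasMFDerivAt {c : ℝ → N} {L : ℝ →L[ℝ] E} (h : HasMFDerivAt 𝓘(ℝ, ℝ) I c 0 L) :
    HasVel I c (L 1) := by
  have : ((1 : ℝ →L[ℝ] ℝ).smulRight (L 1) : ℝ →L[ℝ] E) = L := by ext; simp
  unfold HasVel
  rw [this]
  exact h

theorem HasVel.unique {c : ℝ → N} {v w : E} (h : HasVel I c v) (h' : HasVel I c w) : v = w := by
  have := hasMFDerivAt_unique h h'
  have h2 := congrArg (fun L : ℝ →L[ℝ] E => L 1) this
  simpa using h2

theorem HasVel.congr {c c' : ℝ → N} {v : E} (h : HasVel I c v) (hc : c' =ᶠ[𝓝 0] c) :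
    HasVel I c' v :=
  HasMFDerivAt.congr_of_eventuallyEq h hc

theorem HasVel.continuousAt {c : ℝ → N} {v : E} (h : HasVel I c v) : ContinuousAt c 0 := h.1

theorem HasVel.eventually_mem {c : ℝ → N} {v : E} (h : HasVel I c v) {U : Set N} (hU : IsOpen U)
    (h0 : c 0 ∈ U) : ∀ᶠ t in 𝓝 0, c t ∈ U :=
  h.continuousAt.preimage_mem_nhds (hU.mem_nhds h0)

theorem hasVel_const (a : N) : HasVel I (fun _ => a) 0 := by
  exact hasVel_of_hasMFDerivAt (hasMFDerivAt_const (I := 𝓘(ℝ, ℝ)) (I' := I) a (0 : ℝ))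

theorem HasVel.prodMk {c : ℝ → N} {c' : ℝ → N'} {v : E} {w : E'} (h : HasVel I c v)
    (h' : HasVel J c' w) : HasVel (I.prod J) (fun t => (c t, c' t)) (v, w) := by
  have := hasVel_of_hasMFDerivAt (HasMFDerivAt.prodMk h h')
  convert this using 1
  exact Prod.ext (one_smul ℝ v).symm (one_smul ℝ w).symm

/-- A derivative within `S` already controls curves that lie in `S` near `0`. Maps on fibred
products can thus be differentiated along curves, with no manifold structure on the fibred product.
-/
theorem HasVel.comp_hasMFDerivWithinAt {c : ℝ → N} {v : E} (h : HasVel I c v) {f : N → N'}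
    {S : Set N} {f' : E →L[ℝ] E'} (hf : HasMFDerivWithinAt I J f S (c 0) f')
    (hc : ∀ᶠ t in 𝓝 0, c t ∈ S) : HasVel J (fun t => f (c t)) (f' v) := by
  have h1 : HasMFDerivWithinAt 𝓘(ℝ, ℝ) J (f ∘ c) (c ⁻¹' S) 0
      (f'.comp ((1 : ℝ →L[ℝ] ℝ).smulRight v)) := by
    have := HasMFDerivWithinAt.comp (0 : ℝ) hf (s := c ⁻¹' S)
      (HasMFDerivAt.hasMFDerivWithinAt h) (Subset.refl _)
    exact this
  have h2 := hasVel_of_hasMFDerivAt (h1.hasMFDerivAt hc)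
  have h3 : (f'.comp ((1 : ℝ →L[ℝ] ℝ).smulRight v)) 1 = f' v := congrArg f' (one_smul ℝ v)
  exact h3 ▸ h2

theorem HasVel.comp_hasMFDerivAt {c : ℝ → N} {v : E} (h : HasVel I c v) {f : N → N'}
    {f' : E →L[ℝ] E'} (hf : HasMFDerivAt I J f (c 0) f') : HasVel J (fun t => f (c t)) (f' v) :=
  h.comp_hasMFDerivWithinAt (S := univ) hf.hasMFDerivWithinAt (by simp)

theorem HasVel.comp {c : ℝ → N} {v : E} (h : HasVel I c v) {f : N → N'}
    (hf : MDifferentiableAt I J f (c 0)) :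
    HasVel J (fun t => f (c t)) (mfderiv I J f (c 0) v : E') :=
  h.comp_hasMFDerivAt hf.hasMFDerivAt

theorem HasVel.compWithin {c : ℝ → N} {v : E} (h : HasVel I c v) {f : N → N'} {S : Set N}
    (hf : MDifferentiableWithinAt I J f S (c 0)) (hc : ∀ᶠ t in 𝓝 0, c t ∈ S) :
    HasVel J (fun t => f (c t)) (mfderivWithin I J f S (c 0) v : E') :=
  h.comp_hasMFDerivWithinAt hf.hasMFDerivWithinAt hc

/-- Every tangent vector is the velocity of a curve. -/
theorem exists_hasVel [I.Boundaryless] [IsManifold I ∞ N] (a : N) (v : E) :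
    ∃ c : ℝ → N, c 0 = a ∧ HasVel I c v := by
  set φ := extChartAt I a with hφ
  have h0 : HasDerivAt (fun t : ℝ => φ a + t • v) v 0 := by
    simpa using ((hasDerivAt_id (0 : ℝ)).smul_const v).const_add (φ a)
  have hmem : φ a + (0 : ℝ) • v ∈ φ.target := by
    rw [zero_smul, add_zero]; exact mem_extChartAt_target a
  have ht : IsOpen φ.target := isOpen_extChartAt_target a
  have hc0 : φ.symm (φ a + (0 : ℝ) • v) = a := by
    rw [zero_smul, add_zero]; exact extChartAt_to_inv a
  refine ⟨fun t => φ.symm (φ a + t • v), hc0, ?_, ?_⟩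
  · exact ContinuousAt.comp (f := fun t : ℝ => φ a + t • v)
      ((contMDiffOn_extChartAt_symm (I := I) (n := ∞) a).continuousOn.continuousAt
        (ht.mem_nhds hmem)) h0.continuousAt
  · have h1 : HasFDerivAt (fun t : ℝ => φ a + t • v)
        ((1 : ℝ →L[ℝ] ℝ).smulRight v : ℝ →L[ℝ] E) 0 := h0.hasFDerivAt
    have h2 : ∀ᶠ t in 𝓝 (0 : ℝ), φ a + t • v ∈ φ.target :=
      h0.continuousAt.preimage_mem_nhds (ht.mem_nhds hmem)
    have h3 := h1.congr_of_eventuallyEq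
      (f₁ := writtenInExtChartAt 𝓘(ℝ, ℝ) I (0 : ℝ) (fun t : ℝ => φ.symm (φ a + t • v))) (by
        filter_upwards [h2] with t ht
        rw [writtenInExtChartAt, hc0]
        exact φ.right_inv ht)
    exact h3.hasFDerivWithinAt

/-- Curves lift through submersions, with a prescribed velocity. -/
theorem exists_curve_lift [I.Boundaryless] [IsManifold I ∞ N] [IsManifold J ∞ N']
    [FiniteDimensional ℝ E] [FiniteDimensional ℝ E'] {f : N → N'} (hf : ContMDiff I J ∞ f) {a : N}
    (hsurj : Function.Surjective (mfderiv I J f a)) {x : ℝ → N'} {ξ : E'} (hx : HasVel J x ξ)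
    (hxa : f a = x 0) {v : E} (hv : (mfderiv I J f a v : E') = ξ) :
    ∃ c : ℝ → N, c 0 = a ∧ HasVel I c v ∧ ∀ᶠ t in 𝓝 0, f (c t) = x t := by
  obtain ⟨lam, W, hW, haW, hlam, h1, h2⟩ :=
    exists_submersion_lift isOpen_univ (mem_univ a) hf.contMDiffOn hsurj
  obtain ⟨c₀, rfl, hc₀⟩ := exists_hasVel (I := I) a v
  have hfc := hc₀.comp (hf.mdifferentiable (by simp) (c₀ 0))
  have hp1 := hc₀.prodMk hx
  have hp2 := hc₀.prodMk hfc
  have hd : MDifferentiableAt (I.prod J) I lam (c₀ 0, f (c₀ 0)) :=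
    (hlam.contMDiffAt (hW.mem_nhds haW)).mdifferentiableAt (by simp)
  have hd' : MDifferentiableAt (I.prod J) I lam (c₀ 0, x 0) := hxa ▸ hd
  have hc1 := hp1.comp hd'
  have hc2 := hp2.comp hd
  -- Since `lam (c₀, f c₀) = c₀` near `0`, the differential of `lam` sends `(v, df v)` to `v`. As
  -- `df v = ξ`, the corrected curve `lam (c₀, x)` still has velocity `v`.
  have hv2 : HasVel I c₀ (mfderiv (I.prod J) I lam (c₀ 0, f (c₀ 0)) (v, mfderiv I J f (c₀ 0) v)) :=
    hc2.congr (by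
      filter_upwards [hp2.eventually_mem hW haW] with t ht
      exact (h2 _ ht).symm)
  have hveq := hv2.unique hc₀
  have key : ∀ x₀, f (c₀ 0) = x₀ → (mfderiv (I.prod J) I lam (c₀ 0, x₀) (v, ξ) : E) = v := by
    rintro _ rfl
    rw [← hv]
    exact hveq
  refine ⟨fun t => lam (c₀ t, x t), ?_, key _ hxa ▸ hc1, ?_⟩
  · simp only [← hxa]
    exact h2 _ haW
  · filter_upwards [hp1.eventually_mem hW (hxa ▸ haW)] with t ht
    exact (h1 _ ht).2

end Velocity

section VelocityMfd

variable {A B C X : Mfd.{u}}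

/-- The curve `c` in `A` has velocity `v` at time `0`. -/
abbrev Vel (A : Mfd.{u}) (c : ℝ → A) (v : EuclideanSpace ℝ (Fin A.dim)) : Prop :=
  HasVel (𝓡 A.dim) c v

theorem Smooth.hasMFDerivAt {f : A → B} (hf : Smooth f) (a : A) :
    HasMFDerivAt (𝓡 A.dim) (𝓡 B.dim) f a (diff f a) :=
  (hf.mdifferentiable (by simp) a).hasMFDerivAt

theorem Smooth.vel {f : A → B} (hf : Smooth f) {c : ℝ → A} {v} (hc : Vel A c v) :
    Vel B (fun t => f (c t)) (diff f (c 0) v) :=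
  hc.comp_hasMFDerivAt (hf.hasMFDerivAt _)

theorem SmoothOn.vel {m : A × B → C} {S : Set (A × B)} (hm : SmoothOn m S) {c : ℝ → A} {c' : ℝ → B}
    {v w} (hc : Vel A c v) (hc' : Vel B c' w) (hS : ∀ᶠ t in 𝓝 0, (c t, c' t) ∈ S) :
    Vel C (fun t => m (c t, c' t)) (diffOn m S (c 0) (c' 0) v w) :=
  (hc.prodMk hc').compWithin ((hm _ hS.self_of_nhds).mdifferentiableWithinAt (by simp)) hS

/-- All tangent spaces of `X` are definitionally the same model space, so the heterogeneous equality
of the vector components is an ordinary one. -/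
theorem tangentToFib_iff {f : A → X} {g : B → X} {a : A} {b : B} {v : A.T a} {w : B.T b} :
    TangentToFib f g v w ↔ f a = g b ∧
      (diff f a v : EuclideanSpace ℝ (Fin X.dim)) = diff g b w := by
  unfold TangentToFib
  constructor
  · intro h
    rw [TotalSpace.mk.injEq] at h
    exact ⟨h.1, eq_of_heq h.2⟩
  · rintro ⟨h1, h2⟩
    rw [TotalSpace.mk.injEq]
    exact ⟨h1, heq_of_eq h2⟩

theorem tangentToFib_of_curves {f : A → X} {g : B → X} (hf : Smooth f) (hg : Smooth g) {c : ℝ → A}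
    {c' : ℝ → B} {v w} (hc : Vel A c v) (hc' : Vel B c' w) (h : ∀ᶠ t in 𝓝 0, f (c t) = g (c' t)) :
    TangentToFib f g (a := c 0) (b := c' 0) v w :=
  tangentToFib_iff.2 ⟨h.self_of_nhds, (hf.vel hc).unique ((hg.vel hc').congr h)⟩

theorem exists_vel (a : A) (v : A.T a) : ∃ c : ℝ → A, c 0 = a ∧ Vel A c v :=
  exists_hasVel (I := 𝓡 A.dim) a v

theorem IsSurjSubmersion.exists_lift {f : A → X} (hf : IsSurjSubmersion f) {x : ℝ → X} {ξ}
    (hx : Vel X x ξ) {a : A} (ha : f a = x 0) (v : A.T a)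
    (hv : (diff f a v : EuclideanSpace ℝ (Fin X.dim)) = ξ) :
    ∃ c : ℝ → A, c 0 = a ∧ Vel A c v ∧ ∀ᶠ t in 𝓝 0, f (c t) = x t :=
  exists_curve_lift hf.smooth (hf.submersive a) hx ha hv

theorem IsSurjSubmersion.exists_lift' {f : A → X} (hf : IsSurjSubmersion f) {x : ℝ → X} {ξ}
    (hx : Vel X x ξ) {a : A} (ha : f a = x 0) :
    ∃ (c : ℝ → A) (v : A.T a), c 0 = a ∧ Vel A c v ∧ ∀ᶠ t in 𝓝 0, f (c t) = x t := by
  obtain ⟨v, hv⟩ := hf.submersive a ξ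
  obtain ⟨c, h⟩ := hf.exists_lift hx ha v hv
  exact ⟨c, v, h⟩

/-- A vector tangent to a fibred product is the velocity of a curve in it. -/
theorem exists_curve_fibProd {f : A → X} {g : B → X} (hf : IsSurjSubmersion f) (hg : Smooth g)
    {a : A} {b : B} {v : A.T a} {w : B.T b} (h : TangentToFib f g v w) :
    ∃ (c : ℝ → A) (c' : ℝ → B), c 0 = a ∧ c' 0 = b ∧ Vel A c v ∧ Vel B c' w ∧
      ∀ᶠ t in 𝓝 0, f (c t) = g (c' t) := by
  obtain ⟨c', rfl, hc'⟩ := exists_vel b w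
  obtain ⟨h1, h2⟩ := tangentToFib_iff.1 h
  obtain ⟨c, h3, h4, h5⟩ := hf.exists_lift (hg.vel hc') h1 v h2
  exact ⟨c, c', h3, rfl, h4, hc', h5⟩

end VelocityMfd

/-! ### Injective smooth maps -/

section NormedSpace

variable {E F : Type*} [NormedAddCommGroup E] [NormedSpace ℝ E]
  [NormedAddCommGroup F] [NormedSpace ℝ F] [FiniteDimensional ℝ F]

theorem exists_max_rank (f : E → F) {O : Set E} (hne : O.Nonempty) :
    ∃ w ∈ O, ∀ w' ∈ O, finrank ℝ (LinearMap.range (fderiv ℝ f w').toLinearMap) ≤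
      finrank ℝ (LinearMap.range (fderiv ℝ f w).toLinearMap) := by
  set R := (fun w => finrank ℝ (LinearMap.range (fderiv ℝ f w).toLinearMap)) '' O
  have hb : BddAbove R := by
    refine ⟨finrank ℝ F, ?_⟩
    rintro _ ⟨w, -, rfl⟩
    exact Submodule.finrank_le _
  obtain ⟨w, hw, hw'⟩ := Nat.sSup_mem (hne.image _) hb
  refine ⟨w, hw, fun w' h => ?_⟩
  simp only at hw'
  rw [hw']
  exact le_csSup hb ⟨w', h, rfl⟩

variable [FiniteDimensional ℝ E]

/-- An injective smooth map is an immersion at some point. -/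
theorem exists_injective_fderiv {f : E → F} {O : Set E} (hO : IsOpen O) (hne : O.Nonempty)
    (hf : ContDiffOn ℝ ∞ f O) (hinj : InjOn f O) :
    ∃ w ∈ O, Function.Injective (fderiv ℝ f w) := by
  obtain ⟨w, hwO, hmax⟩ := exists_max_rank f hne
  refine ⟨w, hwO, ?_⟩
  by_contra hnot
  set A := (fderiv ℝ f w).toLinearMap with hA
  have hfd : ∀ x ∈ O, HasFDerivAt f (fderiv ℝ f x) x := fun x hx =>
    ((hf.contDiffAt (hO.mem_nhds hx)).differentiableAt (by simp)).hasFDerivAt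
  -- `L` projects onto the range of the differential `A` at the point of maximal rank, so that `L ∘
  -- f` is a submersion at `w` and can be straightened.
  obtain ⟨L₀, hL₀⟩ := LinearMap.exists_leftInverse_of_injective
    (LinearMap.range A).subtype (Submodule.ker_subtype _)
  set L : F →L[ℝ] LinearMap.range A := LinearMap.toContinuousLinearMap L₀ with hL
  have hLA : ∀ v, L (A v) = ⟨A v, v, rfl⟩ := fun v => LinearMap.congr_fun hL₀ ⟨A v, v, rfl⟩
  have hgd : ∀ x ∈ O, HasFDerivAt (fun x => L (f x)) (L.comp (fderiv ℝ f x)) x := fun x hx =>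
    L.hasFDerivAt.comp x (hfd x hx)
  have hg : ContDiffOn ℝ ∞ (fun x => L (f x)) O := L.contDiff.comp_contDiffOn hf
  have hsurj : Function.Surjective (fderiv ℝ (fun x => L (f x)) w) := by
    rw [(hgd w hwO).fderiv]
    rintro ⟨_, v, rfl⟩
    exact ⟨v, hLA v⟩
  obtain ⟨y, e, hwe, heO, he, hes⟩ := exists_straightening_normed
    (F := LinearMap.ker A) hO hwO hg hsurj (LinearMap.finrank_range_add_finrank_ker A)
  have hesd : ∀ z ∈ e.target, HasFDerivAt e.symm (fderiv ℝ e.symm z) z := fun z hz =>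
    ((hes.contDiffAt (e.open_target.mem_nhds hz)).differentiableAt (by simp)).hasFDerivAt
  -- the derivative of `L ∘ f ∘ e.symm` is the first projection
  have hproj : ∀ z ∈ e.target, ∀ v,
      L (fderiv ℝ f (e.symm z) (fderiv ℝ e.symm z v)) = v.1 := by
    intro z hz v
    have h1 := (hgd _ (heO (e.map_target hz))).comp z (hesd z hz)
    have h2 : HasFDerivAt ((fun x => L (f x)) ∘ e.symm)
        (ContinuousLinearMap.fst ℝ (LinearMap.range A) (LinearMap.ker A)) z := by
      refine hasFDerivAt_fst.congr_of_eventuallyEq ?_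
      filter_upwards [e.open_target.mem_nhds hz] with z' hz'
      have := e.right_inv hz'
      rw [he] at this
      exact congrArg Prod.fst this
    exact congrArg (fun T => T v) (h1.unique h2)
  -- In straightened coordinates `L` maps the range of `df` onto the range of `A`. By maximality of
  -- the rank at `w` the range of `df` is no larger, so `L` is injective on it. A vector `(0, v)`
  -- becomes zero after applying `L ∘ df`, hence already after applying `df`.
  have hker : ∀ z ∈ e.target, ∀ v,
      fderiv ℝ f (e.symm z) (fderiv ℝ e.symm z (0, v)) = 0 := by
    intro z hz v
    set R := LinearMap.range (fderiv ℝ f (e.symm z)).toLinearMap with hR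
    have hs : Function.Surjective (L.toLinearMap.comp R.subtype) := fun u =>
      ⟨⟨_, fderiv ℝ e.symm z (u, 0), rfl⟩, hproj z hz (u, 0)⟩
    have hle := LinearMap.finrank_le_finrank_of_surjective hs
    have hle' := hmax _ (heO (e.map_target hz))
    have hi := (LinearMap.injective_iff_surjective_of_finrank_eq_finrank
      (le_antisymm hle' hle)).2 hs
    have h0 : (⟨_, fderiv ℝ e.symm z (0, v), rfl⟩ : R) = 0 := by
      apply hi
      rw [map_zero]
      exact hproj z hz (0, v)
    exact congrArg Subtype.val h0
  have hpre : IsOpen ((fun v : LinearMap.ker A => ((e w).1, v)) ⁻¹' e.target) :=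
    e.open_target.preimage (by fun_prop)
  have hmem : (e w).2 ∈ (fun v : LinearMap.ker A => ((e w).1, v)) ⁻¹' e.target := e.map_source hwe
  obtain ⟨ε, hε, hball⟩ := Metric.isOpen_iff.1 hpre _ hmem
  have hder : ∀ v ∈ Metric.ball (e w).2 ε,
      HasFDerivAt (fun v : LinearMap.ker A => f (e.symm ((e w).1, v)))
        (0 : LinearMap.ker A →L[ℝ] F) v := by
    intro v hv
    have hz := hball hv
    have h1 : HasFDerivAt (fun v : LinearMap.ker A => ((e w).1, v))
        (ContinuousLinearMap.inr ℝ (LinearMap.range A) (LinearMap.ker A)) v :=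
      hasFDerivAt_prodMk_right _ _
    have h2 := ((hfd _ (heO (e.map_target hz))).comp _ (hesd _ hz)).comp v h1
    have h3 : ((fderiv ℝ f (e.symm ((e w).1, v))).comp (fderiv ℝ e.symm ((e w).1, v))).comp
        (ContinuousLinearMap.inr ℝ (LinearMap.range A) (LinearMap.ker A)) = 0 :=
      ContinuousLinearMap.ext fun u => hker _ hz u
    exact h3 ▸ h2
  -- So `f` is constant on a slice through `w` in the directions of `ker A`. A nonzero kernel would
  -- give a second point of this slice, against injectivity.
  have hconst : ∀ v ∈ Metric.ball (e w).2 ε, f (e.symm ((e w).1, v)) = f w := by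
    intro v hv
    have := (Metric.isOpen_ball).is_const_of_fderiv_eq_zero (𝕜 := ℝ)
      (convex_ball (e w).2 ε).isPreconnected
      (fun v hv => (hder v hv).differentiableAt.differentiableWithinAt)
      (fun v hv => (hder v hv).fderiv) hv (Metric.mem_ball_self hε)
    exact this.trans (congrArg f (e.left_inv hwe))
  have hntr : Nontrivial (LinearMap.ker A) := by
    rw [Submodule.nontrivial_iff_ne_bot]
    exact fun h => hnot (LinearMap.ker_eq_bot.1 h)
  obtain ⟨u, hu⟩ := exists_ne (0 : LinearMap.ker A)
  obtain ⟨δ, hδ, hδ'⟩ : ∃ δ : ℝ, δ ≠ 0 ∧ (e w).2 + δ • u ∈ Metric.ball (e w).2 ε := by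
    have hn : 0 < ‖u‖ := norm_pos_iff.2 hu
    refine ⟨ε / (2 * ‖u‖), by positivity, ?_⟩
    rw [mem_ball_iff_norm, add_sub_cancel_left, norm_smul, Real.norm_of_nonneg (by positivity)]
    field_simp
    linarith
  have hz := hball hδ'
  have h1 := hinj (heO (e.map_target hz)) hwO (hconst _ hδ')
  have h2 := e.right_inv hz
  rw [h1] at h2
  have h3 := congrArg Prod.snd h2
  simp only [left_eq_add] at h3
  exact (smul_ne_zero hδ hu) h3

/-- An injective smooth map is an immersion somewhere, and `hker`, a homogeneity assumption, carries
this to `a`. A map into a space of larger dimension cannot have neighbourhoods of `f a` as images,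
so `hnhds` forces equal dimensions. -/
theorem bijective_fderiv_of_injOn {f : E → F} {O : Set E} (hO : IsOpen O) {a : E} (ha : a ∈ O)
    (hf : ContDiffOn ℝ ∞ f O) (hinj : InjOn f O) (hnhds : ∀ s ∈ 𝓝 a, f '' s ∈ 𝓝 (f a))
    (hker : ¬ Function.Injective (fderiv ℝ f a) → ∀ w ∈ O, ¬ Function.Injective (fderiv ℝ f w)) :
    Function.Bijective (fderiv ℝ f a) := by
  have hi : Function.Injective (fderiv ℝ f a) := by
    by_contra h
    obtain ⟨w, hw, hw'⟩ := exists_injective_fderiv hO ⟨a, ha⟩ hf hinj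
    exact hker h w hw hw'
  refine ⟨hi, ?_⟩
  have hle := LinearMap.finrank_le_finrank_of_injective (f := (fderiv ℝ f a).toLinearMap) hi
  rcases hle.lt_or_eq with hlt | heq
  · exfalso
    obtain ⟨ε, hε, hball⟩ := Metric.isOpen_iff.1 hO a ha
    -- A `C¹` image of a subset of `E` has Hausdorff dimension at most `dim E < dim F`, so its
    -- complement is dense and meets the alleged neighbourhood of `f a`.
    have hd : Dense (f '' Metric.ball a ε)ᶜ :=
      ((hf.mono hball).of_le (by simp)).dense_compl_image_of_dimH_lt_finrank (convex_ball a ε)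
        Subset.rfl (lt_of_le_of_lt (dimH_mono (subset_univ _)) (by
          rw [Real.dimH_univ_eq_finrank]; exact_mod_cast hlt))
    obtain ⟨x, hx, hx'⟩ := mem_closure_iff_nhds.1 (hd (f a)) _
      (hnhds _ (Metric.ball_mem_nhds a hε))
    exact hx' hx
  · exact (LinearMap.injective_iff_surjective_of_finrank_eq_finrank heq).1 hi

end NormedSpace

theorem HasVel.of_eq {E H N : Type*} [NormedAddCommGroup E] [NormedSpace ℝ E] [TopologicalSpace H]
    [TopologicalSpace N] [ChartedSpace H N] {I : ModelWithCorners ℝ E H} {c : ℝ → N} {v w : E}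
    (h : HasVel I c v) (e : v = w) : HasVel I c w := e ▸ h

/-! ### Elementary groupoid identities -/

namespace LieGroupoid

variable (G : LieGroupoid.{u})

theorem inv_mul_cancel_left {g h : G.arr} (hgh : G.s g = G.t h) :
    G.mul (G.inv g) (G.mul g h) = h := by
  rw [← G.mul_assoc _ _ _ (G.s_inv g) hgh, G.inv_mul, hgh, G.one_mul]

theorem mul_inv_cancel_left {g h : G.arr} (hgh : G.t g = G.t h) :
    G.mul g (G.mul (G.inv g) h) = h := by
  rw [← G.mul_assoc _ _ _ (G.t_inv g).symm ((G.s_inv g).trans hgh), G.mul_inv, hgh, G.one_mul]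

theorem mul_inv_cancel_right {g h : G.arr} (hgh : G.s g = G.s h) :
    G.mul (G.mul g (G.inv h)) h = g := by
  rw [G.mul_assoc _ _ _ (hgh.trans (G.t_inv h).symm) (G.s_inv h), G.inv_mul, ← hgh, G.mul_one]

theorem eq_inv_of_mul_eq_one {g h : G.arr} (hgh : G.s g = G.t h) (h1 : G.mul g h = G.one (G.t g)) :
    h = G.inv g := by
  have := G.inv_mul_cancel_left hgh
  rw [h1, ← G.s_inv g, G.mul_one] at this
  exact this.symm

theorem inv_inv (g : G.arr) : G.inv (G.inv g) = g :=
  (G.eq_inv_of_mul_eq_one (G.s_inv g) ((G.inv_mul g).trans (by rw [G.t_inv]))).symm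

theorem inv_one (x : G.X) : G.inv (G.one x) = G.one x := by
  refine (G.eq_inv_of_mul_eq_one ?_ ?_).symm
  · rw [G.s_one, G.t_one]
  · conv_lhs => rw [← G.t_one x]
    rw [G.t_one]
    conv_lhs => enter [2]; rw [← G.t_one x]
    have := G.one_mul (G.one x)
    rw [G.t_one] at this ⊢
    exact this

theorem inv_mul_rev {g h : G.arr} (hgh : G.s g = G.t h) :
    G.inv (G.mul g h) = G.mul (G.inv h) (G.inv g) := by
  have h2 : G.s (G.inv h) = G.t (G.inv g) := by rw [G.s_inv, G.t_inv, hgh]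
  refine (G.eq_inv_of_mul_eq_one ?_ ?_).symm
  · rw [G.s_mul g h hgh, G.t_mul _ _ h2, G.t_inv]
  · rw [G.t_mul g h hgh, G.mul_assoc g h _ hgh (by rw [G.t_mul _ _ h2, G.t_inv]),
      ← G.mul_assoc h _ _ (G.t_inv h).symm h2, G.mul_inv, ← hgh, ← G.t_inv g, G.one_mul, G.mul_inv]

end LieGroupoid

theorem diffOn_zero {A B C : Mfd.{u}} (m : A × B → C) (S : Set (A × B)) (a : A) (b : B) :
    (diffOn m S a b 0 0 : EuclideanSpace ℝ (Fin C.dim)) = 0 :=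
  map_zero (mfderivWithin ((𝓡 A.dim).prod (𝓡 B.dim)) (𝓡 C.dim) m S (a, b))

theorem SmoothOn.vel_zero {A B C : Mfd.{u}} {m : A × B → C} {S : Set (A × B)} (hm : SmoothOn m S)
    {c : ℝ → A} {c' : ℝ → B} (hc : Vel A c 0) (hc' : Vel B c' 0)
    (hS : ∀ᶠ t in 𝓝 0, (c t, c' t) ∈ S) : Vel C (fun t => m (c t, c' t)) 0 := by
  exact (hm.vel hc hc' hS).of_eq (diffOn_zero _ _ _ _)

theorem Smooth.vel_zero {A B : Mfd.{u}} {f : A → B} (hf : Smooth f) {c : ℝ → A} (hc : Vel A c 0) :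
    Vel B (fun t => f (c t)) 0 := by
  exact (hf.vel hc).of_eq (map_zero (diff f (c 0)))

/-! ### The division map of a principal bundle -/

namespace IsLeftPrincipal

variable {G : LieGroupoid.{u}} {P M : Mfd.{u}} {μ : P → G.X} {proj : P → M} {act : G.arr → P → P}

/-- The arrow that takes `p` to `p'`. -/
noncomputable def div (_ : IsLeftPrincipal G μ proj act) (p p' : P) : G.arr :=
  open Classical in
  if hg : ∃ g, G.s g = μ p ∧ p' = act g p then hg.choose else G.one (μ p)

variable (h : IsLeftPrincipal G μ proj act)

theorem s_div {p p' : P} (hp : proj p = proj p') : G.s (h.div p p') = μ p := by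
  have hg := h.transitive p p' hp
  rw [div, dif_pos hg]
  exact hg.choose_spec.1

theorem act_div {p p' : P} (hp : proj p = proj p') : act (h.div p p') p = p' := by
  have hg := h.transitive p p' hp
  rw [div, dif_pos hg]
  exact hg.choose_spec.2.symm

theorem t_div {p p' : P} (hp : proj p = proj p') : G.t (h.div p p') = μ p' := by
  rw [← h.moment_act _ _ (h.s_div hp), h.act_div hp]

theorem act_inv_act (h : IsLeftPrincipal G μ proj act) {g : G.arr} {p : P}
    (hg : G.s g = μ p) : act (G.inv g) (act g p) = p := by
  rw [h.act_act _ _ _ (G.s_inv g) hg, G.inv_mul, hg, h.act_one]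

theorem act_injective (h : IsLeftPrincipal G μ proj act) {g g' : G.arr} {p : P}
    (hg : G.s g = μ p) (hg' : G.s g' = μ p)
    (he : act g p = act g' p) : g = g' := by
  have ht : G.t g = G.t g' := by rw [← h.moment_act g p hg, he, h.moment_act g' p hg']
  have hs : G.s (G.inv g') = G.t g := (G.s_inv g').trans ht.symm
  have h1 : act (G.mul (G.inv g') g) p = p := by
    rw [← h.act_act _ _ _ hs hg, he, h.act_inv_act hg']
  have h2 := h.free _ _ ((G.s_mul _ _ hs).trans hg) h1
  have h3 := G.mul_inv_cancel_left ht.symm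
  rw [h2, ← hg', G.mul_one] at h3
  exact h3.symm

theorem div_act {g : G.arr} {p : P} (hg : G.s g = μ p) : h.div p (act g p) = g := by
  have hp := (h.proj_act g p hg).symm
  exact h.act_injective (h.s_div hp) hg (h.act_div hp)

theorem div_self (p : P) : h.div p p = G.one (μ p) := by
  have := h.div_act (g := G.one (μ p)) (p := p) (G.s_one _)
  rwa [h.act_one] at this

/-- A free proper action makes `(g, p) ↦ (g · p, p)` injective and closed, hence a closed embedding.
Division is read off from its inverse. -/
theorem continuousOn_div :
    ContinuousOn (fun z : P × P => h.div z.1 z.2) (fibProd proj proj) := by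
  set e : fibProd G.s μ → P × P := fun x => (act x.1.1 x.1.2, x.1.2) with he
  have hemb : Topology.IsClosedEmbedding e := by
    refine .of_continuous_injective_isClosedMap h.proper.continuous ?_ h.proper.isClosedMap
    rintro ⟨⟨g, p⟩, hg⟩ ⟨⟨g', p'⟩, hg'⟩ heq
    simp only [he, Prod.mk.injEq] at heq
    obtain ⟨h1, rfl⟩ := heq
    have := h.act_injective hg hg' h1
    subst this
    rfl
  rw [continuousOn_iff_continuous_domRestrict]
  let k : fibProd proj proj → fibProd G.s μ := fun z => ⟨(h.div z.1.1 z.1.2, z.1.1), h.s_div z.2⟩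
  have hk : Continuous k := by
    rw [hemb.isEmbedding.continuous_iff]
    have : e ∘ k = fun z => (z.1.2, z.1.1) := by
      funext z
      exact Prod.ext (h.act_div z.2) rfl
    rw [this]
    fun_prop
  exact continuous_fst.comp (continuous_subtype_val.comp hk)

/-- `a` is a tangent vector at `g` of the source fibre that the orbit map of `p` kills. -/
def OrbitKer (_ : IsLeftPrincipal G μ proj act) (g : G.arr) (p : P)
    (a : EuclideanSpace ℝ (Fin G.arr.dim)) : Prop :=
  ∃ (c : ℝ → G.arr) (d : ℝ → P), c 0 = g ∧ d 0 = p ∧ Vel G.arr c a ∧ Vel P d 0 ∧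
    (∀ᶠ t in 𝓝 0, G.s (c t) = μ (d t)) ∧ Vel P (fun t => act (c t) (d t)) 0

/-- Left translation by `g' g⁻¹` carries the kernel of the orbit map at `g` to the kernel at `g'`.
The translating arrow has to follow the target of the moving arrow, so it is itself a curve `k`,
chosen with zero velocity. -/
theorem exists_orbitKer {g g' : G.arr} {p : P}
    (hg : G.s g = μ p) (hg' : G.s g' = μ p)
    {a : EuclideanSpace ℝ (Fin G.arr.dim)} (ha : a ≠ 0) (hk : h.OrbitKer g p a) :
    ∃ b, b ≠ 0 ∧ h.OrbitKer g' p b := by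
  obtain ⟨c, d, hc0, hd0, hc, hd, hcd, hact⟩ := hk
  have hs : G.s g' = G.t (G.inv g) := by rw [hg', G.t_inv, hg]
  have hks : G.s (G.mul g' (G.inv g)) = G.t g := by rw [G.s_mul _ _ hs, G.s_inv]
  -- The target of `c t` is the moment of `c t · d t`, which has zero velocity. This is what allows
  -- `k` to have zero velocity.
  have htc : Vel G.X (fun t => G.t (c t)) 0 :=
    (h.moment_submersion.smooth.vel_zero hact).congr (by
      filter_upwards [hcd] with t ht
      exact (h.moment_act _ _ ht).symm)
  obtain ⟨k, hk0, hk, hkt⟩ := G.s_submersion.exists_lift htc (a := G.mul g' (G.inv g))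
    (by rw [hks, hc0]) 0 (map_zero _)
  obtain ⟨b, hb⟩ : ∃ b, Vel G.arr (fun t => G.mul (k t) (c t)) b := ⟨_, G.mul_smooth.vel hk hc hkt⟩
  have hst : ∀ᶠ t in 𝓝 0, G.s (G.mul (k t) (c t)) = μ (d t) := by
    filter_upwards [hkt, hcd] with t h1 h2
    rw [G.s_mul _ _ h1, h2]
  refine ⟨b, ?_, fun t => G.mul (k t) (c t), d, ?_, hd0, hb, hd, hst, ?_⟩
  -- Multiplying back by the inverse of `k` would make the original velocity `a` vanish as well.
  · rintro rfl
    have h1 : Vel G.arr (fun t => G.mul (G.inv (k t)) (G.mul (k t) (c t))) 0 :=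
      G.mul_smooth.vel_zero (G.inv_smooth.vel_zero hk) hb (by
        filter_upwards [hkt] with t ht
        exact (G.s_inv _).trans (G.t_mul _ _ ht).symm)
    have h2 : Vel G.arr c 0 := h1.congr (by
      filter_upwards [hkt] with t ht
      exact (G.inv_mul_cancel_left ht).symm)
    exact ha (hc.unique h2)
  · simp only [hk0, hc0]
    exact G.mul_inv_cancel_right (hg'.trans hg.symm)
  · have h1 : Vel P (fun t => act (k t) (act (c t) (d t))) 0 :=
      h.act_smooth.vel_zero hk hact (by
        filter_upwards [hkt, hcd] with t h1 h2
        exact h1.trans (h.moment_act _ _ h2).symm)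
    refine h1.congr ?_
    filter_upwards [hkt, hcd] with t h1 h2
    exact (h.act_act _ _ _ h1 h2).symm

end IsLeftPrincipal

theorem IsSurjSubmersion.dim_le {A B : Mfd.{u}} {f : A → B} (hf : IsSurjSubmersion f) (a : A) :
    B.dim ≤ A.dim := by
  let L : EuclideanSpace ℝ (Fin A.dim) →L[ℝ] EuclideanSpace ℝ (Fin B.dim) := diff f a
  have := LinearMap.finrank_le_finrank_of_surjective (f := L.toLinearMap) (hf.submersive a)
  simpa using this

/-- Local coordinates in which a surjective submersion is the projection of a product. -/
theorem IsSurjSubmersion.exists_straightening {A B : Mfd.{u}} {f : A → B} (hf : IsSurjSubmersion f)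
    (a : A) :
    ∃ (k : ℕ) (y : A → EuclideanSpace ℝ (Fin k)) (Ψ : B × EuclideanSpace ℝ (Fin k) → A) (W : Set A)
      (V : Set (B × EuclideanSpace ℝ (Fin k))), B.dim + k = A.dim ∧ IsOpen W ∧ a ∈ W ∧ IsOpen V ∧
      ContMDiffOn (𝓡 A.dim) (𝓡 k) ∞ y W ∧
      ContMDiffOn ((𝓡 B.dim).prod (𝓡 k)) (𝓡 A.dim) ∞ Ψ V ∧
      (∀ n ∈ W, (f n, y n) ∈ V ∧ Ψ (f n, y n) = n) ∧
      ∀ z ∈ V, Ψ z ∈ W ∧ f (Ψ z) = z.1 ∧ y (Ψ z) = z.2 := by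
  have hle := hf.dim_le a
  obtain ⟨y, Ψ, W, V, hW, haW, -, hV, hy, hΨ, h1, h2⟩ := Pfaffian.exists_straightening
    (F := EuclideanSpace ℝ (Fin (A.dim - B.dim))) isOpen_univ (mem_univ a) hf.smooth.contMDiffOn
    (hf.submersive a) (by simp; omega)
  exact ⟨_, y, Ψ, W, V, by omega, hW, haW, hV, hy, hΨ, h1, h2⟩

theorem hasVel_fderiv {E F : Type*} [NormedAddCommGroup E] [NormedSpace ℝ E]
    [NormedAddCommGroup F] [NormedSpace ℝ F] {f : E → F} {c : ℝ → E} {v : E}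
    (hc : HasVel 𝓘(ℝ, E) c v) (hf : DifferentiableAt ℝ f (c 0)) :
    HasVel 𝓘(ℝ, F) (fun t => f (c t)) (fderiv ℝ f (c 0) v) :=
  hc.comp_hasMFDerivAt hf.hasFDerivAt.hasMFDerivAt

theorem continuousAt_of_contMDiffOn_open {E H N E' H' N' : Type*} [NormedAddCommGroup E]
    [NormedSpace ℝ E] [NormedAddCommGroup E'] [NormedSpace ℝ E'] [TopologicalSpace H]
    [TopologicalSpace H'] [TopologicalSpace N] [TopologicalSpace N'] [ChartedSpace H N]
    [ChartedSpace H' N'] {I : ModelWithCorners ℝ E H} {J : ModelWithCorners ℝ E' H'}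
    {f : N → N'} {U : Set N} (hf : ContMDiffOn I J ∞ f U) (hU : IsOpen U) {a : N} (ha : a ∈ U) :
    ContinuousAt f a := hf.continuousOn.continuousAt (hU.mem_nhds ha)

namespace IsLeftPrincipal

variable {G : LieGroupoid.{u}} {P M : Mfd.{u}} {μ : P → G.X} {proj : P → M} {act : G.arr → P → P}
  (h : IsLeftPrincipal G μ proj act)

/-- In coordinates `u` on the source fibres and `y` on the fibres of the bundle, the orbit map
has invertible differential. -/
theorem bijective_fderiv_orbit (h : IsLeftPrincipal G μ proj act) {k n : ℕ} {p : P} {g : G.arr}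
    (hg : G.s g = μ p)
    {u : G.arr → EuclideanSpace ℝ (Fin k)} {Ψs : G.X × EuclideanSpace ℝ (Fin k) → G.arr}
    {Ws : Set G.arr} {Vs : Set (G.X × EuclideanSpace ℝ (Fin k))} (hWs : IsOpen Ws) (hgWs : g ∈ Ws)
    (hVs : IsOpen Vs) (hu : ContMDiffOn (𝓡 G.arr.dim) (𝓡 k) ∞ u Ws)
    (hΨs : ContMDiffOn ((𝓡 G.X.dim).prod (𝓡 k)) (𝓡 G.arr.dim) ∞ Ψs Vs)
    (hs1 : ∀ n ∈ Ws, (G.s n, u n) ∈ Vs ∧ Ψs (G.s n, u n) = n)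
    (hs2 : ∀ z ∈ Vs, Ψs z ∈ Ws ∧ G.s (Ψs z) = z.1 ∧ u (Ψs z) = z.2)
    {y : P → EuclideanSpace ℝ (Fin n)} {Ψ : M × EuclideanSpace ℝ (Fin n) → P}
    {W : Set P} {V : Set (M × EuclideanSpace ℝ (Fin n))} (hW : IsOpen W) (hpW : act g p ∈ W)
    (hV : IsOpen V) (hy : ContMDiffOn (𝓡 P.dim) (𝓡 n) ∞ y W)
    (hΨ : ContMDiffOn ((𝓡 M.dim).prod (𝓡 n)) (𝓡 P.dim) ∞ Ψ V)
    (h1 : ∀ n ∈ W, (proj n, y n) ∈ V ∧ Ψ (proj n, y n) = n)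
    (h2 : ∀ z ∈ V, Ψ z ∈ W ∧ proj (Ψ z) = z.1 ∧ y (Ψ z) = z.2) :
    Function.Bijective (fderiv ℝ (fun w => y (act (Ψs (μ p, w)) p)) (u g)) := by
  set f : EuclideanSpace ℝ (Fin k) → EuclideanSpace ℝ (Fin n) :=
    fun w => y (act (Ψs (μ p, w)) p) with hf
  have hO₁ : IsOpen {w | (μ p, w) ∈ Vs} := hVs.preimage (by fun_prop)
  have hcS : ContMDiffOn (𝓡 k) (𝓡 G.arr.dim) ∞ (fun w => Ψs (μ p, w)) {w | (μ p, w) ∈ Vs} :=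
    hΨs.comp (contMDiffOn_const.prodMk contMDiffOn_id) fun w hw => hw
  have hcP : ContMDiffOn (𝓡 k) (𝓡 P.dim) ∞ (fun w => act (Ψs (μ p, w)) p) {w | (μ p, w) ∈ Vs} :=
    ContMDiffOn.comp (g := fun x : G.arr × P => act x.1 x.2) h.act_smooth
      (hcS.prodMk contMDiffOn_const) fun w hw => (hs2 _ hw).2.1
  set O := {w | (μ p, w) ∈ Vs} ∩ (fun w => act (Ψs (μ p, w)) p) ⁻¹' W with hOd
  have hO : IsOpen O := hcP.continuousOn.isOpen_inter_preimage hO₁ hW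
  have hfO : ContDiffOn ℝ ∞ f O :=
    contMDiffOn_iff_contDiffOn.1 (hy.comp (hcP.mono fun w hw => hw.1) fun w hw => hw.2)
  have hfd : ∀ w ∈ O, DifferentiableAt ℝ f w := fun w hw =>
    (hfO.contDiffAt (hO.mem_nhds hw)).differentiableAt (by simp)
  have hgs := hs1 g hgWs
  rw [hg] at hgs
  have haO : u g ∈ O := ⟨hgs.1, by simp only [mem_preimage]; rw [hgs.2]; exact hpW⟩
  have hproj : ∀ w ∈ O, proj (act (Ψs (μ p, w)) p) = proj p := fun w hw =>
    h.proj_act _ _ (hs2 _ hw.1).2.1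
  have hrec : ∀ w ∈ O, (proj p, f w) ∈ V ∧ Ψ (proj p, f w) = act (Ψs (μ p, w)) p := by
    intro w hw
    have := h1 _ hw.2
    rwa [hproj w hw] at this
  -- The three conditions come from freeness (injectivity), from continuity of the division (points
  -- near `g · p` in its fibre are reached by arrows near `g`), and from translation of kernel
  -- vectors by `exists_orbitKer` (homogeneity).
  refine bijective_fderiv_of_injOn hO haO hfO ?_ ?_ ?_
  · intro w hw w' hw' he
    have e1 : act (Ψs (μ p, w)) p = act (Ψs (μ p, w')) p := by
      rw [← (hrec w hw).2, ← (hrec w' hw').2, he]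
    have e2 := h.act_injective (hs2 _ hw.1).2.1 (hs2 _ hw'.1).2.1 e1
    have e3 := (hs2 _ hw.1).2.2
    rw [e2, (hs2 _ hw'.1).2.2] at e3
    exact e3.symm
  · intro s hsn
    set q : EuclideanSpace ℝ (Fin n) → P := fun v => Ψ (proj p, v) with hq
    have hfa : f (u g) = y (act g p) := by simp only [hf, hgs.2]
    have hra := hrec _ haO
    have hq0 : q (f (u g)) = act g p := by simp only [hq]; rw [hra.2, hgs.2]
    have hVn : ∀ᶠ v in 𝓝 (f (u g)), (proj p, v) ∈ V :=
      (hV.preimage (by fun_prop : Continuous fun v => (proj p, v))).mem_nhds hra.1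
    have hqc : ContinuousAt q (f (u g)) :=
      ContinuousAt.comp (f := fun v => (proj p, v)) (continuousAt_of_contMDiffOn_open hΨ hV hra.1)
        (by fun_prop)
    have hdc : Tendsto (fun v => h.div p (q v)) (𝓝 (f (u g))) (𝓝 g) := by
      have hd := h.continuousOn_div (p, act g p) (h.proj_act g p hg).symm
      have hdiv : h.div p (act g p) = g := h.div_act hg
      unfold ContinuousWithinAt at hd
      simp only [hdiv] at hd
      refine Tendsto.comp (g := fun z : P × P => h.div z.1 z.2) (f := fun v => (p, q v)) hd
        (tendsto_nhdsWithin_iff.2 ⟨?_, ?_⟩)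
      · rw [nhds_prod_eq]
        exact tendsto_const_nhds.prodMk (hq0 ▸ hqc.tendsto)
      · filter_upwards [hVn] with v hv
        exact (h2 _ hv).2.1.symm
    have huc : Tendsto (fun v => u (h.div p (q v))) (𝓝 (f (u g))) (𝓝 (u g)) :=
      (continuousAt_of_contMDiffOn_open hu hWs hgWs).tendsto.comp hdc
    filter_upwards [huc hsn, hVn, hdc (hWs.mem_nhds hgWs)] with v hv hvV hvW
    have hpr : proj p = proj (q v) := (h2 _ hvV).2.1.symm
    refine ⟨_, hv, ?_⟩
    have e1 := (hs1 _ hvW).2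
    rw [h.s_div hpr] at e1
    simp only [hf]
    rw [e1, h.act_div hpr]
    exact (h2 _ hvV).2.2
  · intro hnot w hw hinj
    obtain ⟨ξ, hξ, hξ0⟩ : ∃ ξ, fderiv ℝ f (u g) ξ = 0 ∧ ξ ≠ 0 := by
      by_contra! hcon
      exact hnot ((injective_iff_map_eq_zero _).2 hcon)
    -- the kernel at `u g` gives a vector killed by the orbit map at `g`
    obtain ⟨a, ha0, ha⟩ : ∃ a, a ≠ 0 ∧ h.OrbitKer g p a := by
      obtain ⟨c, hc0, hc⟩ := exists_hasVel (I := 𝓡 k) (u g) ξ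
      have hcO : ∀ᶠ t in 𝓝 0, c t ∈ O := hc.eventually_mem hO (hc0 ▸ haO)
      have hcsd : MDifferentiableAt (𝓡 k) (𝓡 G.arr.dim) (fun w => Ψs (μ p, w)) (c 0) :=
        ((hcS.mono fun w hw => hw.1).contMDiffAt
          (hO.mem_nhds hcO.self_of_nhds)).mdifferentiableAt (by simp)
      have hcs := hc.comp hcsd
      refine ⟨_, ?_, _, fun _ => p, ?_, rfl, hcs, hasVel_const p, ?_, ?_⟩
      · intro hz
        have hΨ0 : Ψs (μ p, c 0) = g := by rw [hc0]; exact hgs.2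
        have hud : MDifferentiableAt (𝓡 G.arr.dim) (𝓡 k) u (Ψs (μ p, c 0)) := by
          rw [hΨ0]
          exact (hu.contMDiffAt (hWs.mem_nhds hgWs)).mdifferentiableAt (by simp)
        have h3 := (hcs.of_eq hz).comp hud
        have h4 : HasVel (𝓡 k) c 0 := (h3.of_eq (map_zero _)).congr (by
          filter_upwards [hcO] with t ht
          exact (hs2 _ ht.1).2.2.symm)
        exact hξ0 (hc.unique h4)
      · simp only [hc0]; exact hgs.2
      · filter_upwards [hcO] with t ht
        exact (hs2 _ ht.1).2.1
      · have h3 : HasVel (𝓡 n) (fun t => f (c t)) 0 :=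
          (hasVel_fderiv hc (hfd _ hcO.self_of_nhds)).of_eq (by rw [hc0, hξ])
        have h4 := (hasVel_const (I := 𝓡 M.dim) (proj p)).prodMk h3
        have hΨd : MDifferentiableAt ((𝓡 M.dim).prod (𝓡 n)) (𝓡 P.dim) Ψ (proj p, f (c 0)) :=
          (hΨ.contMDiffAt (hV.mem_nhds (hrec _ hcO.self_of_nhds).1)).mdifferentiableAt (by simp)
        refine ((h4.comp hΨd).of_eq (map_zero _)).congr ?_
        filter_upwards [hcO] with t ht
        exact (hrec _ ht).2.symm
    obtain ⟨b, hb0, c, d, hc0, hd0, hc, hd, hcd, hact⟩ :=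
      h.exists_orbitKer hg (hs2 _ hw.1).2.1 ha0 ha
    have hcW : ∀ᶠ t in 𝓝 0, c t ∈ Ws := hc.eventually_mem hWs (hc0 ▸ (hs2 _ hw.1).1)
    have hcu : u (c 0) = w := by rw [hc0]; exact (hs2 _ hw.1).2.2
    have hsc : Vel G.X (fun t => G.s (c t)) 0 :=
      (h.moment_submersion.smooth.vel_zero hd).congr hcd
    have hud : MDifferentiableAt (𝓡 G.arr.dim) (𝓡 k) u (c 0) :=
      (hu.contMDiffAt (hWs.mem_nhds hcW.self_of_nhds)).mdifferentiableAt (by simp)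
    obtain ⟨η, hη⟩ : ∃ η, HasVel (𝓡 k) (fun t => u (c t)) η := ⟨_, hc.comp hud⟩
    have hμ0 : G.s (c 0) = μ p := by rw [hcd.self_of_nhds, hd0]
    -- the curve `Ψs (μ p, u (c t))` has the same velocity as `c`
    have hΨd : MDifferentiableAt ((𝓡 G.X.dim).prod (𝓡 k)) (𝓡 G.arr.dim) Ψs (μ p, u (c 0)) :=
      (hΨs.contMDiffAt (hVs.mem_nhds (by rw [hcu]; exact hw.1))).mdifferentiableAt (by simp)
    have hΨd' : MDifferentiableAt ((𝓡 G.X.dim).prod (𝓡 k)) (𝓡 G.arr.dim) Ψs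
        (G.s (c 0), u (c 0)) := hμ0 ▸ hΨd
    have hb : (mfderiv ((𝓡 G.X.dim).prod (𝓡 k)) (𝓡 G.arr.dim) Ψs (G.s (c 0), u (c 0)) (0, η) :
        EuclideanSpace ℝ (Fin G.arr.dim)) = b := by
      have hcc : Vel G.arr c _ := ((hsc.prodMk hη).comp hΨd').congr (by
        filter_upwards [hcW] with t ht
        exact (hs1 _ ht).2.symm)
      exact hcc.unique hc
    have hc' : Vel G.arr (fun t => Ψs (μ p, u (c t))) b :=
      (((hasVel_const (I := 𝓡 G.X.dim) (μ p)).prodMk hη).comp hΨd).of_eq (by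
        rw [← hb, hμ0])
    have hη0 : η ≠ 0 := by
      rintro rfl
      exact hb0 (hb ▸ map_zero _)
    have hcO : ∀ᶠ t in 𝓝 0, u (c t) ∈ O := hη.eventually_mem hO (by rw [hcu]; exact hw)
    have hc'0 : Ψs (μ p, u (c 0)) = c 0 := by
      rw [← hμ0]; exact (hs1 _ hcW.self_of_nhds).2
    have hv1 := h.act_smooth.vel hc hd hcd
    have hv2 := h.act_smooth.vel hc' (hasVel_const p) (by
      filter_upwards [hcO] with t ht
      exact (hs2 _ ht.1).2.1)
    have hv3 : Vel P (fun t => act (Ψs (μ p, u (c t))) p) 0 := by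
      refine hv2.of_eq ?_
      rw [hc'0, ← hd0]
      exact hv1.unique hact
    have hyd : MDifferentiableAt (𝓡 P.dim) (𝓡 n) y (act (Ψs (μ p, u (c 0))) p) :=
      (hy.contMDiffAt (hW.mem_nhds hcO.self_of_nhds.2)).mdifferentiableAt (by simp)
    have hv4 := (hv3.comp hyd).of_eq (map_zero _)
    have hv5 := hasVel_fderiv hη (hfd _ hcO.self_of_nhds)
    have hv6 := hv5.unique hv4
    rw [hcu] at hv6
    exact hη0 (hinj (hv6.trans (map_zero _).symm))

/-- Near `(p₀, p₁)` the arrow solves the equation `y (g · p) = y p'`, where `g` is written in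
coordinates on the source fibre of `μ p`. The partial differential in `g` is that of the orbit map,
which is invertible, so this is the implicit function theorem. -/
theorem div_smooth : SmoothOn (fun z : P × P => h.div z.1 z.2) (fibProd proj proj) := by
  rintro ⟨p₀, p₁⟩ hpp
  have hpp : proj p₀ = proj p₁ := hpp
  set g := h.div p₀ p₁ with hgd
  have hg : G.s g = μ p₀ := h.s_div hpp
  have hgp : act g p₀ = p₁ := h.act_div hpp
  obtain ⟨k, u, Ψs, Ws, Vs, -, hWs, hgWs, hVs, hu, hΨs, hs1, hs2⟩ :=
    G.s_submersion.exists_straightening g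
  obtain ⟨n, y, Ψ, W, V, -, hW, hpW, hV, hy, hΨ, h1, h2⟩ :=
    h.proj_submersion.exists_straightening p₁
  have hbij := h.bijective_fderiv_orbit hg hWs hgWs hVs hu hΨs hs1 hs2 hW (hgp.symm ▸ hpW) hV hy hΨ
    h1 h2
  have hgs := hs1 g hgWs
  rw [hg] at hgs
  -- the map `(p, w) ↦ (p, y (Ψs (μ p, w) · p))` is a local diffeomorphism
  have hVs' : IsOpen {z : P × EuclideanSpace ℝ (Fin k) | (μ z.1, z.2) ∈ Vs} :=
    hVs.preimage ((h.moment_submersion.smooth.continuous.comp continuous_fst).prodMk continuous_snd)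
  have hc1 : ContMDiffOn ((𝓡 P.dim).prod (𝓡 k)) (𝓡 G.arr.dim) ∞
      (fun z : P × EuclideanSpace ℝ (Fin k) => Ψs (μ z.1, z.2)) {z | (μ z.1, z.2) ∈ Vs} :=
    hΨs.comp ((h.moment_submersion.smooth.comp contMDiff_fst).contMDiffOn.prodMk contMDiffOn_snd)
      fun z hz => hz
  have hc2 : ContMDiffOn ((𝓡 P.dim).prod (𝓡 k)) (𝓡 P.dim) ∞
      (fun z : P × EuclideanSpace ℝ (Fin k) => act (Ψs (μ z.1, z.2)) z.1)
      {z | (μ z.1, z.2) ∈ Vs} :=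
    ContMDiffOn.comp (g := fun x : G.arr × P => act x.1 x.2) h.act_smooth
      (hc1.prodMk contMDiffOn_fst) fun z hz => (hs2 _ hz).2.1
  set U := {z : P × EuclideanSpace ℝ (Fin k) | (μ z.1, z.2) ∈ Vs} ∩
    (fun z => act (Ψs (μ z.1, z.2)) z.1) ⁻¹' W with hUd
  have hU : IsOpen U := hc2.continuousOn.isOpen_inter_preimage hVs' hW
  set H : P × EuclideanSpace ℝ (Fin k) → P × EuclideanSpace ℝ (Fin n) :=
    fun z => (z.1, y (act (Ψs (μ z.1, z.2)) z.1)) with hH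
  have hHs : ContMDiffOn ((𝓡 P.dim).prod (𝓡 k)) ((𝓡 P.dim).prod (𝓡 n)) ∞ H U :=
    contMDiffOn_fst.prodMk (hy.comp (hc2.mono fun z hz => hz.1) fun z hz => hz.2)
  have haU : (p₀, u g) ∈ U := by
    refine ⟨hgs.1, ?_⟩
    simp only [mem_preimage]
    rw [hgs.2, hgp]
    exact hpW
  have hHd : MDifferentiableAt ((𝓡 P.dim).prod (𝓡 k)) ((𝓡 P.dim).prod (𝓡 n)) H (p₀, u g) :=
    (hHs.contMDiffAt (hU.mem_nhds haU)).mdifferentiableAt (by simp)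
  have hsurj : Function.Surjective
      (mfderiv ((𝓡 P.dim).prod (𝓡 k)) ((𝓡 P.dim).prod (𝓡 n)) H (p₀, u g)) := by
    -- `D` is block triangular: its first component is the identity in the direction of `P` (`hD1`),
    -- and on vectors `(0, ξ)` its second component is the differential of the orbit map (`hD2`).
    set D : EuclideanSpace ℝ (Fin P.dim) × EuclideanSpace ℝ (Fin k) →L[ℝ]
      EuclideanSpace ℝ (Fin P.dim) × EuclideanSpace ℝ (Fin n) :=
      mfderiv ((𝓡 P.dim).prod (𝓡 k)) ((𝓡 P.dim).prod (𝓡 n)) H (p₀, u g) with hD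
    have hD1 : ∀ η ξ, (D (η, ξ)).1 = η := by
      intro η ξ
      obtain ⟨c, hc0, hc⟩ := exists_hasVel (I := 𝓡 P.dim) p₀ η
      obtain ⟨d, hd0, hd⟩ := exists_hasVel (I := 𝓡 k) (u g) ξ
      have h3 := (hc.prodMk hd).comp_hasMFDerivAt (f := H) (f' := D) (by
        rw [hc0, hd0]; exact hHd.hasMFDerivAt)
      have h4 := h3.comp (f := Prod.fst) (J := 𝓡 P.dim) mdifferentiableAt_fst
      rw [mfderiv_fst] at h4
      exact h4.unique hc
    have hD2 : ∀ ξ, (D (0, ξ)).2 = fderiv ℝ (fun w => y (act (Ψs (μ p₀, w)) p₀)) (u g) ξ := by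
      intro ξ
      obtain ⟨d, hd0, hd⟩ := exists_hasVel (I := 𝓡 k) (u g) ξ
      have h3 := ((hasVel_const (I := 𝓡 P.dim) p₀).prodMk hd).comp_hasMFDerivAt
        (f := H) (f' := D) (by rw [hd0]; exact hHd.hasMFDerivAt)
      have h4 := h3.comp (f := Prod.snd) (J := 𝓡 n) mdifferentiableAt_snd
      rw [mfderiv_snd] at h4
      have hdiff : DifferentiableAt ℝ (fun w => y (act (Ψs (μ p₀, w)) p₀)) (d 0) := by
        have h5 : ContMDiffOn (𝓡 k) (𝓡 n) ∞ (fun w => (H (p₀, w)).2) ((fun w => (p₀, w)) ⁻¹' U) :=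
          (contMDiff_snd.comp_contMDiffOn hHs).comp
            (contMDiffOn_const.prodMk contMDiffOn_id) fun w hw => hw
        refine ((contMDiffOn_iff_contDiffOn.1 h5).contDiffAt
          ((hU.preimage (by fun_prop)).mem_nhds ?_)).differentiableAt (by simp)
        rw [hd0]; exact haU
      have h6 := hasVel_fderiv hd hdiff
      rw [hd0] at h6
      exact h4.unique h6
    intro z
    obtain ⟨ξ, hξ⟩ := hbij.2 ((show EuclideanSpace ℝ (Fin P.dim) × EuclideanSpace ℝ (Fin n) from
      z).2 - (D (z.1, 0)).2)
    refine ⟨(z.1, ξ), ?_⟩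
    have h7 : D (z.1, ξ) = D (z.1, 0) + D (0, ξ) := by rw [← map_add]; simp
    change D (z.1, ξ) = z
    refine Prod.ext (hD1 _ _) ?_
    rw [h7, Prod.snd_add, hD2, hξ]
    abel
  have hdim : P.dim + n = P.dim + k := by
    let L := fderiv ℝ (fun w => y (act (Ψs (μ p₀, w)) p₀)) (u g)
    have := (LinearEquiv.ofBijective L.toLinearMap hbij).finrank_eq
    simp at this
    omega
  -- Straightening with a zero-dimensional complement is the inverse function theorem on manifolds:
  -- `ΨH` is a local inverse of `H`.
  obtain ⟨z, ΨH, WH, VH, hWH, haWH, -, hVH, -, hΨH, hH1, -⟩ := Pfaffian.exists_straightening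
    (F := EuclideanSpace ℝ (Fin 0)) hU haU hHs hsurj (by simp; omega)
  have hz : ∀ a, z a = 0 := fun a => Subsingleton.elim _ _
  have hHa : H (p₀, u g) = (p₀, y p₁) := by simp only [hH, hgs.2, hgp]
  have hHa1 := hH1 _ haWH
  rw [hz, hHa] at hHa1
  have hcont := h.continuousOn_div (p₀, p₁) hpp
  -- Continuity of the division ensures that, for pairs near `(p₀, p₁)`, the arrow lies in the
  -- domain where `H` is inverted, so that the local inverse finds this very arrow.
  have hev : ∀ᶠ q in 𝓝[fibProd proj proj] (p₀, p₁),
      h.div q.1 q.2 = Ψs (μ q.1, (ΨH ((q.1, y q.2), 0)).2) := by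
    have e1 : ∀ᶠ q in 𝓝[fibProd proj proj] (p₀, p₁), h.div q.1 q.2 ∈ Ws :=
      hcont.preimage_mem_nhdsWithin (hWs.mem_nhds hgWs)
    have e2 : ∀ᶠ q in 𝓝[fibProd proj proj] (p₀, p₁), (q.1, u (h.div q.1 q.2)) ∈ WH := by
      have hcu : ContinuousWithinAt (fun q : P × P => (q.1, u (h.div q.1 q.2)))
          (fibProd proj proj) (p₀, p₁) :=
        continuous_fst.continuousWithinAt.prodMk
          (ContinuousAt.comp_continuousWithinAt (f := fun q : P × P => h.div q.1 q.2)
            (x := (p₀, p₁)) (continuousAt_of_contMDiffOn_open hu hWs hgWs) hcont)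
      exact hcu.preimage_mem_nhdsWithin (hWH.mem_nhds haWH)
    filter_upwards [e1, e2, self_mem_nhdsWithin] with q h3 h4 h5
    have h5 : proj q.1 = proj q.2 := h5
    have h6 := (hs1 _ h3).2
    rw [h.s_div h5] at h6
    have h7 := (hH1 _ h4).2
    simp only [hz, hH] at h7
    rw [h6, h.act_div h5] at h7
    rw [h7, h6]
  refine ContMDiffWithinAt.congr_of_eventuallyEq (f := fun q : P × P =>
    Ψs (μ q.1, (ΨH ((q.1, y q.2), 0)).2)) ?_ hev (hev.self_of_nhdsWithin hpp)
  refine ContMDiffAt.contMDiffWithinAt ?_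
  have hy' : ContMDiffAt ((𝓡 P.dim).prod (𝓡 P.dim)) (𝓡 n) ∞ (fun q : P × P => y q.2) (p₀, p₁) :=
    (hy.contMDiffAt (hW.mem_nhds hpW)).comp (p₀, p₁) contMDiffAt_snd
  have hin : ContMDiffAt ((𝓡 P.dim).prod (𝓡 P.dim)) (((𝓡 P.dim).prod (𝓡 n)).prod (𝓡 0)) ∞
      (fun q : P × P => ((q.1, y q.2), (0 : EuclideanSpace ℝ (Fin 0)))) (p₀, p₁) :=
    (contMDiffAt_fst.prodMk hy').prodMk contMDiffAt_const
  have hK : ContMDiffAt ((𝓡 P.dim).prod (𝓡 P.dim)) ((𝓡 P.dim).prod (𝓡 k)) ∞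
      (fun q : P × P => ΨH ((q.1, y q.2), 0)) (p₀, p₁) :=
    (hΨH.contMDiffAt (hVH.mem_nhds hHa1.1)).comp (p₀, p₁) hin
  have hlast : ContMDiffAt ((𝓡 P.dim).prod (𝓡 P.dim)) ((𝓡 G.X.dim).prod (𝓡 k)) ∞
      (fun q : P × P => (μ q.1, (ΨH ((q.1, y q.2), 0)).2)) (p₀, p₁) :=
    ((h.moment_submersion.smooth _).comp (p₀, p₁) contMDiffAt_fst).prodMk
      (contMDiffAt_snd.comp (p₀, p₁) hK)
  refine ContMDiffAt.comp (p₀, p₁) (hΨs.contMDiffAt (hVs.mem_nhds ?_)) hlast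
  simp only [hHa1.2]
  exact hgs.1

end IsLeftPrincipal

/-! ### Quotient manifolds -/

section Quotient

variable {A B : Mfd.{u}} {Y : Type u}

/-- A slice chart at `x ∈ S` for the quotient of `S` by the fibres of `q`: a function `c` which is
constant on the fibres of `q`, with a smooth section `l`, and whose fibres in a saturated domain `D`
are fibres of `q`. -/
structure SliceChart (S : Set (A × B)) (q : A × B → Y) (n : ℕ) (x : A × B) where
  D : Set (A × B)
  D_mem_nhdsWithin : ∀ z ∈ D, D ∈ 𝓝[S] z
  D_sub : D ⊆ S
  mem_D : x ∈ D
  O : Set (EuclideanSpace ℝ (Fin n))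
  isOpen_O : IsOpen O
  c : A × B → EuclideanSpace ℝ (Fin n)
  c_smooth : ContMDiffOn ((𝓡 A.dim).prod (𝓡 B.dim)) (𝓡 n) ∞ c D
  l : EuclideanSpace ℝ (Fin n) → A × B
  l_smooth : ContMDiffOn (𝓡 n) ((𝓡 A.dim).prod (𝓡 B.dim)) ∞ l O
  c_mem : ∀ z ∈ D, c z ∈ O
  l_mem : ∀ w ∈ O, l w ∈ D
  c_l : ∀ w ∈ O, c (l w) = w
  q_l_c : ∀ z ∈ D, q (l (c z)) = q z
  saturated : ∀ z ∈ D, ∀ z' ∈ S, q z = q z' → z' ∈ D ∧ c z' = c z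
  l_c_base : l (c x) = x

namespace SliceChart

variable {S : Set (A × B)} {q : A × B → Y} {n : ℕ} {x x' : A × B}

/-- The chart of the quotient that a slice chart defines, given a choice of representatives. -/
def chart (κ : SliceChart S q n x) (rep : Y → A × B) (hrep : ∀ y, rep y ∈ S ∧ q (rep y) = y) :
    PartialEquiv Y (EuclideanSpace ℝ (Fin n)) where
  toFun y := κ.c (rep y)
  invFun w := q (κ.l w)
  source := {y | rep y ∈ κ.D}
  target := κ.O
  map_source' _ hy := κ.c_mem _ hy
  map_target' w hw := (κ.saturated _ (κ.l_mem w hw) _ (hrep _).1 (hrep _).2.symm).1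
  left_inv' y hy := (κ.q_l_c _ hy).trans (hrep y).2
  right_inv' w hw :=
    (κ.saturated _ (κ.l_mem w hw) _ (hrep _).1 (hrep _).2.symm).2.trans (κ.c_l w hw)

variable (rep : Y → A × B)

theorem rep_mem_D_iff (hrep : ∀ y, rep y ∈ S ∧ q (rep y) = y) (κ : SliceChart S q n x)
    {z : A × B} (hz : z ∈ S) :
    rep (q z) ∈ κ.D ↔ z ∈ κ.D :=
  ⟨fun h => (κ.saturated _ h z hz (hrep _).2).1,
    fun h => (κ.saturated _ h _ (hrep _).1 (hrep _).2.symm).1⟩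

variable (hrep : ∀ y, rep y ∈ S ∧ q (rep y) = y)

theorem chart_apply (κ : SliceChart S q n x) {z : A × B} (hz : z ∈ κ.D) :
    κ.chart rep hrep (q z) = κ.c z :=
  (κ.saturated _ hz _ (hrep _).1 (hrep _).2.symm).2

theorem transition_source (κ : SliceChart S q n x) (κ' : SliceChart S q n x') :
    ((κ.chart rep hrep).symm.trans (κ'.chart rep hrep)).source = κ.O ∩ κ.l ⁻¹' κ'.D := by
  rw [PartialEquiv.trans_source]
  ext w
  refine and_congr_right fun hw => ?_
  exact κ'.rep_mem_D_iff rep hrep (κ.D_sub (κ.l_mem w hw))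

theorem transition_apply (κ : SliceChart S q n x) (κ' : SliceChart S q n x') {w}
    (hw : w ∈ κ.O ∩ κ.l ⁻¹' κ'.D) :
    ((κ.chart rep hrep).symm.trans (κ'.chart rep hrep)) w = κ'.c (κ.l w) :=
  κ'.chart_apply rep hrep hw.2

theorem isOpen_transition (κ : SliceChart S q n x) (κ' : SliceChart S q n x') :
    IsOpen (κ.O ∩ κ.l ⁻¹' κ'.D) := by
  rw [isOpen_iff_mem_nhds]
  rintro w ⟨hw, hw'⟩
  have h1 : Tendsto κ.l (𝓝[κ.O] w) (𝓝[S] (κ.l w)) :=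
    tendsto_nhdsWithin_iff.2 ⟨κ.l_smooth.continuousOn w hw,
      eventually_mem_nhdsWithin.mono fun w hw => κ.D_sub (κ.l_mem w hw)⟩
  have h2 := h1 (κ'.D_mem_nhdsWithin _ hw')
  rw [κ.isOpen_O.nhdsWithin_eq hw] at h2
  exact inter_mem (κ.isOpen_O.mem_nhds hw) h2

theorem contDiffOn_transition (κ : SliceChart S q n x) (κ' : SliceChart S q n x') :
    ContDiffOn ℝ ∞ (fun w => κ'.c (κ.l w)) (κ.O ∩ κ.l ⁻¹' κ'.D) :=
  contMDiffOn_iff_contDiffOn.1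
    (κ'.c_smooth.comp (κ.l_smooth.mono inter_subset_left) inter_subset_right)

end SliceChart

/-- The quotient of `S` by the fibres of `q` is a manifold if there are slice charts at all points;
the quotient map is smooth and has smooth local sections through all points. -/
theorem exists_quotient_mfd (S : Set (A × B)) (q : A × B → Y) (hq : ∀ y, ∃ x ∈ S, q x = y) (n : ℕ)
    (κ : ∀ x ∈ S, Nonempty (SliceChart S q n x)) :
    ∃ (N : Mfd.{u}) (p : A × B → N), SmoothOn p S ∧ (∀ y, ∃ x ∈ S, p x = y) ∧
      (∀ x ∈ S, ∀ x' ∈ S, p x = p x' ↔ q x = q x') ∧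
      ∀ x ∈ S, ∃ (l : N → A × B) (U : Set N), IsOpen U ∧ p x ∈ U ∧
        ContMDiffOn (𝓡 N.dim) ((𝓡 A.dim).prod (𝓡 B.dim)) ∞ l U ∧ l (p x) = x ∧
        ∀ y ∈ U, l y ∈ S ∧ p (l y) = y := by
  choose rep hrep using hq
  replace κ : ∀ x : S, SliceChart S q n x.1 := fun x => (κ x.1 x.2).some
  let e : S → PartialEquiv Y (EuclideanSpace ℝ (Fin n)) := fun x => (κ x).chart rep hrep
  let core : ChartedSpaceCore (EuclideanSpace ℝ (Fin n)) Y :=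
    { atlas := range e
      chartAt := fun y => e ⟨rep y, (hrep y).1⟩
      mem_chart_source := fun y => (κ ⟨rep y, (hrep y).1⟩).mem_D
      chart_mem_atlas := fun y => mem_range_self _
      open_source := by
        rintro _ _ ⟨x, rfl⟩ ⟨x', rfl⟩
        rw [SliceChart.transition_source]
        exact SliceChart.isOpen_transition _ _
      continuousOn_toFun := by
        rintro _ _ ⟨x, rfl⟩ ⟨x', rfl⟩
        rw [SliceChart.transition_source]
        exact (SliceChart.contDiffOn_transition _ _).continuousOn.congr
          fun w hw => SliceChart.transition_apply _ _ _ _ hw }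
  -- The topology on `Y` is the one generated by the charts. Continuity of `q` is part of its
  -- smoothness, which is checked in the charts below.
  let top : TopologicalSpace Y := core.toTopologicalSpace
  let charted : ChartedSpace (EuclideanSpace ℝ (Fin n)) Y := core.toChartedSpace
  let κ' : S → OpenPartialHomeomorph Y (EuclideanSpace ℝ (Fin n)) := fun x =>
    core.openPartialHomeomorph (e x) (mem_range_self x)
  have hatlas : ∀ f ∈ atlas (EuclideanSpace ℝ (Fin n)) Y, ∃ x, f = κ' x := by
    intro f hf
    have hf' : f ∈ ⋃ (e' : PartialEquiv Y (EuclideanSpace ℝ (Fin n))) (he : e' ∈ core.atlas),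
      {core.openPartialHomeomorph e' he} := hf
    simp only [mem_iUnion, mem_singleton_iff] at hf'
    obtain ⟨_, ⟨x, rfl⟩, rfl⟩ := hf'
    exact ⟨x, rfl⟩
  have hmem : ∀ x, κ' x ∈ atlas (EuclideanSpace ℝ (Fin n)) Y := by
    intro x
    change κ' x ∈ ⋃ (e' : PartialEquiv Y (EuclideanSpace ℝ (Fin n))) (he : e' ∈ core.atlas),
      {core.openPartialHomeomorph e' he}
    simp only [mem_iUnion, mem_singleton_iff]
    exact ⟨e x, mem_range_self x, rfl⟩
  have hmfd : IsManifold (𝓡 n) ∞ Y := by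
    refine isManifold_of_contDiffOn _ _ _ fun f f' hf hf' => ?_
    obtain ⟨x, rfl⟩ := hatlas f hf
    obtain ⟨x', rfl⟩ := hatlas f' hf'
    have hsrc : ((κ' x).symm.trans (κ' x')).source = (κ x).O ∩ (κ x).l ⁻¹' (κ x').D :=
      SliceChart.transition_source rep hrep (κ x) (κ x')
    have h1 := (κ x).contDiffOn_transition (κ x')
    rw [hsrc]
    refine (h1.congr (f₁ := (κ' x).symm.trans (κ' x'))
      fun w hw => SliceChart.transition_apply rep hrep (κ x) (κ x') hw).mono ?_
    exact fun w hw => hw.1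
  have hmax : ∀ x, κ' x ∈ IsManifold.maximalAtlas (𝓡 n) ∞ Y := fun x =>
    IsManifold.subset_maximalAtlas (hmem x)
  refine ⟨⟨Y, n⟩, q, ?_, fun y => ⟨_, hrep y⟩, fun _ _ _ _ => Iff.rfl, ?_⟩
  · intro x hx
    have h1 := (contMDiffOn_symm_of_mem_maximalAtlas (hmax ⟨x, hx⟩)).comp
      (κ ⟨x, hx⟩).c_smooth (fun z hz => (κ ⟨x, hx⟩).c_mem z hz)
    have h2 : ContMDiffOn ((𝓡 A.dim).prod (𝓡 B.dim)) (𝓡 n) ∞ q (κ ⟨x, hx⟩).D :=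
      h1.congr fun z hz => ((κ ⟨x, hx⟩).q_l_c z hz).symm
    exact (h2 x (κ ⟨x, hx⟩).mem_D).mono_of_mem_nhdsWithin
      ((κ ⟨x, hx⟩).D_mem_nhdsWithin x (κ ⟨x, hx⟩).mem_D)
  · intro x hx
    refine ⟨fun y => (κ ⟨x, hx⟩).l (κ' ⟨x, hx⟩ y), (κ' ⟨x, hx⟩).source, (κ' ⟨x, hx⟩).open_source,
      ((κ ⟨x, hx⟩).rep_mem_D_iff rep hrep hx).2 (κ ⟨x, hx⟩).mem_D,
      (κ ⟨x, hx⟩).l_smooth.comp (contMDiffOn_of_mem_maximalAtlas (hmax ⟨x, hx⟩))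
        (κ' ⟨x, hx⟩).mapsTo, ?_, ?_⟩
    · have := (κ ⟨x, hx⟩).chart_apply rep hrep (κ ⟨x, hx⟩).mem_D
      exact (congrArg (κ ⟨x, hx⟩).l this).trans (κ ⟨x, hx⟩).l_c_base
    · intro y hy
      exact ⟨(κ ⟨x, hx⟩).D_sub ((κ ⟨x, hx⟩).l_mem _ ((κ' ⟨x, hx⟩).map_source hy)),
        (κ' ⟨x, hx⟩).left_inv hy⟩

end Quotient

/-! ### The quotient of a fibred product by the diagonal action -/

section DiagonalQuotient

variable {G : LieGroupoid.{u}} {A B M N : Mfd.{u}} {τ : A → G.X} {π₁ : A → M}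
  {act₁ : G.arr → A → A} {μ : B → G.X} {ν : B → N} {act : G.arr → B → B}

theorem IsLeftPrincipal.act_one_of_eq (h : IsLeftPrincipal G μ ν act) {x : G.X} {b : B}
    (hx : x = μ b) : act (G.one x) b = b := by rw [hx, h.act_one]

theorem IsLeftPrincipal.mul_div (h₁ : IsLeftPrincipal G τ π₁ act₁) {g : G.arr} {a a' : A}
    (hg : G.s g = τ a) (haa' : π₁ a = π₁ a') :
    G.mul (h₁.div (act₁ g a) a') g = h₁.div a a' ∧ G.s (h₁.div (act₁ g a) a') = G.t g := by
  have h2 : π₁ (act₁ g a) = π₁ a' := (h₁.proj_act g a hg).trans haa'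
  have h3 : G.s (h₁.div (act₁ g a) a') = G.t g := (h₁.s_div h2).trans (h₁.moment_act g a hg)
  refine ⟨h₁.act_injective ((G.s_mul _ _ h3).trans hg) (h₁.s_div haa') ?_, h3⟩
  rw [← h₁.act_act _ _ _ h3 hg, h₁.act_div h2, h₁.act_div haa']

/-- Near `a₀` every diagonal orbit has a unique representative whose first entry lies on a local
section `σ` of `π₁`, namely `(σ (π₁ a), T (a, b))`. Its coordinates are those of `π₁ a` in `M`,
together with the coordinates of `T (a, b)` along the fibre of `μ`; this accounts for the dimension.
Choosing `σ` through `a₀` makes the section of the chart pass through the given point. -/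
theorem exists_sliceChart (h₁ : IsLeftPrincipal G τ π₁ act₁) (h : IsLeftPrincipal G μ ν act)
    {Y : Type u} {q : A × B → Y}
    (hq : ∀ x ∈ fibProd τ μ, ∀ y ∈ fibProd τ μ, q x = q y ↔
      ∃ g, G.s g = τ x.1 ∧ y = (act₁ g x.1, act g x.2)) {x : A × B} (hx : x ∈ fibProd τ μ) :
    Nonempty (SliceChart (fibProd τ μ) q (M.dim + (B.dim - G.X.dim)) x) := by
  obtain ⟨a₀, b₀⟩ := x
  have hab : τ a₀ = μ b₀ := hx
  obtain ⟨σ, OM, hOM, haOM, hσ, hσa, hσ'⟩ := exists_local_section isOpen_univ (mem_univ a₀)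
    h₁.proj_submersion.smooth.contMDiffOn (h₁.proj_submersion.submersive a₀)
  obtain ⟨k, y, Ψ, W, V, hk, hW, hbW, hV, hy, hΨ, hΨ1, hΨ2⟩ :=
    h.moment_submersion.exists_straightening b₀
  rw [show B.dim - G.X.dim = k by omega]
  set κ := extChartAt (𝓡 M.dim) (π₁ a₀) with hκ
  let ι : EuclideanSpace ℝ (Fin (M.dim + k)) ≃L[ℝ]
      EuclideanSpace ℝ (Fin M.dim) × EuclideanSpace ℝ (Fin k) :=
    ContinuousLinearEquiv.ofFinrankEq (by simp)
  have hκs : ContMDiffOn (𝓡 M.dim) (𝓡 M.dim) ∞ κ κ.source := by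
    rw [hκ, extChartAt_source]; exact contMDiffOn_extChartAt
  have hκt : ContMDiffOn (𝓡 M.dim) (𝓡 M.dim) ∞ κ.symm κ.target := contMDiffOn_extChartAt_symm _
  have hκo : IsOpen κ.source := isOpen_extChartAt_source _
  have hκto : IsOpen κ.target := isOpen_extChartAt_target _
  -- translation of `b` along the arrow that takes `a` to the local section
  let T : A × B → B := fun z => act (h₁.div z.1 (σ (π₁ z.1))) z.2
  set D₀ : Set (A × B) := {z | z ∈ fibProd τ μ ∧ π₁ z.1 ∈ OM ∩ κ.source} with hD₀
  have hdiv : ∀ z ∈ D₀, π₁ z.1 = π₁ (σ (π₁ z.1)) := fun z hz => (hσ' _ hz.2.1).2.symm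
  have hsd : ∀ z ∈ D₀, G.s (h₁.div z.1 (σ (π₁ z.1))) = μ z.2 := fun z hz =>
    (h₁.s_div (hdiv z hz)).trans hz.1
  have hπ₁ : ContMDiff ((𝓡 A.dim).prod (𝓡 B.dim)) (𝓡 M.dim) ∞ (fun z : A × B => π₁ z.1) :=
    h₁.proj_submersion.smooth.comp contMDiff_fst
  have hTs : ContMDiffOn ((𝓡 A.dim).prod (𝓡 B.dim)) (𝓡 B.dim) ∞ T D₀ := by
    refine ContMDiffOn.comp (g := fun x : G.arr × B => act x.1 x.2) h.act_smooth
      (ContMDiffOn.prodMk ?_ contMDiffOn_snd) fun z hz => hsd z hz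
    exact ContMDiffOn.comp (g := fun z : A × A => h₁.div z.1 z.2) h₁.div_smooth
      (contMDiffOn_fst.prodMk (hσ.comp hπ₁.contMDiffOn fun z hz => hz.2.1)) fun z hz => hdiv z hz
  have hD₀n : ∀ z ∈ D₀, D₀ ∈ 𝓝[fibProd τ μ] z := fun z hz =>
    inter_mem_nhdsWithin _
      (((hOM.inter hκo).preimage hπ₁.continuous).mem_nhds hz.2)
  have hμT : ∀ z ∈ D₀, μ (T z) = τ (σ (π₁ z.1)) := fun z hz =>
    (h.moment_act _ _ (hsd z hz)).trans (h₁.t_div (hdiv z hz))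
  -- the section
  let m : EuclideanSpace ℝ (Fin (M.dim + k)) → M := fun w => κ.symm (ι w).1
  have hι1 : ContMDiff (𝓡 (M.dim + k)) (𝓡 M.dim) ∞ (fun w => (ι w).1) :=
    (contDiff_fst.comp ι.contDiff).contMDiff
  have hι2 : ContMDiff (𝓡 (M.dim + k)) (𝓡 k) ∞ (fun w => (ι w).2) :=
    (contDiff_snd.comp ι.contDiff).contMDiff
  set O₁ : Set (EuclideanSpace ℝ (Fin (M.dim + k))) := (fun w => (ι w).1) ⁻¹' κ.target with hO₁
  have hO₁o : IsOpen O₁ := hκto.preimage hι1.continuous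
  have hm : ContMDiffOn (𝓡 (M.dim + k)) (𝓡 M.dim) ∞ m O₁ :=
    hκt.comp hι1.contMDiffOn fun w hw => hw
  have hO₂o : IsOpen (O₁ ∩ m ⁻¹' OM) := hm.continuousOn.isOpen_inter_preimage hO₁o hOM
  have hσm : ContMDiffOn (𝓡 (M.dim + k)) (𝓡 A.dim) ∞ (fun w => σ (m w)) (O₁ ∩ m ⁻¹' OM) :=
    hσ.comp (hm.mono inter_subset_left) fun w hw => hw.2
  have hpair : ContMDiffOn (𝓡 (M.dim + k)) ((𝓡 G.X.dim).prod (𝓡 k)) ∞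
      (fun w => (τ (σ (m w)), (ι w).2)) (O₁ ∩ m ⁻¹' OM) :=
    (h₁.moment_submersion.smooth.comp_contMDiffOn hσm).prodMk hι2.contMDiffOn
  have hOo := hpair.continuousOn.isOpen_inter_preimage hO₂o hV
  have hΨm : ContMDiffOn (𝓡 (M.dim + k)) (𝓡 B.dim) ∞ (fun w => Ψ (τ (σ (m w)), (ι w).2))
      ((O₁ ∩ m ⁻¹' OM) ∩ (fun w => (τ (σ (m w)), (ι w).2)) ⁻¹' V) :=
    hΨ.comp (hpair.mono inter_subset_left) fun w hw => hw.2
  have hl0 : ∀ w ∈ (O₁ ∩ m ⁻¹' OM) ∩ (fun w => (τ (σ (m w)), (ι w).2)) ⁻¹' V,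
      ((σ (m w), Ψ (τ (σ (m w)), (ι w).2)) : A × B) ∈ D₀ ∧ π₁ (σ (m w)) = m w ∧
      T (σ (m w), Ψ (τ (σ (m w)), (ι w).2)) = Ψ (τ (σ (m w)), (ι w).2) := by
    intro w hw
    have e1 : π₁ (σ (m w)) = m w := (hσ' _ hw.1.2).2
    have e2 : τ (σ (m w)) = μ (Ψ (τ (σ (m w)), (ι w).2)) := (hΨ2 _ hw.2).2.1.symm
    refine ⟨⟨e2, ?_⟩, e1, ?_⟩
    · simp only [e1]
      exact ⟨hw.1.2, κ.map_target hw.1.1⟩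
    · simp only [T, e1]
      rw [h₁.div_self]
      exact h.act_one_of_eq e2
  have hcD : ∀ z ∈ D₀ ∩ T ⁻¹' W, m (ι.symm (κ (π₁ z.1), y (T z))) = π₁ z.1 := fun z hz => by
    simp only [m, ContinuousLinearEquiv.apply_symm_apply]
    exact κ.left_inv hz.1.2.2
  have hrec : ∀ z ∈ D₀ ∩ T ⁻¹' W, (τ (σ (π₁ z.1)), y (T z)) ∈ V ∧
      Ψ (τ (σ (π₁ z.1)), y (T z)) = T z := fun z hz => by
    have := hΨ1 _ hz.2
    rwa [hμT z hz.1] at this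
  have hlc : ∀ z ∈ D₀ ∩ T ⁻¹' W,
      ((σ (m (ι.symm (κ (π₁ z.1), y (T z)))), Ψ (τ (σ (m (ι.symm (κ (π₁ z.1), y (T z))))),
        (ι (ι.symm (κ (π₁ z.1), y (T z)))).2)) : A × B) = (σ (π₁ z.1), T z) := fun z hz => by
    rw [hcD z hz, ContinuousLinearEquiv.apply_symm_apply, (hrec z hz).2]
  have hTx : T (a₀, b₀) = b₀ := by
    simp only [T, hσa]
    rw [h₁.div_self, hab, h.act_one]
  have hxD₀ : ((a₀, b₀) : A × B) ∈ D₀ ∩ T ⁻¹' W := by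
    refine ⟨⟨hx, haOM, mem_extChartAt_source _⟩, ?_⟩
    rw [mem_preimage, hTx]; exact hbW
  refine ⟨{
    D := D₀ ∩ T ⁻¹' W
    D_mem_nhdsWithin := fun z hz => ?_
    D_sub := fun z hz => hz.1.1
    mem_D := hxD₀
    O := (O₁ ∩ m ⁻¹' OM) ∩ (fun w => (τ (σ (m w)), (ι w).2)) ⁻¹' V
    isOpen_O := hOo
    c := fun z => ι.symm (κ (π₁ z.1), y (T z))
    c_smooth := ?_
    l := fun w => (σ (m w), Ψ (τ (σ (m w)), (ι w).2))
    l_smooth := (hσm.mono inter_subset_left).prodMk hΨm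
    c_mem := fun z hz => ?_
    l_mem := fun w hw => ⟨(hl0 w hw).1, ?_⟩
    c_l := fun w hw => ?_
    q_l_c := fun z hz => ?_
    saturated := ?_
    l_c_base := ?_ }⟩
  · have h2 := ((hTs.continuousOn z hz.1).mono_of_mem_nhdsWithin
      (hD₀n z hz.1)).preimage_mem_nhdsWithin (hW.mem_nhds hz.2)
    exact inter_mem (hD₀n z hz.1) h2
  · have h3 : ContMDiffOn ((𝓡 A.dim).prod (𝓡 B.dim))
        𝓘(ℝ, EuclideanSpace ℝ (Fin M.dim) × EuclideanSpace ℝ (Fin k)) ∞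
        (fun z => (κ (π₁ z.1), y (T z))) (D₀ ∩ T ⁻¹' W) := by
      rw [modelWithCornersSelf_prod, ← chartedSpaceSelf_prod]
      exact (hκs.comp hπ₁.contMDiffOn fun z hz => hz.1.2.2).prodMk
        (hy.comp (hTs.mono inter_subset_left) fun z hz => hz.2)
    exact ι.symm.contDiff.contMDiff.comp_contMDiffOn h3
  · refine ⟨⟨?_, ?_⟩, ?_⟩
    · simp only [hO₁, mem_preimage, ContinuousLinearEquiv.apply_symm_apply]
      exact κ.map_source hz.1.2.2
    · rw [mem_preimage, hcD z hz]
      exact hz.1.2.1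
    · simp only [mem_preimage]
      rw [hcD z hz, ContinuousLinearEquiv.apply_symm_apply]
      exact (hrec z hz).1
  · rw [mem_preimage, (hl0 w hw).2.2]
    exact (hΨ2 _ hw.2).1
  · rw [(hl0 w hw).2.2, (hl0 w hw).2.1, (hΨ2 _ hw.2).2.2, ι.symm_apply_eq]
    exact Prod.ext (κ.right_inv hw.1.1) rfl
  · rw [hlc z hz]
    refine ((hq z hz.1.1 _ ?_).2 ⟨_, h₁.s_div (hdiv z hz.1), ?_⟩).symm
    · exact (hμT z hz.1).symm
    · rw [h₁.act_div (hdiv z hz.1)]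
  · intro z hz z' hz' hqz
    obtain ⟨g, hg, rfl⟩ := (hq z hz.1.1 z' hz').1 hqz
    have e1 : π₁ (act₁ g z.1) = π₁ z.1 := h₁.proj_act g _ hg
    have e2 := h₁.mul_div hg (hdiv z hz.1)
    -- The arrow from `g · a` to `σ`, multiplied by `g`, is the arrow from `a` to `σ`; hence `T` is
    -- constant on diagonal orbits.
    have e3 : T (act₁ g z.1, act g z.2) = T z := by
      simp only [T, e1]
      rw [h.act_act _ _ _ e2.2 (hg.trans hz.1.1), e2.1]
    refine ⟨⟨⟨hz', ?_⟩, ?_⟩, ?_⟩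
    · simp only [e1]; exact hz.1.2
    · rw [mem_preimage, e3]; exact hz.2
    · simp only [e1, e3]
  · rw [hlc _ hxD₀, hTx, hσa]

/-- The orbit relation of the diagonal action on a fibred product. -/
def orbitSetoid (h₁ : IsLeftPrincipal G τ π₁ act₁) (h : IsLeftPrincipal G μ ν act) :
    Setoid (fibProd τ μ) where
  r x y := ∃ g, G.s g = τ x.1.1 ∧ y.1 = (act₁ g x.1.1, act g x.1.2)
  iseqv := by
    refine ⟨fun x => ⟨G.one (τ x.1.1), G.s_one _, ?_⟩, ?_, ?_⟩
    · have hx : τ x.1.1 = μ x.1.2 := x.2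
      refine Prod.ext (h₁.act_one _).symm ?_
      simp only
      rw [hx, h.act_one]
    · rintro ⟨⟨a, b⟩, hx⟩ ⟨⟨a', b'⟩, hy⟩ ⟨g, hg, he⟩
      have hx : τ a = μ b := hx
      simp only [Prod.mk.injEq] at he hg
      obtain ⟨rfl, rfl⟩ := he
      refine ⟨G.inv g, ?_, ?_⟩
      · rw [G.s_inv, h₁.moment_act g a hg]
      · simp only
        rw [h₁.act_inv_act hg, h.act_inv_act (hg.trans hx)]
    · rintro ⟨⟨a, b⟩, hx⟩ ⟨⟨a', b'⟩, hy⟩ ⟨⟨a'', b''⟩, hz⟩ ⟨g, hg, he⟩ ⟨g', hg', he'⟩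
      have hx : τ a = μ b := hx
      simp only [Prod.mk.injEq] at he he' hg hg'
      obtain ⟨rfl, rfl⟩ := he
      obtain ⟨rfl, rfl⟩ := he'
      have hs : G.s g' = G.t g := hg'.trans (h₁.moment_act g a hg)
      refine ⟨G.mul g' g, (G.s_mul _ _ hs).trans hg, ?_⟩
      simp only
      rw [h₁.act_act _ _ _ hs hg, h.act_act _ _ _ hs (hg.trans hx)]

/-- The quotient of a fibred product by the diagonal action. -/
theorem exists_diagonal_quotient (h₁ : IsLeftPrincipal G τ π₁ act₁)
    (h : IsLeftPrincipal G μ ν act) :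
    ∃ (Y : Mfd.{u}) (q : A × B → Y), SmoothOn q (fibProd τ μ) ∧ (∀ y, ∃ x ∈ fibProd τ μ, q x = y) ∧
      (∀ x ∈ fibProd τ μ, ∀ y ∈ fibProd τ μ, q x = q y ↔
        ∃ g, G.s g = τ x.1 ∧ y = (act₁ g x.1, act g x.2)) ∧
      ∀ x ∈ fibProd τ μ, ∃ (l : Y → A × B) (U : Set Y), IsOpen U ∧ q x ∈ U ∧
        ContMDiffOn (𝓡 Y.dim) ((𝓡 A.dim).prod (𝓡 B.dim)) ∞ l U ∧ l (q x) = x ∧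
        ∀ y ∈ U, l y ∈ fibProd τ μ ∧ q (l y) = y := by
  classical
  have hfill : ∀ a : A, ∃ b : B, τ a = μ b := fun a =>
    (h.moment_submersion.surj (τ a)).imp fun _ => Eq.symm
  choose fill hfill using hfill
  -- The map has to be defined on all of `A × B`. Outside of the fibred product the second entry is
  -- replaced by an arbitrary point over `τ x.1`; these values play no role.
  let q : A × B → Quotient (orbitSetoid h₁ h) := fun x =>
    if hx : x ∈ fibProd τ μ then Quotient.mk _ ⟨x, hx⟩ else Quotient.mk _ ⟨(x.1, fill x.1), hfill _⟩
  have hqS : ∀ x (hx : x ∈ fibProd τ μ), q x = Quotient.mk _ ⟨x, hx⟩ := fun x hx => dif_pos hx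
  have hq : ∀ x ∈ fibProd τ μ, ∀ y ∈ fibProd τ μ, q x = q y ↔
      ∃ g, G.s g = τ x.1 ∧ y = (act₁ g x.1, act g x.2) := by
    intro x hx y hy
    rw [hqS x hx, hqS y hy, Quotient.eq]
    exact Iff.rfl
  have hsurj : ∀ y, ∃ x ∈ fibProd τ μ, q x = y := by
    intro y
    induction y using Quotient.inductionOn with
    | h x => exact ⟨x.1, x.2, hqS _ _⟩
  obtain ⟨Y, p, h1, h2, h3, h4⟩ := exists_quotient_mfd (fibProd τ μ) q hsurj _
    fun x hx => exists_sliceChart h₁ h hq hx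
  exact ⟨Y, p, h1, h2, fun x hx y hy => (h3 x hx y hy).trans (hq x hx y hy), h4⟩

end DiagonalQuotient

/-! ### Transport between fibres and representations -/

theorem VBundle.tr_tr {X : Mfd.{u}} (E : VBundle X) {x y z : X} (h : x = y) (h' : y = z)
    (e : E.fib x) : E.tr h' (E.tr h e) = E.tr (h.trans h') e := by
  subst h h'; rfl

theorem VBundle.tr_self {X : Mfd.{u}} (E : VBundle X) {x : X} (h : x = x) (e : E.fib x) :
    E.tr h e = e := rfl

theorem VBundle.tr_eq_iff {X : Mfd.{u}} (E : VBundle X) {x y : X} (h : x = y) {e : E.fib x}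
    {e' : E.fib y} : E.tr h e = e' ↔ e = E.tr h.symm e' := by
  subst h; rfl

namespace Representation

variable {G : LieGroupoid.{u}} (R : Representation G)

theorem act_tr {g : G.arr} {x' x y : G.X} (hx : G.s g = x) (hy : G.t g = y) (h : x' = x)
    (e : R.E.fib x') : R.act g hx hy (R.E.tr h e) = R.act g (hx.trans h.symm) hy e := by
  subst h; rfl

theorem tr_act {g : G.arr} {x y y' : G.X} (hx : G.s g = x) (hy : G.t g = y) (h : y = y')
    (e : R.E.fib x) : R.E.tr h (R.act g hx hy e) = R.act g hx (hy.trans h) e := by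
  subst h; rfl

theorem act_congr {g g' : G.arr} (hg : g = g') {x y : G.X} (hx : G.s g = x) (hy : G.t g = y)
    (e : R.E.fib x) : R.act g hx hy e = R.act g' (hg ▸ hx) (hg ▸ hy) e := by
  subst hg; rfl

theorem act_one {z x y : G.X} (hx : G.s (G.one z) = x) (hy : G.t (G.one z) = y) (e : R.E.fib x) :
    R.act (G.one z) hx hy e = R.E.tr (hx.symm.trans ((G.s_one z).trans ((G.t_one z).symm.trans hy)))
      e := by
  have h := LinearMap.congr_fun (R.rep_one z) (R.E.tr (hx.symm.trans (G.s_one z)) e)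
  rw [LinearMap.id_apply] at h
  have h' : R.act (G.one z) (G.s_one z) (G.t_one z) (R.E.tr (hx.symm.trans (G.s_one z)) e) =
    R.E.tr (hx.symm.trans (G.s_one z)) e := h
  rw [R.act_tr] at h'
  have h2 := congrArg (R.E.tr ((G.t_one z).symm.trans hy)) h'
  rw [R.tr_act, R.E.tr_tr] at h2
  exact h2

theorem act_mul {g h : G.arr} (hgh : G.s g = G.t h) {x y : G.X} (hx : G.s (G.mul g h) = x)
    (hy : G.t (G.mul g h) = y) (e : R.E.fib x) :
    R.act (G.mul g h) hx hy e = R.act g hgh ((G.t_mul g h hgh).symm.trans hy)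
      (R.act h ((G.s_mul g h hgh).symm.trans hx) rfl e) := by
  subst hy
  obtain rfl : G.s h = x := (G.s_mul g h hgh).symm.trans hx
  have h1 := LinearMap.congr_fun (R.rep_mul g h hgh) e
  have h' : R.act (G.mul g h) (G.s_mul g h hgh) (G.t_mul g h hgh) e =
    R.act g hgh rfl (R.act h rfl rfl e) := h1
  have h2 := congrArg (R.E.tr (G.t_mul g h hgh).symm) h'
  rw [R.tr_act, R.tr_act] at h2
  exact h2

theorem act_inv_act {g : G.arr} {x y : G.X} (hx : G.s g = x) (hy : G.t g = y)
    (hx' : G.s (G.inv g) = y) (hy' : G.t (G.inv g) = x) (e : R.E.fib x) :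
    R.act (G.inv g) hx' hy' (R.act g hx hy e) = e := by
  subst hx hy
  have hs : G.s (G.mul (G.inv g) g) = G.s g := by rw [G.inv_mul, G.s_one]
  have ht : G.t (G.mul (G.inv g) g) = G.s g := by rw [G.inv_mul, G.t_one]
  have h1 := R.act_mul (G.s_inv g) hs ht e
  rw [R.act_congr (G.inv_mul g), R.act_one] at h1
  exact h1.symm

theorem act_act_inv {g : G.arr} {x y : G.X} (hx : G.s g = x) (hy : G.t g = y)
    (hx' : G.s (G.inv g) = y) (hy' : G.t (G.inv g) = x) (e : R.E.fib y) :
    R.act g hx hy (R.act (G.inv g) hx' hy' e) = e := by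
  have h1 := R.act_inv_act hx' hy' (by rw [G.inv_inv]; exact hx) (by rw [G.inv_inv]; exact hy) e
  rwa [R.act_congr (G.inv_inv g)] at h1

end Representation

/-! ### Smoothness of forms -/

section SmoothForms

variable {X : Mfd.{u}} {E : VBundle X}

/-- Smoothness is tested in a trivialization around `b n₀`, which is linear on the nearby fibres. -/
theorem contMDiffAt_tot_sub {E' H' N : Type*} [NormedAddCommGroup E'] [NormedSpace ℝ E']
    [TopologicalSpace H'] [TopologicalSpace N] [ChartedSpace H' N] {I : ModelWithCorners ℝ E' H'}
    {b : N → X} {v w : ∀ n, E.fib (b n)} {n₀ : N}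
    (hv : ContMDiffAt I E.model ∞ (fun n => (⟨b n, v n⟩ : E.Tot)) n₀)
    (hw : ContMDiffAt I E.model ∞ (fun n => (⟨b n, w n⟩ : E.Tot)) n₀) :
    ContMDiffAt I E.model ∞ (fun n => (⟨b n, v n - w n⟩ : E.Tot)) n₀ := by
  rw [contMDiffAt_totalSpace] at hv hw ⊢
  refine ⟨hv.1, (hv.2.sub hw.2).congr_of_eventuallyEq ?_⟩
  have hmem : ∀ᶠ n in 𝓝 n₀,
      b n ∈ (trivializationAt (EuclideanSpace ℝ (Fin E.rank)) E.fib (b n₀)).baseSet :=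
    hv.1.continuousAt.preimage_mem_nhds
      ((trivializationAt _ _ (b n₀)).open_baseSet.mem_nhds (mem_baseSet_trivializationAt _ _ _))
  filter_upwards [hmem] with n hn
  exact ((trivializationAt (EuclideanSpace ℝ (Fin E.rank)) E.fib (b n₀)).linear ℝ hn).map_sub _ _

theorem contMDiffAt_tot_neg {E' H' N : Type*} [NormedAddCommGroup E'] [NormedSpace ℝ E']
    [TopologicalSpace H'] [TopologicalSpace N] [ChartedSpace H' N] {I : ModelWithCorners ℝ E' H'}
    {b : N → X} {v : ∀ n, E.fib (b n)} {n₀ : N}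
    (hv : ContMDiffAt I E.model ∞ (fun n => (⟨b n, v n⟩ : E.Tot)) n₀) :
    ContMDiffAt I E.model ∞ (fun n => (⟨b n, - v n⟩ : E.Tot)) n₀ := by
  rw [contMDiffAt_totalSpace] at hv ⊢
  refine ⟨hv.1, hv.2.neg.congr_of_eventuallyEq ?_⟩
  have hmem : ∀ᶠ n in 𝓝 n₀,
      b n ∈ (trivializationAt (EuclideanSpace ℝ (Fin E.rank)) E.fib (b n₀)).baseSet :=
    hv.1.continuousAt.preimage_mem_nhds
      ((trivializationAt _ _ (b n₀)).open_baseSet.mem_nhds (mem_baseSet_trivializationAt _ _ _))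
  filter_upwards [hmem] with n hn
  exact ((trivializationAt (EuclideanSpace ℝ (Fin E.rank)) E.fib (b n₀)).linear ℝ hn).map_neg _

theorem FormOn.IsSmooth.neg {P : Mfd.{u}} {f : P → X} {θ : FormOn P f E} (hθ : θ.IsSmooth) :
    FormOn.IsSmooth (fun p => - θ p : FormOn P f E) :=
  fun v => contMDiffAt_tot_neg (hθ v)

theorem linTot_apply {P Y : Mfd.{u}} {f : P → X} {g : P → Y} {F : VBundle Y}
    (L : ∀ p : P, E.fib (f p) →ₗ[ℝ] F.fib (g p)) (p : P) (e : E.fib (f p)) :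
    linTot L (p, ⟨f p, e⟩) = ⟨g p, L p e⟩ := by
  simp only [linTot]
  rw [dif_pos trivial]
  rfl

/-- A smooth bundle morphism takes smooth maps into `f^*E` to smooth maps into `g^*F`. -/
theorem IsSmoothLin.contMDiffAt {P Y : Mfd.{u}} {f : P → X} {g : P → Y} {F : VBundle Y}
    {L : ∀ p : P, E.fib (f p) →ₗ[ℝ] F.fib (g p)} (hL : IsSmoothLin L)
    {E' H' N : Type*} [NormedAddCommGroup E'] [NormedSpace ℝ E']
    [TopologicalSpace H'] [TopologicalSpace N] [ChartedSpace H' N] {I : ModelWithCorners ℝ E' H'}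
    {c : N → P} {v : ∀ n, E.fib (f (c n))} {n₀ : N} (hc : ContMDiffAt I (𝓡 P.dim) ∞ c n₀)
    (hv : ContMDiffAt I E.model ∞ (fun n => (⟨f (c n), v n⟩ : E.Tot)) n₀) :
    ContMDiffAt I F.model ∞ (fun n => (⟨g (c n), L (c n) (v n)⟩ : F.Tot)) n₀ := by
  have h1 : ContMDiffAt I ((𝓡 P.dim).prod E.model) ∞
      (fun n => ((c n, ⟨f (c n), v n⟩) : P × E.Tot)) n₀ := hc.prodMk hv
  have h2 := ContMDiffWithinAt.comp (s := univ) n₀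
    (hL (c n₀, ⟨f (c n₀), v n₀⟩) rfl) h1.contMDiffWithinAt (fun n _ => rfl)
  rw [contMDiffWithinAt_univ] at h2
  exact h2.congr_of_eventuallyEq (Eventually.of_forall fun n => (linTot_apply L (c n) (v n)).symm)

theorem FormOn.IsSmooth.lin_comp {P Y : Mfd.{u}} {f : P → X} {g : P → Y} {F : VBundle Y}
    {θ : FormOn P f E} (hθ : θ.IsSmooth) {L : ∀ p : P, E.fib (f p) →ₗ[ℝ] F.fib (g p)}
    (hL : IsSmoothLin L) : FormOn.IsSmooth (fun p => (L p).comp (θ p) : FormOn P g F) := fun v =>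
  hL.contMDiffAt (c := fun v : TangentBundle (𝓡 P.dim) P => v.1)
    (contMDiff_proj (TangentSpace (𝓡 P.dim)) v) (hθ v)

end SmoothForms

/-! ### Left and right principal bundles -/

section LeftRight

variable {G : LieGroupoid.{u}} {P M : Mfd.{u}} {μ : P → G.X} {proj : P → M}

theorem IsRightPrincipal.toLeft {act : P → G.arr → P} (h : IsRightPrincipal G μ proj act) :
    IsLeftPrincipal G μ proj (fun g p => act p (G.inv g)) where
  moment_submersion := h.moment_submersion
  proj_submersion := h.proj_submersion
  act_smooth := ContMDiffOn.comp (g := fun x : P × G.arr => act x.1 x.2) h.act_smooth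
    (contMDiffOn_snd.prodMk (G.inv_smooth.comp contMDiff_fst).contMDiffOn) fun x hx => by
      have hx : G.s x.1 = μ x.2 := hx
      exact hx.symm.trans (G.t_inv _).symm
  moment_act g p hg := by rw [h.moment_act _ _ (hg.symm.trans (G.t_inv _).symm), G.s_inv]
  act_one p := by rw [G.inv_one, h.act_one]
  act_act g k p hgk hk := by
    rw [h.act_act _ _ _ (hk.symm.trans (G.t_inv _).symm) (by rw [G.s_inv, G.t_inv, hgk]),
      G.inv_mul_rev hgk]
  proj_act g p hg := h.proj_act _ _ (hg.symm.trans (G.t_inv _).symm)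
  transitive p q hpq := by
    obtain ⟨g, hg, hq⟩ := h.transitive p q hpq
    exact ⟨G.inv g, (G.s_inv g).trans hg.symm, by rw [G.inv_inv]; exact hq⟩
  free g p hg hp := by
    have := h.free p _ (hg.symm.trans (G.t_inv _).symm) hp
    rw [← G.inv_inv g, this, G.inv_one]
  proper := by
    let φ : fibProd G.s μ ≃ₜ fibProd μ G.t :=
      { toFun := fun x => ⟨(x.1.2, G.inv x.1.1), (x.2 : G.s x.1.1 = μ x.1.2).symm.trans
          (G.t_inv _).symm⟩
        invFun := fun x => ⟨(G.inv x.1.2, x.1.1), (G.s_inv _).trans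
          (x.2 : μ x.1.1 = G.t x.1.2).symm⟩
        left_inv := fun x => Subtype.ext (Prod.ext (G.inv_inv _) rfl)
        right_inv := fun x => Subtype.ext (Prod.ext rfl (G.inv_inv _))
        continuous_toFun := by
          have := G.inv_smooth.continuous
          fun_prop
        continuous_invFun := by
          have := G.inv_smooth.continuous
          fun_prop }
    exact h.proper.comp φ.isProperMap

theorem IsLeftPrincipal.toRight {act : G.arr → P → P} (h : IsLeftPrincipal G μ proj act) :
    IsRightPrincipal G μ proj (fun p g => act (G.inv g) p) where
  moment_submersion := h.moment_submersion
  proj_submersion := h.proj_submersion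
  act_smooth := ContMDiffOn.comp (g := fun x : G.arr × P => act x.1 x.2) h.act_smooth
    ((G.inv_smooth.comp contMDiff_snd).contMDiffOn.prodMk contMDiffOn_fst) fun x hx => by
      have hx : μ x.1 = G.t x.2 := hx
      exact (G.s_inv _).trans hx.symm
  moment_act p g hg := by rw [h.moment_act _ _ ((G.s_inv _).trans hg.symm), G.t_inv]
  act_one p := by rw [G.inv_one, h.act_one]
  act_act p g k hg hgk := by
    rw [h.act_act _ _ _ (by rw [G.s_inv, G.t_inv, hgk]) ((G.s_inv _).trans hg.symm),
      G.inv_mul_rev hgk]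
  proj_act p g hg := h.proj_act _ _ ((G.s_inv _).trans hg.symm)
  transitive p q hpq := by
    obtain ⟨g, hg, hq⟩ := h.transitive p q hpq
    exact ⟨G.inv g, ((G.t_inv g).trans hg).symm, by rw [G.inv_inv]; exact hq⟩
  free p g hg hp := by
    have := h.free _ p ((G.s_inv _).trans hg.symm) hp
    rw [← G.inv_inv g, this, G.inv_one]
  proper := by
    let φ : fibProd μ G.t ≃ₜ fibProd G.s μ :=
      { toFun := fun x => ⟨(G.inv x.1.2, x.1.1), (G.s_inv _).trans
          (x.2 : μ x.1.1 = G.t x.1.2).symm⟩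
        invFun := fun x => ⟨(x.1.2, G.inv x.1.1), (x.2 : G.s x.1.1 = μ x.1.2).symm.trans
          (G.t_inv _).symm⟩
        left_inv := fun x => Subtype.ext (Prod.ext rfl (G.inv_inv _))
        right_inv := fun x => Subtype.ext (Prod.ext (G.inv_inv _) rfl)
        continuous_toFun := by
          have := G.inv_smooth.continuous
          fun_prop
        continuous_invFun := by
          have := G.inv_smooth.continuous
          fun_prop }
    exact h.proper.comp φ.isProperMap

end LeftRight

/-! ### Multiplicativity in terms of curves -/

section Ev

variable {P X : Mfd.{u}} {f : P → X} {E : VBundle X} (θ : FormOn P f E)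

/-- The value of a form at a point `p` over `x`, on a vector given in the model space. -/
noncomputable def FormOn.ev (θ : FormOn P f E) (p : P) {x : X} (h : f p = x)
    (v : EuclideanSpace ℝ (Fin P.dim)) : E.fib x := θ.val p h v

theorem FormOn.ev_congr {p p' : P} (hp : p = p') {x : X} (h : f p = x)
    (v : EuclideanSpace ℝ (Fin P.dim)) : θ.ev p h v = θ.ev p' (hp ▸ h) v := by
  subst hp; rfl

theorem FormOn.tr_ev {p : P} {x y : X} (h : f p = x) (h' : x = y)
    (v : EuclideanSpace ℝ (Fin P.dim)) : E.tr h' (θ.ev p h v) = θ.ev p (h.trans h') v := by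
  subst h h'; rfl

theorem FormOn.ev_neg_form {p : P} {x : X} (h : f p = x) (v : EuclideanSpace ℝ (Fin P.dim)) :
    FormOn.ev (fun p => - θ p : FormOn P f E) p h v = - θ.ev p h v := by
  subst h; rfl

theorem FormOn.ev_zero {p : P} {x : X} (h : f p = x) : θ.ev p h 0 = 0 := by
  subst h; exact map_zero (θ p)

theorem FormOn.tot_ev {p : P} {x : X} (h : f p = x) (v : EuclideanSpace ℝ (Fin P.dim)) :
    (⟨x, θ.ev p h v⟩ : E.Tot) = θ.tot ⟨p, v⟩ := by
  subst h; rfl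

end Ev

namespace PfaffianGroupoid

variable (Γ : PfaffianGroupoid.{u})

/-- Multiplicativity along curves. The velocity `z` of the product and the base points `x`, `y` are
variables, so that it applies to fibres that are equal only propositionally. -/
theorem form_mul {g h : ℝ → Γ.G.arr} {v w z} (hg : Vel Γ.G.arr g v) (hh : Vel Γ.G.arr h w)
    (hgh : ∀ᶠ t in 𝓝 0, Γ.G.s (g t) = Γ.G.t (h t))
    (hz : Vel Γ.G.arr (fun t => Γ.G.mul (g t) (h t)) z) {x y : Γ.G.X}
    (hy : Γ.G.t (Γ.G.mul (g 0) (h 0)) = y) (hy' : Γ.G.t (g 0) = y) (hx : Γ.G.s (g 0) = x)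
    (hx' : Γ.G.t (h 0) = x) :
    Γ.form.ev (Γ.G.mul (g 0) (h 0)) hy z =
      Γ.form.ev (g 0) hy' v + Γ.R.act (g 0) hx hy' (Γ.form.ev (h 0) hx' w) := by
  subst hy' hx'
  have h1 := Γ.multiplicative (g 0) (h 0) hx v w
    (tangentToFib_of_curves Γ.G.s_submersion.smooth Γ.G.t_smooth hg hh hgh)
  have h2 := hz.unique (Γ.G.mul_smooth.vel hg hh hgh)
  subst h2
  exact h1

/-- A unit satisfies `1 · 1 = 1`, so multiplicativity gives `ω = ω + ω` along curves of units. -/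
theorem form_one {x : ℝ → Γ.G.X} {z} (hz : Vel Γ.G.arr (fun t => Γ.G.one (x t)) z) {y : Γ.G.X}
    (hy : Γ.G.t (Γ.G.one (x 0)) = y) : Γ.form.ev (Γ.G.one (x 0)) hy z = 0 := by
  have hst : ∀ t, Γ.G.s (Γ.G.one (x t)) = Γ.G.t (Γ.G.one (x t)) := fun t => by
    rw [Γ.G.s_one, Γ.G.t_one]
  have hm : ∀ t, Γ.G.mul (Γ.G.one (x t)) (Γ.G.one (x t)) = Γ.G.one (x t) := fun t => by
    have := Γ.G.one_mul (Γ.G.one (x t))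
    rwa [Γ.G.t_one] at this
  have h1 := Γ.form_mul hz hz (Eventually.of_forall hst)
    (hz.congr (Eventually.of_forall hm)) (by rw [hm, hy]) hy ((hst 0).trans hy) hy
  rw [Γ.form.ev_congr (hm 0), Γ.R.act_one, VBundle.tr_self] at h1
  exact left_eq_add.1 h1

/-- Apply multiplicativity to `g g⁻¹ = 1`, where `ω` vanishes, and then act by `g⁻¹`. -/
theorem form_inv {g : ℝ → Γ.G.arr} {w w'} (hg : Vel Γ.G.arr g w)
    (hg' : Vel Γ.G.arr (fun t => Γ.G.inv (g t)) w') {x y : Γ.G.X}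
    (hx : Γ.G.t (Γ.G.inv (g 0)) = x) (hy : Γ.G.s (Γ.G.inv (g 0)) = y) (hy' : Γ.G.t (g 0) = y) :
    Γ.form.ev (Γ.G.inv (g 0)) hx w' =
      - Γ.R.act (Γ.G.inv (g 0)) hy hx (Γ.form.ev (g 0) hy' w) := by
  have hst : ∀ t, Γ.G.s (g t) = Γ.G.t (Γ.G.inv (g t)) := fun t => (Γ.G.t_inv _).symm
  obtain ⟨z, hz⟩ : ∃ z, Vel Γ.G.arr (fun t => Γ.G.one (Γ.G.t (g t))) z :=
    ⟨_, Γ.G.one_smooth.vel (Γ.G.t_smooth.vel hg)⟩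
  have h1 := Γ.form_mul hg hg' (Eventually.of_forall hst)
    (hz.congr (Eventually.of_forall fun t => Γ.G.mul_inv (g t)))
    (by rw [Γ.G.mul_inv, Γ.G.t_one, hy']) hy' ((hst 0).trans hx) hx
  rw [Γ.form.ev_congr (Γ.G.mul_inv (g 0))] at h1
  have h2 := Γ.form_one (x := fun t => Γ.G.t (g t)) hz ((Γ.G.t_one _).trans hy')
  have h4 := (neg_eq_of_add_eq_zero_right (h1.symm.trans h2)).symm
  have h5 := congrArg (Γ.R.act (Γ.G.inv (g 0)) hy hx) h4
  rwa [map_neg, Γ.R.act_inv_act] at h5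

end PfaffianGroupoid

section Pfaffian

variable {Γ : PfaffianGroupoid.{u}} {P M : Mfd.{u}} {μ : P → Γ.G.X} {proj : P → M}

theorem IsLeftPfaffian.act_vel {act : Γ.G.arr → P → P} {θ : FormOn P μ Γ.R.E}
    (hp : IsLeftPrincipal Γ.G μ proj act) (h : IsLeftPfaffian Γ μ proj act θ)
    {g : ℝ → Γ.G.arr} {p : ℝ → P} {w v z} (hg : Vel Γ.G.arr g w) (hv : Vel P p v)
    (hgp : ∀ᶠ t in 𝓝 0, Γ.G.s (g t) = μ (p t)) (hz : Vel P (fun t => act (g t) (p t)) z)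
    {x y : Γ.G.X} (hy : μ (act (g 0) (p 0)) = y) (hy' : Γ.G.t (g 0) = y) (hx : Γ.G.s (g 0) = x)
    (hx' : μ (p 0) = x) :
    θ.ev (act (g 0) (p 0)) hy z =
      Γ.form.ev (g 0) hy' w + Γ.R.act (g 0) hx hy' (θ.ev (p 0) hx' v) := by
  subst hy' hx'
  have h1 := h.multiplicative (g 0) (p 0) hx hy w v
    (tangentToFib_of_curves Γ.G.s_submersion.smooth hp.moment_submersion.smooth hg hv hgp)
  have h2 := hz.unique (hp.act_smooth.vel hg hv hgp)
  subst h2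
  exact h1

/-- Every vector tangent to the fibred product is the velocity of a curve in it, so multiplicativity
may be checked along curves. -/
theorem IsLeftPfaffian.of_curves {act : Γ.G.arr → P → P} {θ : FormOn P μ Γ.R.E}
    (hp : IsLeftPrincipal Γ.G μ proj act)
    (H : ∀ (g : ℝ → Γ.G.arr) (p : ℝ → P) (w v z), Vel Γ.G.arr g w → Vel P p v →
      (∀ᶠ t in 𝓝 0, Γ.G.s (g t) = μ (p t)) → Vel P (fun t => act (g t) (p t)) z →
      ∀ (hs : Γ.G.s (g 0) = μ (p 0)) (hm : μ (act (g 0) (p 0)) = Γ.G.t (g 0)),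
      θ.ev (act (g 0) (p 0)) hm z =
        Γ.form.ev (g 0) rfl w + Γ.R.act (g 0) hs rfl (θ.ev (p 0) rfl v))
    (hker : ∀ p, LinearMap.ker (diff μ p).toLinearMap ⊓ LinearMap.ker (θ p) =
      LinearMap.ker (diff proj p).toLinearMap ⊓ LinearMap.ker (θ p)) :
    IsLeftPfaffian Γ μ proj act θ where
  multiplicative g p hg hm w v hT := by
    obtain ⟨c, c', rfl, rfl, hc, hc', hcc⟩ :=
      exists_curve_fibProd Γ.G.s_submersion hp.moment_submersion.smooth hT
    exact H c c' w v _ hc hc' hcc (hp.act_smooth.vel hc hc' hcc) hg hm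
  ker_eq := hker

theorem IsRightPfaffian.act_vel {act : P → Γ.G.arr → P} {θ : FormOn P μ Γ.R.E}
    (hp : IsRightPrincipal Γ.G μ proj act) (h : IsRightPfaffian Γ μ proj act θ)
    {p : ℝ → P} {g : ℝ → Γ.G.arr} {v w z} (hv : Vel P p v) (hg : Vel Γ.G.arr g w)
    (hgp : ∀ᶠ t in 𝓝 0, μ (p t) = Γ.G.t (g t)) (hz : Vel P (fun t => act (p t) (g t)) z)
    {x y : Γ.G.X} (hm : μ (act (p 0) (g 0)) = y) (hy : Γ.G.t (Γ.G.inv (g 0)) = y)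
    (hx : Γ.G.s (Γ.G.inv (g 0)) = x) (hs : μ (p 0) = x) (hs' : Γ.G.t (g 0) = x) :
    θ.ev (act (p 0) (g 0)) hm z =
      Γ.R.act (Γ.G.inv (g 0)) hx hy (θ.ev (p 0) hs v + Γ.form.ev (g 0) hs' w) := by
  subst hs'
  obtain rfl : Γ.G.s (g 0) = y := (Γ.G.t_inv _).symm.trans hy
  have h1 := h.multiplicative (p 0) (g 0) hs hm v w
    (tangentToFib_of_curves hp.moment_submersion.smooth Γ.G.t_smooth hv hg hgp)
  have h2 := hz.unique (hp.act_smooth.vel hv hg hgp)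
  subst h2
  rw [map_add]
  exact h1

theorem IsRightPfaffian.of_curves {act : P → Γ.G.arr → P} {θ : FormOn P μ Γ.R.E}
    (hp : IsRightPrincipal Γ.G μ proj act)
    (H : ∀ (p : ℝ → P) (g : ℝ → Γ.G.arr) (v w z), Vel P p v → Vel Γ.G.arr g w →
      (∀ᶠ t in 𝓝 0, μ (p t) = Γ.G.t (g t)) → Vel P (fun t => act (p t) (g t)) z →
      ∀ (hs : μ (p 0) = Γ.G.t (g 0)) (hm : μ (act (p 0) (g 0)) = Γ.G.s (g 0)),
      θ.ev (act (p 0) (g 0)) hm z =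
        Γ.R.act (Γ.G.inv (g 0)) (Γ.G.s_inv _) (Γ.G.t_inv _)
          (θ.ev (p 0) hs v + Γ.form.ev (g 0) rfl w))
    (hker : ∀ p, LinearMap.ker (diff μ p).toLinearMap ⊓ LinearMap.ker (θ p) =
      LinearMap.ker (diff proj p).toLinearMap ⊓ LinearMap.ker (θ p)) :
    IsRightPfaffian Γ μ proj act θ where
  multiplicative p g hg hm v w hT := by
    obtain ⟨c, c', rfl, rfl, hc, hc', hcc⟩ :=
      exists_curve_fibProd hp.moment_submersion Γ.G.t_smooth hT
    have := H c c' v w _ hc hc' hcc (hp.act_smooth.vel hc hc' hcc) hg hm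
    rw [map_add] at this
    exact this
  ker_eq := hker

theorem ker_neg {V W : Type*} [AddCommGroup V] [Module ℝ V] [AddCommGroup W] [Module ℝ W]
    (f : V →ₗ[ℝ] W) : LinearMap.ker (-f) = LinearMap.ker f := by
  ext x
  simp

/-- With `g⁻¹` in place of `g`, the right law reads `g · θ - ω`, because inversion pulls `ω` back to
`-g⁻¹ · ω`. Changing the sign of `θ` turns this into the left law `ω + g · θ`. -/
theorem IsRightPfaffian.toLeft {act : P → Γ.G.arr → P} {θ : FormOn P μ Γ.R.E}
    (hp : IsRightPrincipal Γ.G μ proj act) (h : IsRightPfaffian Γ μ proj act θ) :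
    IsLeftPfaffian Γ μ proj (fun g p => act p (Γ.G.inv g)) (fun p => - θ p) := by
  refine IsLeftPfaffian.of_curves hp.toLeft ?_ fun p => ?_
  · intro g p w v z hg hv hgp hz hs hm
    obtain ⟨w', hg'⟩ : ∃ w', Vel Γ.G.arr (fun t => Γ.G.inv (g t)) w' :=
      ⟨_, Γ.G.inv_smooth.vel hg⟩
    rw [FormOn.ev_neg_form, FormOn.ev_neg_form,
      h.act_vel hp hv hg' (hgp.mono fun t ht => ht.symm.trans (Γ.G.t_inv _).symm) hz
        hm (by rw [Γ.G.inv_inv]) (by rw [Γ.G.inv_inv, hs]) rfl ((Γ.G.t_inv _).trans hs),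
      Γ.form_inv hg hg' ((Γ.G.t_inv _).trans hs) (Γ.G.s_inv _) rfl,
      Γ.R.act_congr (Γ.G.inv_inv (g 0)), map_add, map_neg, Γ.R.act_act_inv, map_neg]
    abel
  · have := h.ker_eq p
    rw [ker_neg]
    exact this

theorem IsLeftPfaffian.toRight {act : Γ.G.arr → P → P} {θ : FormOn P μ Γ.R.E}
    (hp : IsLeftPrincipal Γ.G μ proj act) (h : IsLeftPfaffian Γ μ proj act θ) :
    IsRightPfaffian Γ μ proj (fun p g => act (Γ.G.inv g) p) (fun p => - θ p) := by
  refine IsRightPfaffian.of_curves hp.toRight ?_ fun p => ?_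
  · intro p g v w z hv hg hgp hz hs hm
    obtain ⟨w', hg'⟩ : ∃ w', Vel Γ.G.arr (fun t => Γ.G.inv (g t)) w' :=
      ⟨_, Γ.G.inv_smooth.vel hg⟩
    rw [FormOn.ev_neg_form, FormOn.ev_neg_form,
      h.act_vel hp hg' hv (hgp.mono fun t ht => (Γ.G.s_inv _).trans ht.symm) hz hm
        (Γ.G.t_inv _) (Γ.G.s_inv _) hs, Γ.form_inv hg hg' (Γ.G.t_inv _) (Γ.G.s_inv _) rfl,
      map_add, map_neg]
    abel
  · have := h.ker_eq p
    rw [ker_neg]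
    exact this

end Pfaffian

/-! ### The opposite of a Pfaffian bibundle -/

namespace PfaffianBibundle

variable {Γ₁ Γ₂ : PfaffianGroupoid.{u}} (Q : PfaffianBibundle Γ₁ Γ₂)

/-- The isomorphism `Φ` at `p`, between the fibres over `x = μ₁ p` and `y = μ₂ p`. -/
noncomputable def phi (p : Q.P) {x : Γ₁.G.X} {y : Γ₂.G.X} (hx : Q.μ₁ p = x) (hy : Q.μ₂ p = y) :
    Γ₁.R.E.fib x →ₗ[ℝ] Γ₂.R.E.fib y :=
  (Γ₂.R.E.tr hy).comp ((Q.Φ p).toLinearMap.comp (Γ₁.R.E.tr hx.symm))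

theorem phi_rfl (p : Q.P) (α : Γ₁.R.E.fib (Q.μ₁ p)) : Q.phi p rfl rfl α = Q.Φ p α := rfl

theorem phi_congr {p p' : Q.P} (hp : p = p') {x : Γ₁.G.X} {y : Γ₂.G.X} (hx : Q.μ₁ p = x)
    (hy : Q.μ₂ p = y) (α : Γ₁.R.E.fib x) : Q.phi p hx hy α = Q.phi p' (hp ▸ hx) (hp ▸ hy) α := by
  subst hp; rfl

theorem phi_tr {p : Q.P} {x x' : Γ₁.G.X} {y : Γ₂.G.X} (hx : Q.μ₁ p = x) (hy : Q.μ₂ p = y)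
    (h : x' = x) (α : Γ₁.R.E.fib x') :
    Q.phi p hx hy (Γ₁.R.E.tr h α) = Q.phi p (hx.trans h.symm) hy α := by
  subst h; rfl

theorem tr_phi {p : Q.P} {x : Γ₁.G.X} {y y' : Γ₂.G.X} (hx : Q.μ₁ p = x) (hy : Q.μ₂ p = y)
    (h : y = y') (α : Γ₁.R.E.fib x) :
    Γ₂.R.E.tr h (Q.phi p hx hy α) = Q.phi p hx (hy.trans h) α := by
  subst h; rfl

theorem phi_injective {p : Q.P} {x : Γ₁.G.X} {y : Γ₂.G.X} (hx : Q.μ₁ p = x) (hy : Q.μ₂ p = y) :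
    Function.Injective (Q.phi p hx hy) := by
  subst hx hy
  exact (Q.Φ p).injective

theorem phi_lact {g : Γ₁.G.arr} {p : Q.P} {x x' : Γ₁.G.X} {y : Γ₂.G.X} (hx : Γ₁.G.s g = x)
    (hx' : Γ₁.G.t g = x') (hp : Q.μ₁ p = x) (hy : Q.μ₂ p = y) (hx'' : Q.μ₁ (Q.lact g p) = x')
    (hy' : Q.μ₂ (Q.lact g p) = y) (α : Γ₁.R.E.fib x) :
    Q.phi (Q.lact g p) hx'' hy' (Γ₁.R.act g hx hx' α) = Q.phi p hp hy α := by
  subst hp hx'' hy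
  have h := Q.Φ_left g p hx α
  rw [eq_comm, VBundle.tr_eq_iff] at h
  exact h.symm

theorem phi_ract {p : Q.P} {g : Γ₂.G.arr} {x : Γ₁.G.X} {y y' : Γ₂.G.X} (hg : Q.μ₂ p = Γ₂.G.t g)
    (hx : Q.μ₁ p = x) (hx' : Q.μ₁ (Q.ract p g) = x) (hy : Q.μ₂ p = y)
    (hs : Γ₂.G.s (Γ₂.G.inv g) = y) (ht : Γ₂.G.t (Γ₂.G.inv g) = y')
    (hy' : Q.μ₂ (Q.ract p g) = y') (α : Γ₁.R.E.fib x) :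
    Q.phi (Q.ract p g) hx' hy' α = Γ₂.R.act (Γ₂.G.inv g) hs ht (Q.phi p hx hy α) := by
  subst hx hy hy'
  exact Q.Φ_right p g hg α

/-- The right action of `Σ₂` on `P`, as a left action. -/
def ractInv (g : Γ₂.G.arr) (p : Q.P) : Q.P := Q.ract p (Γ₂.G.inv g)

theorem ractInv_principal : IsLeftPrincipal Γ₂.G Q.μ₂ Q.μ₁ Q.ractInv := Q.right_principal.toLeft

/-- The bibundle `(P, -Φ ∘ θ, Φ⁻¹)` from `Σ₂` to `Σ₁`, with the actions exchanged. -/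
noncomputable def op : PfaffianBibundle Γ₂ Γ₁ where
  P := Q.P
  μ₁ := Q.μ₂
  μ₂ := Q.μ₁
  lact g p := Q.ract p (Γ₂.G.inv g)
  ract p g := Q.lact (Γ₁.G.inv g) p
  left_principal := Q.right_principal.toLeft
  right_principal := Q.left_principal.toRight
  commute g p h hg hp := (Q.commute _ _ _ ((Γ₁.G.s_inv h).trans hp.symm)
    (hg.symm.trans (Γ₂.G.t_inv g).symm)).symm
  θ p := - (Q.Φ p).toLinearMap.comp (Q.θ p)
  θ_smooth := (Q.θ_smooth.lin_comp Q.Φ_smooth).neg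
  left_pfaffian := Q.right_pfaffian.toLeft Q.right_principal
  Φ p := (Q.Φ p).symm
  Φ_smooth := Q.Φ_symm_smooth
  Φ_symm_smooth := Q.Φ_smooth
  right_pfaffian := by
    have h : (fun p => (Q.Φ p).symm.toLinearMap.comp (- (Q.Φ p).toLinearMap.comp (Q.θ p)) :
        FormOn Q.P Q.μ₁ Γ₁.R.E) = fun p => - Q.θ p := by
      funext p
      ext v
      change (Q.Φ p).symm (- Q.Φ p (Q.θ p v)) = - Q.θ p v
      rw [map_neg, LinearEquiv.symm_apply_apply]
    rw [h]
    exact Q.left_pfaffian.toRight Q.left_principal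
  Φ_left g p hg α := by
    rw [LinearEquiv.symm_apply_eq, ← Q.phi_rfl, Q.phi_tr,
      Q.phi_ract (hg.symm.trans (Γ₂.G.t_inv g).symm) rfl _ rfl
        ((Γ₂.G.s_inv _).trans ((Γ₂.G.t_inv g).trans hg))
        ((congrArg Γ₂.G.t (Γ₂.G.inv_inv g)).trans
          (Q.right_principal.toLeft.moment_act g p hg).symm),
      Q.phi_rfl, LinearEquiv.apply_symm_apply, Γ₂.R.act_congr (Γ₂.G.inv_inv g)]
  Φ_right p g hg α := by
    rw [LinearEquiv.symm_apply_eq, ← Q.phi_rfl,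
      Q.phi_lact _ _ rfl (Q.left_principal.proj_act _ _ ((Γ₁.G.s_inv g).trans hg.symm)).symm]
    rw [← Q.tr_phi rfl rfl (Q.left_principal.proj_act _ _ ((Γ₁.G.s_inv g).trans hg.symm)).symm,
      Q.phi_rfl, LinearEquiv.apply_symm_apply]

/-- Taking the opposite twice gives back the same data, but only propositionally: the actions agree
by `inv_inv`, and the form by cancelling two signs and `Φ⁻¹ ∘ Φ`. -/
theorem IsQuotientMap.of_op_op {M : Mfd.{u}} {B₁ : PrincipalPfaffianBundle Γ₁ M}
    {B₂ : PrincipalPfaffianBundle Γ₂ M} {q : B₁.P × Q.P → B₂.P}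
    (h : Q.op.op.IsQuotientMap B₁ B₂ q) : Q.IsQuotientMap B₁ B₂ q where
  smooth := h.smooth
  surj := h.surj
  submersive := h.submersive
  orbits x hx y hy := by
    refine (h.orbits x hx y hy).trans (exists_congr fun g => ?_)
    change _ ∧ y = (_, Q.lact (Γ₁.G.inv (Γ₁.G.inv g)) x.2) ↔ _
    rw [Γ₁.G.inv_inv]
  proj_eq := h.proj_eq
  moment_eq := h.moment_eq
  equivariant x hx g hg := by
    have := h.equivariant x hx g hg
    change q (_, Q.ract x.2 (Γ₂.G.inv (Γ₂.G.inv g))) = _ at this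
    rwa [Γ₂.G.inv_inv] at this
  form_eq p₁ p hp hm v₁ v hT := by
    have := h.form_eq p₁ p hp hm v₁ v hT
    refine this.trans ?_
    change Q.Φ p (- (Q.Φ p).symm (- Q.Φ p (Q.θ p v)) - _) = _
    rw [map_neg, LinearEquiv.symm_apply_apply, neg_neg]
    rfl

end PfaffianBibundle

/-! ### The diagonal quotient as a principal bundle of the second groupoid -/

theorem surjective_diff_of_curves {A B : Mfd.{u}} {f : A → B} (hf : Smooth f) {a : A}
    (H : ∀ x : ℝ → B, ∀ ξ, x 0 = f a → Vel B x ξ →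
      ∃ c v, c 0 = a ∧ Vel A c v ∧ ∀ᶠ t in 𝓝 0, f (c t) = x t) :
    Function.Surjective (diff f a) := by
  intro ξ
  obtain ⟨x, hx0, hx⟩ := exists_vel (f a) ξ
  obtain ⟨c, v, rfl, hc, hcx⟩ := H x ξ hx0 hx
  exact ⟨v, (hf.vel hc).unique (hx.congr hcx)⟩

/-- An action with unique and locally continuous division is proper. -/
theorem isProperMap_of_division {G : LieGroupoid.{u}} {P M : Mfd.{u}} [T2Space M] {μ : P → G.X}
    {proj : P → M} {act : G.arr → P → P} (hproj : Continuous proj)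
    (hact : ContinuousOn (fun x : G.arr × P => act x.1 x.2) (fibProd G.s μ))
    (hpa : ∀ g p, G.s g = μ p → proj (act g p) = proj p)
    (hinj : ∀ g g' p, G.s g = μ p → G.s g' = μ p → act g p = act g' p → g = g')
    (hdiv : ∀ z ∈ fibProd proj proj, ∃ (d : P × P → G.arr) (U : Set (P × P)), IsOpen U ∧ z ∈ U ∧
      ContinuousOn d (U ∩ fibProd proj proj) ∧
      ∀ w ∈ U ∩ fibProd proj proj, G.s (d w) = μ w.2 ∧ act (d w) w.2 = w.1) :
    IsProperMap (fun x : fibProd G.s μ => (act x.1.1 x.1.2, x.1.2)) := by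
  have htrans : ∀ z : P × P, ∃ g, z ∈ fibProd proj proj → G.s g = μ z.2 ∧ act g z.2 = z.1 := by
    intro z
    by_cases hz : z ∈ fibProd proj proj
    · obtain ⟨d, U, -, hzU, -, h⟩ := hdiv z hz
      exact ⟨d z, fun _ => h z ⟨hzU, hz⟩⟩
    · exact ⟨G.one (μ z.2), fun h => absurd h hz⟩
  choose δ hδ' using htrans
  have hδs := fun z hz => (hδ' z hz).1
  have hδ := fun z hz => (hδ' z hz).2
  have hδc : ContinuousOn δ (fibProd proj proj) := by
    intro z hz
    obtain ⟨d, U, hU, hzU, hd, h⟩ := hdiv z hz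
    have h1 : ContinuousWithinAt d (fibProd proj proj) z :=
      (hd z ⟨hzU, hz⟩).mono_of_mem_nhdsWithin
        (inter_mem (mem_nhdsWithin_of_mem_nhds (hU.mem_nhds hzU)) self_mem_nhdsWithin)
    have h2 : ∀ w ∈ U ∩ fibProd proj proj, δ w = d w := fun w hw =>
      hinj _ _ w.2 (hδs w hw.2) (h w hw).1 ((hδ w hw.2).trans (h w hw).2.symm)
    refine h1.congr_of_eventuallyEq ?_ (h2 z ⟨hzU, hz⟩)
    filter_upwards [mem_nhdsWithin_of_mem_nhds (hU.mem_nhds hzU), self_mem_nhdsWithin]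
      with w hw hw' using h2 w ⟨hw, hw'⟩
  let e : fibProd G.s μ ≃ₜ fibProd proj proj :=
    { toFun := fun x => ⟨(act x.1.1 x.1.2, x.1.2), hpa x.1.1 x.1.2 x.2⟩
      invFun := fun z => ⟨(δ z.1, z.1.2), hδs z.1 z.2⟩
      left_inv := fun x => Subtype.ext <| Prod.ext
        (hinj _ _ x.1.2 (hδs _ (hpa x.1.1 x.1.2 x.2)) x.2 (hδ _ (hpa x.1.1 x.1.2 x.2))) rfl
      right_inv := fun z => Subtype.ext <| Prod.ext (hδ z.1 z.2) rfl
      continuous_toFun := by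
        refine Continuous.subtype_mk (Continuous.prodMk ?_ (by fun_prop)) _
        exact continuousOn_iff_continuous_domRestrict.1 hact
      continuous_invFun := by
        refine Continuous.subtype_mk (Continuous.prodMk ?_ (by fun_prop)) _
        exact continuousOn_iff_continuous_domRestrict.1 hδc }
  -- The action map is a homeomorphism onto the fibred square of `proj`, and since `M` is Hausdorff
  -- this square is closed in `P × P`.
  have hcl : IsClosed (fibProd proj proj) :=
    isClosed_eq (hproj.comp continuous_fst) (hproj.comp continuous_snd)
  exact (hcl.isClosedEmbedding_subtypeVal.comp e.isClosedEmbedding).isProperMap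

/-- A quotient of `P₁ ×_{X₁} P` by the diagonal action, with local lifts. -/
structure DiagonalQuotient {Γ₁ Γ₂ : PfaffianGroupoid.{u}} (Q : PfaffianBibundle Γ₁ Γ₂) {M : Mfd.{u}}
    (B₁ : PrincipalPfaffianBundle Γ₁ M) where
  Y : Mfd.{u}
  q : B₁.P × Q.P → Y
  smooth : SmoothOn q (Q.fib B₁)
  surj : ∀ y, ∃ x ∈ Q.fib B₁, q x = y
  orbits : ∀ x ∈ Q.fib B₁, ∀ y ∈ Q.fib B₁, q x = q y ↔
    ∃ g, Γ₁.G.s g = B₁.μ x.1 ∧ y = (B₁.act g x.1, Q.lact g x.2)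
  lift : ∀ x ∈ Q.fib B₁, ∃ (l : Y → B₁.P × Q.P) (U : Set Y), IsOpen U ∧ q x ∈ U ∧
    ContMDiffOn (𝓡 Y.dim) ((𝓡 B₁.P.dim).prod (𝓡 Q.P.dim)) ∞ l U ∧ l (q x) = x ∧
    ∀ y ∈ U, l y ∈ Q.fib B₁ ∧ q (l y) = y

namespace DiagonalQuotient

variable {Γ₁ Γ₂ : PfaffianGroupoid.{u}} {Q : PfaffianBibundle Γ₁ Γ₂} {M : Mfd.{u}}
  {B₁ : PrincipalPfaffianBundle Γ₁ M}

theorem nonempty (Q : PfaffianBibundle Γ₁ Γ₂) (B₁ : PrincipalPfaffianBundle Γ₁ M) :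
    Nonempty (DiagonalQuotient Q B₁) := by
  obtain ⟨Y, q, h1, h2, h3, h4⟩ := exists_diagonal_quotient B₁.principal Q.left_principal
  exact ⟨⟨Y, q, h1, h2, h3, h4⟩⟩

variable (D : DiagonalQuotient Q B₁)

/-- A representative of a point of the quotient. -/
noncomputable def rep (y : D.Y) : B₁.P × Q.P := (D.surj y).choose

theorem rep_mem (y : D.Y) : D.rep y ∈ Q.fib B₁ := (D.surj y).choose_spec.1

theorem q_rep (y : D.Y) : D.q (D.rep y) = y := (D.surj y).choose_spec.2

/-- The projection of the quotient to the base. -/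
noncomputable def proj (y : D.Y) : M := B₁.proj (D.rep y).1

/-- The moment map of the quotient. -/
noncomputable def moment (y : D.Y) : Γ₂.G.X := Q.μ₂ (D.rep y).2

/-- The left action of the second groupoid on the quotient. -/
noncomputable def act (g : Γ₂.G.arr) (y : D.Y) : D.Y :=
  D.q ((D.rep y).1, Q.ractInv g (D.rep y).2)

theorem mem_lact {x : B₁.P × Q.P} (hx : x ∈ Q.fib B₁) {g : Γ₁.G.arr} (hg : Γ₁.G.s g = B₁.μ x.1) :
    (B₁.act g x.1, Q.lact g x.2) ∈ Q.fib B₁ :=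
  (B₁.principal.moment_act _ _ hg).trans
    (Q.left_principal.moment_act _ _ (hg.trans hx)).symm

theorem mem_ractInv {x : B₁.P × Q.P} (hx : x ∈ Q.fib B₁) {g : Γ₂.G.arr}
    (hg : Γ₂.G.s g = Q.μ₂ x.2) : (x.1, Q.ractInv g x.2) ∈ Q.fib B₁ :=
  Eq.trans hx (Q.ractInv_principal.proj_act _ _ hg).symm

theorem q_lact {x : B₁.P × Q.P} (hx : x ∈ Q.fib B₁) {g : Γ₁.G.arr} (hg : Γ₁.G.s g = B₁.μ x.1) :
    D.q (B₁.act g x.1, Q.lact g x.2) = D.q x :=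
  ((D.orbits x hx _ (mem_lact hx hg)).2 ⟨g, hg, rfl⟩).symm

theorem proj_q {x : B₁.P × Q.P} (hx : x ∈ Q.fib B₁) : D.proj (D.q x) = B₁.proj x.1 := by
  obtain ⟨g, hg, h⟩ := (D.orbits x hx _ (D.rep_mem (D.q x))).1 (D.q_rep _).symm
  rw [proj, h]
  exact B₁.principal.proj_act _ _ hg

theorem moment_q {x : B₁.P × Q.P} (hx : x ∈ Q.fib B₁) : D.moment (D.q x) = Q.μ₂ x.2 := by
  obtain ⟨g, hg, h⟩ := (D.orbits x hx _ (D.rep_mem (D.q x))).1 (D.q_rep _).symm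
  rw [moment, h]
  exact Q.left_principal.proj_act _ _ (hg.trans hx)

theorem act_q {x : B₁.P × Q.P} (hx : x ∈ Q.fib B₁) {g : Γ₂.G.arr} (hg : Γ₂.G.s g = Q.μ₂ x.2) :
    D.act g (D.q x) = D.q (x.1, Q.ractInv g x.2) := by
  obtain ⟨k, hk, h⟩ := (D.orbits x hx _ (D.rep_mem (D.q x))).1 (D.q_rep _).symm
  have hkx : Γ₁.G.s k = Q.μ₁ x.2 := hk.trans hx
  have hcomm : Q.ractInv g (Q.lact k x.2) = Q.lact k (Q.ractInv g x.2) :=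
    Q.commute _ _ _ hkx (hg.symm.trans (Γ₂.G.t_inv g).symm)
  rw [act, h]
  simp only
  rw [hcomm]
  exact D.q_lact (x := (x.1, Q.ractInv g x.2)) (mem_ractInv hx hg) hk

/-- Near each point `f` is `F` composed with a smooth local lift of the quotient map. -/
theorem contMDiff_of_descends {C : Mfd.{u}} {f : D.Y → C} {F : B₁.P × Q.P → C}
    (hF : SmoothOn F (Q.fib B₁)) (h : ∀ x ∈ Q.fib B₁, f (D.q x) = F x) : Smooth f := by
  intro y
  obtain ⟨l, U, hU, hyU, hl, -, hlU⟩ := D.lift _ (D.rep_mem y)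
  rw [D.q_rep] at hyU
  have h1 := hF.comp hl fun y hy => (hlU y hy).1
  refine (h1.contMDiffAt (hU.mem_nhds hyU)).congr_of_eventuallyEq ?_
  filter_upwards [hU.mem_nhds hyU] with y hy
  rw [Function.comp_apply, ← h _ (hlU y hy).1, (hlU y hy).2]

theorem proj_smooth : Smooth D.proj :=
  D.contMDiff_of_descends
    ((B₁.principal.proj_submersion.smooth.comp contMDiff_fst).contMDiffOn) fun _ hx => D.proj_q hx

theorem moment_smooth : Smooth D.moment :=
  D.contMDiff_of_descends
    ((Q.left_principal.proj_submersion.smooth.comp contMDiff_snd).contMDiffOn)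
    fun _ hx => D.moment_q hx

theorem exists_q_vel {a : ℝ → B₁.P} {b : ℝ → Q.P} {v w} (ha : Vel B₁.P a v) (hb : Vel Q.P b w)
    (hab : ∀ᶠ t in 𝓝 0, B₁.μ (a t) = Q.μ₁ (b t)) : ∃ z, Vel D.Y (fun t => D.q (a t, b t)) z :=
  ⟨_, D.smooth.vel ha hb hab⟩

theorem proj_submersion : IsSurjSubmersion D.proj := by
  refine ⟨D.proj_smooth, fun m => ?_, fun y => surjective_diff_of_curves D.proj_smooth ?_⟩
  · obtain ⟨a, rfl⟩ := B₁.principal.proj_submersion.surj m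
    obtain ⟨b, hb⟩ := Q.left_principal.moment_submersion.surj (B₁.μ a)
    exact ⟨D.q (a, b), D.proj_q hb.symm⟩
  · intro m ξ hm0 hm
    obtain ⟨⟨a₀, b₀⟩, hx, rfl⟩ := D.surj y
    rw [D.proj_q hx] at hm0
    obtain ⟨a, v, ha0, ha, ham⟩ := B₁.principal.proj_submersion.exists_lift' hm hm0.symm
    obtain ⟨b, w, hb0, hb, hba⟩ := Q.left_principal.moment_submersion.exists_lift'
      (B₁.principal.moment_submersion.smooth.vel ha) (a := b₀) (by rw [ha0]; exact hx.symm)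
    obtain ⟨z, hz⟩ := D.exists_q_vel ha hb (hba.mono fun t ht => ht.symm)
    refine ⟨_, z, by rw [ha0, hb0], hz, ?_⟩
    filter_upwards [ham, hba] with t h1 h2
    rw [D.proj_q h2.symm, h1]

theorem moment_submersion : IsSurjSubmersion D.moment := by
  refine ⟨D.moment_smooth, fun x => ?_, fun y => surjective_diff_of_curves D.moment_smooth ?_⟩
  · obtain ⟨b, rfl⟩ := Q.left_principal.proj_submersion.surj x
    obtain ⟨a, ha⟩ := B₁.principal.moment_submersion.surj (Q.μ₁ b)
    exact ⟨D.q (a, b), D.moment_q ha⟩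
  · intro x ξ hx0 hx
    obtain ⟨⟨a₀, b₀⟩, hy, rfl⟩ := D.surj y
    rw [D.moment_q hy] at hx0
    obtain ⟨b, w, hb0, hb, hbx⟩ := Q.left_principal.proj_submersion.exists_lift' hx hx0.symm
    obtain ⟨a, v, ha0, ha, hab⟩ := B₁.principal.moment_submersion.exists_lift'
      (Q.left_principal.moment_submersion.smooth.vel hb) (a := a₀) (by rw [hb0]; exact hy)
    obtain ⟨z, hz⟩ := D.exists_q_vel ha hb hab
    refine ⟨_, z, by rw [ha0, hb0], hz, ?_⟩
    filter_upwards [hab, hbx] with t h1 h2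
    rw [D.moment_q h1, h2]

theorem act_smooth : SmoothOn (fun x : Γ₂.G.arr × D.Y => D.act x.1 x.2)
    (fibProd Γ₂.G.s D.moment) := by
  rintro ⟨g₀, y₀⟩ hgy
  obtain ⟨l, U, hU, hyU, hl, -, hlU⟩ := D.lift _ (D.rep_mem y₀)
  rw [D.q_rep] at hyU
  set S := fibProd Γ₂.G.s D.moment ∩ (Prod.snd ⁻¹' U) with hS
  have hlS : ContMDiffOn ((𝓡 Γ₂.G.arr.dim).prod (𝓡 D.Y.dim)) ((𝓡 B₁.P.dim).prod (𝓡 Q.P.dim)) ∞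
      (fun z : Γ₂.G.arr × D.Y => l z.2) S :=
    hl.comp contMDiffOn_snd fun z hz => hz.2
  have hmem : ∀ z ∈ S, Γ₂.G.s z.1 = Q.μ₂ (l z.2).2 := by
    rintro ⟨g, y⟩ ⟨h1, h2⟩
    have h3 := D.moment_q (hlU y h2).1
    rw [(hlU y h2).2] at h3
    exact Eq.trans h1 h3
  have h1 : ContMDiffOn ((𝓡 Γ₂.G.arr.dim).prod (𝓡 D.Y.dim)) (𝓡 Q.P.dim) ∞
      (fun z : Γ₂.G.arr × D.Y => Q.ractInv z.1 (l z.2).2) S :=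
    ContMDiffOn.comp (g := fun z : Γ₂.G.arr × Q.P => Q.ractInv z.1 z.2)
      Q.ractInv_principal.act_smooth
      (contMDiffOn_fst.prodMk (contMDiff_snd.comp_contMDiffOn hlS)) hmem
  have h2 : ContMDiffOn ((𝓡 Γ₂.G.arr.dim).prod (𝓡 D.Y.dim)) (𝓡 D.Y.dim) ∞
      (fun z : Γ₂.G.arr × D.Y => D.q ((l z.2).1, Q.ractInv z.1 (l z.2).2)) S :=
    ContMDiffOn.comp (g := D.q) D.smooth ((contMDiff_fst.comp_contMDiffOn hlS).prodMk h1)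
      fun z hz => mem_ractInv (hlU z.2 hz.2).1 (hmem z hz)
  have h3 : ∀ z ∈ S, D.act z.1 z.2 = D.q ((l z.2).1, Q.ractInv z.1 (l z.2).2) := fun z hz => by
    rw [← D.act_q (hlU z.2 hz.2).1 (hmem z hz), (hlU z.2 hz.2).2]
  have hSn : S ∈ 𝓝[fibProd Γ₂.G.s D.moment] (g₀, y₀) :=
    inter_mem self_mem_nhdsWithin
      (mem_nhdsWithin_of_mem_nhds ((hU.preimage continuous_snd).mem_nhds hyU))
  exact ((h2.congr h3) (g₀, y₀) ⟨hgy, hyU⟩).mono_of_mem_nhdsWithin hSn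

/-- If `(a, b · g⁻¹)` and `(a, b · g'⁻¹)` lie in one diagonal orbit, the arrow of `Σ₁` that relates
them fixes `a` and is therefore a unit. Freeness of the action of `Σ₂` on `P` then applies. -/
theorem act_injective {g g' : Γ₂.G.arr} {y : D.Y} (hg : Γ₂.G.s g = D.moment y)
    (hg' : Γ₂.G.s g' = D.moment y) (h : D.act g y = D.act g' y) : g = g' := by
  obtain ⟨x, hx, rfl⟩ := D.surj y
  rw [D.moment_q hx] at hg hg'
  rw [D.act_q hx hg, D.act_q hx hg', D.orbits _ (mem_ractInv hx hg) _ (mem_ractInv hx hg')] at h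
  obtain ⟨k, hk, h⟩ := h
  rw [Prod.mk.injEq] at h
  have hk1 := B₁.principal.free k x.1 hk h.1.symm
  have h2 := h.2
  rw [hk1] at h2
  have h3 : Q.lact (Γ₁.G.one (B₁.μ x.1)) (Q.ractInv g x.2) = Q.ractInv g x.2 :=
    Q.left_principal.act_one_of_eq (mem_ractInv hx hg)
  rw [h3] at h2
  exact (Q.ractInv_principal.act_injective hg' hg h2).symm

/-- The arrow that takes the class of `x` to the class of `x'`. -/
noncomputable def diagDiv (Q : PfaffianBibundle Γ₁ Γ₂) (B₁ : PrincipalPfaffianBundle Γ₁ M)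
    (x x' : B₁.P × Q.P) : Γ₂.G.arr :=
  Q.ractInv_principal.div (Q.lact (B₁.principal.div x.1 x'.1) x.2) x'.2

theorem mu_lact_div {x x' : B₁.P × Q.P} (hx : x ∈ Q.fib B₁) (hx' : x' ∈ Q.fib B₁)
    (h : B₁.proj x.1 = B₁.proj x'.1) :
    Q.μ₁ (Q.lact (B₁.principal.div x.1 x'.1) x.2) = Q.μ₁ x'.2 := by
  rw [Q.left_principal.moment_act _ _ ((B₁.principal.s_div h).trans hx), B₁.principal.t_div h]
  exact hx'

/-- An arrow of `Σ₁` moves the first entry of `x` to that of `x'`. The two second entries then lie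
over the same point of `X₁`, that is, in one orbit of `Σ₂`. -/
theorem diagDiv_spec {x x' : B₁.P × Q.P} (hx : x ∈ Q.fib B₁) (hx' : x' ∈ Q.fib B₁)
    (h : B₁.proj x.1 = B₁.proj x'.1) :
    Γ₂.G.s (diagDiv Q B₁ x x') = Q.μ₂ x.2 ∧ D.act (diagDiv Q B₁ x x') (D.q x) = D.q x' := by
  set k := B₁.principal.div x.1 x'.1 with hk
  have hks : Γ₁.G.s k = B₁.μ x.1 := B₁.principal.s_div h
  have hm : Q.μ₁ (Q.lact k x.2) = Q.μ₁ x'.2 := mu_lact_div hx hx' h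
  have hs : Γ₂.G.s (diagDiv Q B₁ x x') = Q.μ₂ (Q.lact k x.2) := Q.ractInv_principal.s_div hm
  have hμ : Q.μ₂ (Q.lact k x.2) = Q.μ₂ x.2 := Q.left_principal.proj_act _ _ (hks.trans hx)
  refine ⟨hs.trans hμ, ?_⟩
  rw [← D.q_lact hx hks, D.act_q (mem_lact hx hks) hs]
  congr 1
  exact Prod.ext (B₁.principal.act_div h) (Q.ractInv_principal.act_div hm)

theorem continuousOn_diagDiv : ContinuousOn
    (fun z : (B₁.P × Q.P) × (B₁.P × Q.P) => diagDiv Q B₁ z.1 z.2)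
    {z | z.1 ∈ Q.fib B₁ ∧ z.2 ∈ Q.fib B₁ ∧ B₁.proj z.1.1 = B₁.proj z.2.1} := by
  refine Q.ractInv_principal.continuousOn_div.comp (f := fun z : (B₁.P × Q.P) × (B₁.P × Q.P) =>
    ((Q.lact (B₁.principal.div z.1.1 z.2.1) z.1.2, z.2.2) : Q.P × Q.P)) ?_
    fun z hz => mu_lact_div hz.1 hz.2.1 hz.2.2
  refine ContinuousOn.prodMk ?_ (by fun_prop)
  refine Q.left_principal.act_smooth.continuousOn.comp (f := fun z : (B₁.P × Q.P) × (B₁.P × Q.P) =>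
    (B₁.principal.div z.1.1 z.2.1, z.1.2)) ?_
    fun z hz => (B₁.principal.s_div hz.2.2).trans hz.1
  refine ContinuousOn.prodMk ?_ (by fun_prop)
  exact B₁.principal.continuousOn_div.comp (f := fun z : (B₁.P × Q.P) × (B₁.P × Q.P) =>
    (z.1.1, z.2.1)) (by fun_prop) fun z hz => hz.2.2

theorem principal [T2Space M] : IsLeftPrincipal Γ₂.G D.moment D.proj D.act := by
  have hone : ∀ y, D.act (Γ₂.G.one (D.moment y)) y = y := by
    intro y
    obtain ⟨x, hx, rfl⟩ := D.surj y
    rw [D.moment_q hx, D.act_q hx (Γ₂.G.s_one _)]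
    congr 1
    exact Prod.ext rfl (Q.ractInv_principal.act_one x.2)
  have hpa : ∀ g y, Γ₂.G.s g = D.moment y → D.proj (D.act g y) = D.proj y := by
    intro g y hg
    obtain ⟨x, hx, rfl⟩ := D.surj y
    rw [D.moment_q hx] at hg
    rw [D.act_q hx hg, D.proj_q hx, D.proj_q (mem_ractInv hx hg)]
  refine ⟨D.moment_submersion, D.proj_submersion, D.act_smooth, ?_, hone, ?_, hpa, ?_, ?_, ?_⟩
  · intro g y hg
    obtain ⟨x, hx, rfl⟩ := D.surj y
    rw [D.moment_q hx] at hg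
    rw [D.act_q hx hg, D.moment_q (mem_ractInv hx hg)]
    exact Q.ractInv_principal.moment_act _ _ hg
  · intro g h y hgh hh
    obtain ⟨x, hx, rfl⟩ := D.surj y
    rw [D.moment_q hx] at hh
    rw [D.act_q hx hh, D.act_q (mem_ractInv hx hh)
      (hgh.trans (Q.ractInv_principal.moment_act _ _ hh).symm),
      D.act_q hx ((Γ₂.G.s_mul _ _ hgh).trans hh)]
    congr 1
    exact Prod.ext rfl (Q.ractInv_principal.act_act _ _ _ hgh hh)
  · intro y y' h
    obtain ⟨x, hx, rfl⟩ := D.surj y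
    obtain ⟨x', hx', rfl⟩ := D.surj y'
    rw [D.proj_q hx, D.proj_q hx'] at h
    rw [D.moment_q hx]
    exact ⟨_, (D.diagDiv_spec hx hx' h).1, (D.diagDiv_spec hx hx' h).2.symm⟩
  · intro g y hg h
    exact D.act_injective hg (Γ₂.G.s_one _) (h.trans (hone y).symm)
  -- Division on the quotient is locally `diagDiv` applied to lifts of the two points, hence
  -- continuous.
  · refine isProperMap_of_division D.proj_smooth.continuous D.act_smooth.continuousOn hpa
      (fun _ _ _ => D.act_injective) ?_
    rintro ⟨y, y'⟩ -
    obtain ⟨l, U, hU, hyU, hl, -, hlU⟩ := D.lift _ (D.rep_mem y)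
    obtain ⟨l', U', hU', hyU', hl', -, hlU'⟩ := D.lift _ (D.rep_mem y')
    rw [D.q_rep] at hyU hyU'
    have hpr : ∀ z ∈ (U ×ˢ U') ∩ fibProd D.proj D.proj,
        B₁.proj (l' z.2).1 = B₁.proj (l z.1).1 := by
      rintro ⟨z, z'⟩ ⟨⟨hz, hz'⟩, h⟩
      rw [← D.proj_q (hlU z hz).1, ← D.proj_q (hlU' z' hz').1, (hlU z hz).2, (hlU' z' hz').2]
      exact Eq.symm h
    refine ⟨fun z => diagDiv Q B₁ (l' z.2) (l z.1), U ×ˢ U', hU.prod hU', ⟨hyU, hyU'⟩, ?_, ?_⟩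
    · refine continuousOn_diagDiv.comp (f := fun z : D.Y × D.Y => (l' z.2, l z.1)) ?_ ?_
      · refine ContinuousOn.prodMk ?_ ?_
        · exact hl'.continuousOn.comp continuousOn_snd fun z hz => hz.1.2
        · exact hl.continuousOn.comp continuousOn_fst fun z hz => hz.1.1
      · exact fun z hz => ⟨(hlU' _ hz.1.2).1, (hlU _ hz.1.1).1, hpr z hz⟩
    · intro z hz
      have h := D.diagDiv_spec (hlU' _ hz.1.2).1 (hlU _ hz.1.1).1 (hpr z hz)
      rw [(hlU' _ hz.1.2).2, (hlU _ hz.1.1).2] at h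
      refine ⟨h.1.trans ?_, h.2⟩
      rw [← D.moment_q (hlU' _ hz.1.2).1, (hlU' _ hz.1.2).2]

end DiagonalQuotient

/-! ### The form on the quotient -/

theorem FormOn.tot_ev_of_eq {P X : Mfd.{u}} {f : P → X} {E : VBundle X} (θ : FormOn P f E)
    {p p' : P} (hp : p = p') {x : X} (h : f p = x) (v : EuclideanSpace ℝ (Fin P.dim)) :
    (⟨f p', θ p' v⟩ : E.Tot) = ⟨x, θ.ev p h v⟩ := by
  subst hp h; rfl

section DiagForm

variable {Γ₁ Γ₂ : PfaffianGroupoid.{u}} (Q : PfaffianBibundle Γ₁ Γ₂) {M : Mfd.{u}}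
  (B₁ : PrincipalPfaffianBundle Γ₁ M)

/-- The form `Φ ∘ (pr₂^*θ - pr₁^*θ₁)` on `P₁ ×_{X₁} P`. -/
noncomputable def diagForm {a : B₁.P} {b : Q.P} (h : B₁.μ a = Q.μ₁ b) {y : Γ₂.G.X}
    (hy : Q.μ₂ b = y) (v : EuclideanSpace ℝ (Fin B₁.P.dim)) (w : EuclideanSpace ℝ (Fin Q.P.dim)) :
    Γ₂.R.E.fib y :=
  Q.phi b rfl hy (Q.θ.ev b rfl w - B₁.θ.ev a h v)

variable {Q B₁}

theorem diagForm_congr {a a' : B₁.P} {b b' : Q.P} (ha : a = a') (hb : b = b')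
    (h : B₁.μ a = Q.μ₁ b) {y : Γ₂.G.X} (hy : Q.μ₂ b = y) (v w) :
    diagForm Q B₁ h hy v w = diagForm Q B₁ (ha ▸ hb ▸ h) (hb ▸ hy) v w := by
  subst ha hb; rfl

theorem diagForm_eq_zero_iff {a : B₁.P} {b : Q.P} (h : B₁.μ a = Q.μ₁ b) {y : Γ₂.G.X}
    (hy : Q.μ₂ b = y) (v w) :
    diagForm Q B₁ h hy v w = 0 ↔ Q.θ.ev b rfl w = B₁.θ.ev a h v := by
  rw [diagForm, map_eq_zero_iff _ (Q.phi_injective rfl hy), sub_eq_zero]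

/-- The form `Φ ∘ (pr₂^*θ - pr₁^*θ₁)` is basic. -/
theorem diagForm_basic {a a' : ℝ → B₁.P} {b b' : ℝ → Q.P} {v v' w w'} (ha : Vel B₁.P a v)
    (ha' : Vel B₁.P a' v') (hb : Vel Q.P b w) (hb' : Vel Q.P b' w')
    (hab : ∀ᶠ t in 𝓝 0, B₁.μ (a t) = Q.μ₁ (b t))
    (H : ∀ᶠ t in 𝓝 0, ∃ g, Γ₁.G.s g = B₁.μ (a t) ∧ a' t = B₁.act g (a t) ∧ b' t = Q.lact g (b t))
    (h : B₁.μ (a 0) = Q.μ₁ (b 0)) (h' : B₁.μ (a' 0) = Q.μ₁ (b' 0)) {y : Γ₂.G.X}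
    (hy : Q.μ₂ (b 0) = y) (hy' : Q.μ₂ (b' 0) = y) :
    diagForm Q B₁ h hy v w = diagForm Q B₁ h' hy' v' w' := by
  set g : ℝ → Γ₁.G.arr := fun t => B₁.principal.div (a t) (a' t) with hg
  have hproj : ∀ᶠ t in 𝓝 0, B₁.proj (a t) = B₁.proj (a' t) := H.mono fun t ⟨k, hk, hka, _⟩ => by
    rw [hka, B₁.principal.proj_act _ _ hk]
  have hgt : ∀ᶠ t in 𝓝 0, Γ₁.G.s (g t) = B₁.μ (a t) ∧ a' t = B₁.act (g t) (a t) ∧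
      b' t = Q.lact (g t) (b t) := H.mono fun t ⟨k, hk, hka, hkb⟩ => by
    have : g t = k := by
      rw [hg]; simp only; rw [hka, B₁.principal.div_act hk]
    rw [this]
    exact ⟨hk, hka, hkb⟩
  -- The arrows relating the two curves have a velocity because the division map is smooth; this is
  -- where its differentiability is needed for the form.
  obtain ⟨γ, hγ⟩ : ∃ γ, Vel Γ₁.G.arr g γ :=
    ⟨_, B₁.principal.div_smooth.vel ha ha' hproj⟩
  obtain ⟨hs, h1, h2⟩ := hgt.self_of_nhds
  have hsb : Γ₁.G.s (g 0) = Q.μ₁ (b 0) := hs.trans h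
  have ht : Γ₁.G.t (g 0) = Q.μ₁ (b' 0) := by
    rw [h2, Q.left_principal.moment_act _ _ hsb]
  have e1 := B₁.isPfaffian.act_vel B₁.principal hγ ha (hgt.mono fun t ht => ht.1)
    (ha'.congr (hgt.mono fun t ht => ht.2.1.symm)) (by rw [← h1, h']) ht hsb h
  have e2 := Q.left_pfaffian.act_vel Q.left_principal hγ hb
    ((hgt.and hab).mono fun t ht => ht.1.1.trans ht.2)
    (hb'.congr (hgt.mono fun t ht => ht.2.2.symm)) (by rw [← h2]) ht hsb rfl
  -- Both forms acquire the same term `ω₁` and the same action of `g`. The first cancels in the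
  -- difference, and the second is absorbed by the invariance of `Φ`.
  rw [diagForm, diagForm, B₁.θ.ev_congr h1, Q.θ.ev_congr h2, e1, e2, Q.phi_congr h2,
    add_sub_add_left_eq_sub, ← map_sub]
  exact (Q.phi_lact hsb ht rfl hy _ _ _).symm

end DiagForm

namespace DiagonalQuotient

variable {Γ₁ Γ₂ : PfaffianGroupoid.{u}} {Q : PfaffianBibundle Γ₁ Γ₂} {M : Mfd.{u}}
  {B₁ : PrincipalPfaffianBundle Γ₁ M} (D : DiagonalQuotient Q B₁)

theorem exists_lift_rep (y : D.Y) : ∃ (l : D.Y → B₁.P × Q.P) (U : Set D.Y), IsOpen U ∧ y ∈ U ∧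
    ContMDiffOn (𝓡 D.Y.dim) ((𝓡 B₁.P.dim).prod (𝓡 Q.P.dim)) ∞ l U ∧
    l y = D.rep y ∧ ∀ z ∈ U, l z ∈ Q.fib B₁ ∧ D.q (l z) = z := by
  have h := D.lift _ (D.rep_mem y)
  rwa [D.q_rep] at h

/-- A local lift of the quotient map through the chosen representative of `y`. -/
noncomputable def liftAt (y : D.Y) : D.Y → B₁.P × Q.P := (D.exists_lift_rep y).choose

theorem liftAt_spec (y : D.Y) : ∃ U : Set D.Y, IsOpen U ∧ y ∈ U ∧
    ContMDiffOn (𝓡 D.Y.dim) ((𝓡 B₁.P.dim).prod (𝓡 Q.P.dim)) ∞ (D.liftAt y) U ∧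
    D.liftAt y y = D.rep y ∧ ∀ z ∈ U, D.liftAt y z ∈ Q.fib B₁ ∧ D.q (D.liftAt y z) = z :=
  (D.exists_lift_rep y).choose_spec

/-- The form on the quotient whose negative pulls back to `Φ ∘ (pr₂^*θ - pr₁^*θ₁)`. -/
noncomputable def form : FormOn D.Y D.moment Γ₂.R.E := fun y =>
  - (Q.Φ (D.rep y).2).toLinearMap.comp
    ((Q.θ (D.rep y).2).comp (diff (fun z => (D.liftAt y z).2) y :
        EuclideanSpace ℝ (Fin D.Y.dim) →L[ℝ] EuclideanSpace ℝ (Fin Q.P.dim)).toLinearMap -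
      (B₁.θ.val (D.rep y).1 (D.rep_mem y)).comp (diff (fun z => (D.liftAt y z).1) y :
        EuclideanSpace ℝ (Fin D.Y.dim) →L[ℝ] EuclideanSpace ℝ (Fin B₁.P.dim)).toLinearMap)

theorem exists_vel_lift {l : D.Y → B₁.P × Q.P} {U : Set D.Y} (hU : IsOpen U)
    (hl : ContMDiffOn (𝓡 D.Y.dim) ((𝓡 B₁.P.dim).prod (𝓡 Q.P.dim)) ∞ l U)
    {y : ℝ → D.Y} {z} (hy : Vel D.Y y z) (h0 : y 0 ∈ U) :
    Vel B₁.P (fun t => (l (y t)).1) (diff (fun z => (l z).1) (y 0) z) ∧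
      Vel Q.P (fun t => (l (y t)).2) (diff (fun z => (l z).2) (y 0) z) := by
  have h := (hl.contMDiffAt (hU.mem_nhds h0)).mdifferentiableAt (by simp)
  have h1 : MDifferentiableAt (𝓡 D.Y.dim) (𝓡 B₁.P.dim) (fun z => (l z).1) (y 0) :=
    mdifferentiableAt_fst.comp (y 0) h
  have h2 : MDifferentiableAt (𝓡 D.Y.dim) (𝓡 Q.P.dim) (fun z => (l z).2) (y 0) :=
    mdifferentiableAt_snd.comp (y 0) h
  exact ⟨hy.comp h1, hy.comp h2⟩

theorem orbit_of_q_eq {x x' : B₁.P × Q.P} (hx : x ∈ Q.fib B₁) (hx' : x' ∈ Q.fib B₁)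
    (h : D.q x = D.q x') :
    ∃ g, Γ₁.G.s g = B₁.μ x.1 ∧ x'.1 = B₁.act g x.1 ∧ x'.2 = Q.lact g x.2 := by
  obtain ⟨g, hg, he⟩ := (D.orbits x hx x' hx').1 h
  exact ⟨g, hg, by rw [he], by rw [he]⟩

/-- The form is defined by one chosen lift at each point. Any other lift of the same curve differs
by the diagonal action, under which the difference form is basic. -/
theorem form_q_vel {a : ℝ → B₁.P} {b : ℝ → Q.P} {v w z} (ha : Vel B₁.P a v) (hb : Vel Q.P b w)
    (hab : ∀ᶠ t in 𝓝 0, B₁.μ (a t) = Q.μ₁ (b t)) (hz : Vel D.Y (fun t => D.q (a t, b t)) z)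
    (h : B₁.μ (a 0) = Q.μ₁ (b 0)) {y : Γ₂.G.X} (hy : D.moment (D.q (a 0, b 0)) = y)
    (hy' : Q.μ₂ (b 0) = y) :
    D.form.ev (D.q (a 0, b 0)) hy z = - diagForm Q B₁ h hy' v w := by
  subst hy
  obtain ⟨U, hU, hyU, hl, hl0, hlU⟩ := D.liftAt_spec (D.q (a 0, b 0))
  obtain ⟨h1, h2⟩ := D.exists_vel_lift hU hl hz hyU
  have hUt := hz.eventually_mem hU hyU
  have hfib : B₁.μ (D.liftAt (D.q (a 0, b 0)) (D.q (a 0, b 0))).1 =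
    Q.μ₁ (D.liftAt (D.q (a 0, b 0)) (D.q (a 0, b 0))).2 := (hlU _ hyU).1
  have e := (diagForm_basic ha h1 hb h2 hab ((hUt.and hab).mono fun t ht =>
    D.orbit_of_q_eq (x := (a t, b t)) ht.2 (hlU _ ht.1).1 (hlU _ ht.1).2.symm) h hfib hy'
    (by rw [hl0]; rfl)).trans
      (diagForm_congr (congrArg Prod.fst hl0) (congrArg Prod.snd hl0) hfib _ _ _)
  refine Eq.trans ?_ (congrArg Neg.neg e.symm)
  rfl

/-- The lifts in the definition of the form are chosen independently at each point. By `form_q_vel`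
a single smooth lift `l` near `y₀` computes the form at all nearby points, and in terms of `l` it is
visibly smooth. -/
theorem form_smooth : D.form.IsSmooth := by
  rintro ⟨y₀, v₀⟩
  obtain ⟨U, hU, hyU, hl, -, hlU⟩ := D.liftAt_spec y₀
  set l := D.liftAt y₀
  have hl1 : ContMDiffOn (𝓡 D.Y.dim) (𝓡 B₁.P.dim) ∞ (fun z => (l z).1) U :=
    contMDiff_fst.comp_contMDiffOn hl
  have hl2 : ContMDiffOn (𝓡 D.Y.dim) (𝓡 Q.P.dim) ∞ (fun z => (l z).2) U :=
    contMDiff_snd.comp_contMDiffOn hl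
  have hUt : ∀ᶠ n in 𝓝 (⟨y₀, v₀⟩ : TangentBundle (𝓡 D.Y.dim) D.Y), n.1 ∈ U :=
    (FiberBundle.continuous_proj (EuclideanSpace ℝ (Fin D.Y.dim))
      (TangentSpace (𝓡 D.Y.dim) (M := D.Y))).continuousAt.preimage_mem_nhds (hU.mem_nhds hyU)
  have key : ∀ {C : Mfd.{u}} {f : D.Y → C}, ContMDiffOn (𝓡 D.Y.dim) (𝓡 C.dim) ∞ f U →
      ContMDiffAt (𝓡 D.Y.dim).tangent (𝓡 C.dim).tangent ∞
        (tangentMap (𝓡 D.Y.dim) (𝓡 C.dim) f) ⟨y₀, v₀⟩ := by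
    intro C f hf
    have h1 := hf.contMDiffOn_tangentMapWithin (m := ∞) (by simp) hU.uniqueMDiffOn
    have h2 : ContMDiffOn (𝓡 D.Y.dim).tangent (𝓡 C.dim).tangent ∞
        (tangentMap (𝓡 D.Y.dim) (𝓡 C.dim) f) (TotalSpace.proj ⁻¹' U) := h1.congr fun n hn =>
      (tangentMapWithin_eq_tangentMap (hU.uniqueMDiffOn _ hn)
        ((hf.contMDiffAt (hU.mem_nhds hn)).mdifferentiableAt (by simp))).symm
    exact h2.contMDiffAt hUt
  have hfib : ∀ y ∈ U, B₁.μ (l y).1 = Q.μ₁ (l y).2 := fun y hy => (hlU y hy).1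
  classical
  have s1 : ContMDiffAt (𝓡 D.Y.dim).tangent Γ₁.R.E.model ∞
      (fun n : TangentBundle (𝓡 D.Y.dim) D.Y => (⟨Q.μ₁ (l n.1).2,
        Q.θ (l n.1).2 (diff (fun z => (l z).2) n.1 n.2)⟩ : Γ₁.R.E.Tot)) ⟨y₀, v₀⟩ :=
    (Q.θ_smooth _).comp _ (key hl2)
  have s2 : ContMDiffAt (𝓡 D.Y.dim).tangent Γ₁.R.E.model ∞
      (fun n : TangentBundle (𝓡 D.Y.dim) D.Y => (⟨Q.μ₁ (l n.1).2,
        if h : B₁.μ (l n.1).1 = Q.μ₁ (l n.1).2 then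
          B₁.θ.ev (l n.1).1 h (diff (fun z => (l z).1) n.1 n.2) else 0⟩ : Γ₁.R.E.Tot))
      ⟨y₀, v₀⟩ := by
    refine ((B₁.θ_smooth _).comp _ (key hl1)).congr_of_eventuallyEq ?_
    filter_upwards [hUt] with n hn
    rw [dif_pos (hfib _ hn)]
    exact B₁.θ.tot_ev (hfib _ hn) _
  have s0 : ContMDiffAt (𝓡 D.Y.dim).tangent (𝓡 Q.P.dim) ∞
      (fun n : TangentBundle (𝓡 D.Y.dim) D.Y => (l n.1).2) ⟨y₀, v₀⟩ :=
    ContMDiffAt.comp (g := fun z => (l z).2) (f := TotalSpace.proj)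
      (⟨y₀, v₀⟩ : TangentBundle (𝓡 D.Y.dim) D.Y) (hl2.contMDiffAt (hU.mem_nhds hyU))
      (contMDiff_proj (TangentSpace (𝓡 D.Y.dim)) _)
  have s3 := contMDiffAt_tot_neg (Q.Φ_smooth.contMDiffAt s0 (contMDiffAt_tot_sub s1 s2))
  refine s3.congr_of_eventuallyEq ?_
  filter_upwards [hUt] with n hn
  obtain ⟨y, v⟩ := n
  have hn : y ∈ U := hn
  obtain ⟨c, rfl, hc⟩ := exists_vel y v
  obtain ⟨h1, h2⟩ := D.exists_vel_lift hU hl hc hn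
  have hct := hc.eventually_mem hU hn
  have hm : D.moment (D.q (l (c 0))) = Q.μ₂ (l (c 0)).2 := D.moment_q (hlU _ hn).1
  have e := D.form_q_vel h1 h2 (hct.mono fun t ht => hfib _ ht)
    (hc.congr (hct.mono fun t ht => (hlU _ ht).2)) (hfib _ hn) hm rfl
  have hq := (hlU _ hn).2
  have e' : (⟨D.moment (c 0), D.form (c 0) v⟩ : Γ₂.R.E.Tot) =
      ⟨Q.μ₂ (l (c 0)).2, D.form.ev (D.q (l (c 0))) hm v⟩ := D.form.tot_ev_of_eq hq hm v
  refine e'.trans ?_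
  rw [dif_pos (hfib _ hn)]
  exact congrArg (fun z => (⟨Q.μ₂ (l (c 0)).2, z⟩ : Γ₂.R.E.Tot)) e

end DiagonalQuotient

/-! ### Multiplicativity and the kernel condition on the quotient -/

theorem Smooth.diff_eq_of_vel {A B : Mfd.{u}} {f : A → B} (hf : Smooth f) {c : ℝ → A} {v ξ}
    (hc : Vel A c v) {a : A} (ha : c 0 = a) (h : Vel B (fun t => f (c t)) ξ) :
    (diff f a v : EuclideanSpace ℝ (Fin B.dim)) = ξ := by
  subst ha
  exact (hf.vel hc).unique h

theorem FormOn.ev_eq_zero_iff {P X : Mfd.{u}} {f : P → X} {E : VBundle X} (θ : FormOn P f E)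
    {p p' : P} (hp : p = p') {x : X} (h : f p = x) (v : EuclideanSpace ℝ (Fin P.dim)) :
    θ.ev p h v = 0 ↔ θ p' v = 0 := by
  subst hp h; rfl

section Ker

variable {P X Y Z : Mfd.{u}} {f : P → X} {g : P → Y} {k : P → Z} {E : VBundle Z} {θ : FormOn P k E}
  {p : P}

theorem ker_iff_of_ker_eq
    (h : LinearMap.ker (diff f p).toLinearMap ⊓ LinearMap.ker (θ p) =
      LinearMap.ker (diff g p).toLinearMap ⊓ LinearMap.ker (θ p))
    {v : EuclideanSpace ℝ (Fin P.dim)} (hv : θ p v = 0) :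
    (diff f p v : EuclideanSpace ℝ (Fin X.dim)) = 0 ↔
      (diff g p v : EuclideanSpace ℝ (Fin Y.dim)) = 0 :=
  ⟨fun h' => (h.le (show v ∈ _ from ⟨h', hv⟩)).1, fun h' => (h.ge (show v ∈ _ from ⟨h', hv⟩)).1⟩

theorem ker_eq_of_ker_iff
    (h : ∀ v : EuclideanSpace ℝ (Fin P.dim), θ p v = 0 →
      ((diff f p v : EuclideanSpace ℝ (Fin X.dim)) = 0 ↔
        (diff g p v : EuclideanSpace ℝ (Fin Y.dim)) = 0)) :
    LinearMap.ker (diff f p).toLinearMap ⊓ LinearMap.ker (θ p) =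
      LinearMap.ker (diff g p).toLinearMap ⊓ LinearMap.ker (θ p) :=
  le_antisymm (fun v hv => ⟨(h v hv.2).1 hv.1, hv.2⟩) fun v hv => ⟨(h v hv.2).2 hv.1, hv.2⟩

end Ker

theorem PfaffianBibundle.op_θ_ev {Γ₁ Γ₂ : PfaffianGroupoid.{u}} (Q : PfaffianBibundle Γ₁ Γ₂)
    {p : Q.P} {y : Γ₂.G.X} (h : Q.μ₂ p = y) (v : EuclideanSpace ℝ (Fin Q.P.dim)) :
    FormOn.ev (P := Q.P) (f := Q.μ₂) Q.op.θ p h v = - Q.phi p rfl h (Q.θ.ev p rfl v) := by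
  subst h; rfl

theorem PfaffianBibundle.phi_ractInv {Γ₁ Γ₂ : PfaffianGroupoid.{u}} (Q : PfaffianBibundle Γ₁ Γ₂)
    {p : Q.P} {g : Γ₂.G.arr} {x : Γ₁.G.X} {y y' : Γ₂.G.X} (hs : Γ₂.G.s g = y)
    (hx : Q.μ₁ p = x) (hx' : Q.μ₁ (Q.ractInv g p) = x) (hy : Q.μ₂ p = y) (ht : Γ₂.G.t g = y')
    (hy' : Q.μ₂ (Q.ractInv g p) = y') (α : Γ₁.R.E.fib x) :
    Q.phi (Q.ractInv g p) hx' hy' α = Γ₂.R.act g hs ht (Q.phi p hx hy α) := by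
  have h := Q.phi_ract (g := Γ₂.G.inv g) (by rw [hy, Γ₂.G.t_inv, hs]) hx hx' hy
    (by rw [Γ₂.G.s_inv, Γ₂.G.t_inv, hs]) (by rw [Γ₂.G.t_inv, Γ₂.G.s_inv, ht]) hy' α
  rwa [Γ₂.R.act_congr (Γ₂.G.inv_inv g)] at h

section DiagForm

variable {Γ₁ Γ₂ : PfaffianGroupoid.{u}} {Q : PfaffianBibundle Γ₁ Γ₂} {M : Mfd.{u}}
  {B₁ : PrincipalPfaffianBundle Γ₁ M}

/-- The term in `θ` transforms by the multiplicativity of `-Φ ∘ θ` for the left action of `Σ₂`, the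
Pfaffian law of the opposite bibundle. The term in `θ₁` sees only the equivariance of `Φ`. -/
theorem diagForm_ractInv {g : ℝ → Γ₂.G.arr} {a : ℝ → B₁.P} {b : ℝ → Q.P} {γ v w w'}
    (hg : Vel Γ₂.G.arr g γ) (hb : Vel Q.P b w)
    (hgb : ∀ᶠ t in 𝓝 0, Γ₂.G.s (g t) = Q.μ₂ (b t))
    (hb' : Vel Q.P (fun t => Q.ractInv (g t) (b t)) w') (h : B₁.μ (a 0) = Q.μ₁ (b 0))
    (h' : B₁.μ (a 0) = Q.μ₁ (Q.ractInv (g 0) (b 0))) {y y' : Γ₂.G.X} (hy : Q.μ₂ (b 0) = y)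
    (hs : Γ₂.G.s (g 0) = y) (ht : Γ₂.G.t (g 0) = y')
    (hy' : Q.μ₂ (Q.ractInv (g 0) (b 0)) = y') :
    - diagForm Q B₁ h' hy' v w' =
      Γ₂.form.ev (g 0) ht γ + Γ₂.R.act (g 0) hs ht (- diagForm Q B₁ h hy v w) := by
  have e : FormOn.ev (P := Q.P) (f := Q.μ₂) Q.op.θ (Q.ractInv (g 0) (b 0)) hy' w' =
      Γ₂.form.ev (g 0) ht γ + Γ₂.R.act (g 0) hs ht
        (FormOn.ev (P := Q.P) (f := Q.μ₂) Q.op.θ (b 0) hy w) :=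
    Q.op.left_pfaffian.act_vel Q.ractInv_principal hg hb hgb hb' hy' ht hs hy
  rw [Q.op_θ_ev, Q.op_θ_ev] at e
  have hθ : B₁.θ.ev (a 0) h' v = Γ₁.R.E.tr (h.symm.trans h') (B₁.θ.ev (a 0) h v) := by
    rw [FormOn.tr_ev]
  rw [diagForm, diagForm, map_sub, map_sub, neg_sub, sub_eq_add_neg, e, hθ, Q.phi_tr,
    Q.phi_ractInv hs rfl _ hy ht, neg_sub, map_sub, map_neg]
  abel

end DiagForm

namespace DiagonalQuotient

variable {Γ₁ Γ₂ : PfaffianGroupoid.{u}} {Q : PfaffianBibundle Γ₁ Γ₂} {M : Mfd.{u}}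
  {B₁ : PrincipalPfaffianBundle Γ₁ M} (D : DiagonalQuotient Q B₁)

/-- Every curve in the quotient lifts through any given point over it. -/
theorem exists_curve_lift {y : ℝ → D.Y} {z} (hy : Vel D.Y y z) {a₀ : B₁.P} {b₀ : Q.P}
    (h : B₁.μ a₀ = Q.μ₁ b₀) (h0 : D.q (a₀, b₀) = y 0) :
    ∃ (a : ℝ → B₁.P) (b : ℝ → Q.P) (v : EuclideanSpace ℝ (Fin B₁.P.dim))
      (w : EuclideanSpace ℝ (Fin Q.P.dim)), a 0 = a₀ ∧ b 0 = b₀ ∧ Vel B₁.P a v ∧ Vel Q.P b w ∧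
      ∀ᶠ t in 𝓝 0, B₁.μ (a t) = Q.μ₁ (b t) ∧ D.q (a t, b t) = y t := by
  obtain ⟨l, U, hU, hyU, hl, hl0, hlU⟩ := D.lift (a₀, b₀) h
  rw [h0] at hyU hl0
  obtain ⟨h1, h2⟩ := D.exists_vel_lift hU hl hy hyU
  exact ⟨_, _, _, _, congrArg Prod.fst hl0, congrArg Prod.snd hl0, h1, h2,
    (hy.eventually_mem hU hyU).mono fun t ht => hlU _ ht⟩

/-- The differential of `q` depends only on the base point and the velocities, so a lift may be
replaced by a more convenient curve with the same first-order data. -/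
theorem vel_q_congr {a a' : ℝ → B₁.P} {b b' : ℝ → Q.P} {v w z} (ha : Vel B₁.P a v)
    (hb : Vel Q.P b w) (hab : ∀ᶠ t in 𝓝 0, B₁.μ (a t) = Q.μ₁ (b t))
    (hz : Vel D.Y (fun t => D.q (a t, b t)) z) (ha' : Vel B₁.P a' v) (hb' : Vel Q.P b' w)
    (hab' : ∀ᶠ t in 𝓝 0, B₁.μ (a' t) = Q.μ₁ (b' t)) (ha0 : a' 0 = a 0) (hb0 : b' 0 = b 0) :
    Vel D.Y (fun t => D.q (a' t, b' t)) z := by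
  have key : ∀ x y, x = a 0 → y = b 0 → (diffOn D.q (Q.fib B₁) x y v w :
      EuclideanSpace ℝ (Fin D.Y.dim)) = diffOn D.q (Q.fib B₁) (a 0) (b 0) v w := by
    rintro _ _ rfl rfl; rfl
  exact (D.smooth.vel ha' hb' hab').of_eq
    ((key _ _ ha0 hb0).trans ((D.smooth.vel ha hb hab).unique hz))

/-- Since `μ₂` has zero velocity along the lift, the lift can be changed so that its component in
`P` is constant. Vanishing of the form then says that `θ₁` vanishes on the velocity in `P₁`, while
the moment map of `P₁` is constant near `0`. The kernel condition of `P₁` concludes. -/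
theorem ker_proj_of_ker_moment {y : D.Y} {z : EuclideanSpace ℝ (Fin D.Y.dim)}
    (h1 : (diff D.moment y z : EuclideanSpace ℝ (Fin Γ₂.G.X.dim)) = 0) (h2 : D.form y z = 0) :
    (diff D.proj y z : EuclideanSpace ℝ (Fin M.dim)) = 0 := by
  obtain ⟨c, rfl, hc⟩ := exists_vel y z
  obtain ⟨⟨a₀, b₀⟩, hx, hq⟩ := D.surj (c 0)
  obtain ⟨a, b, v, w, rfl, rfl, ha, hb, hab⟩ := D.exists_curve_lift hc hx hq
  have hbv : Vel Γ₂.G.X (fun t => Q.μ₂ (b t)) 0 :=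
    ((D.moment_smooth.vel hc).of_eq h1).congr (hab.mono fun t ht =>
      (D.moment_q ht.1).symm.trans (congrArg D.moment ht.2))
  -- `b'` has the same point and velocity as `b` at `0`, but stays in one fibre of `μ₂`, which is an
  -- orbit of `Σ₁`; `a'` is adjusted to remain over it.
  obtain ⟨b', hb'0, hb', hbb'⟩ := Q.left_principal.proj_submersion.exists_lift
    (hasVel_const (I := 𝓡 Γ₂.G.X.dim) (Q.μ₂ (b 0))) (a := b 0) rfl w
    (Q.left_principal.proj_submersion.smooth.diff_eq_of_vel hb rfl hbv)
  have hab1 : ∀ᶠ t in 𝓝 0, B₁.μ (a t) = Q.μ₁ (b t) := hab.mono fun t ht => ht.1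
  obtain ⟨a', ha'0, ha', hab'⟩ := B₁.principal.moment_submersion.exists_lift
    (Q.left_principal.moment_submersion.smooth.vel hb') (a := a 0)
    (by rw [hb'0]; exact hx) v
    (B₁.principal.moment_submersion.smooth.diff_eq_of_vel ha rfl
      (((Q.left_principal.moment_submersion.smooth.vel hb).of_eq
        (Q.left_principal.moment_submersion.smooth.diff_eq_of_vel hb hb'0.symm
          (Q.left_principal.moment_submersion.smooth.vel hb)).symm).congr hab1))
  have hz := D.vel_q_congr ha hb hab1 (hc.congr (hab.mono fun t ht => ht.2)) ha' hb' hab' ha'0 hb'0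
  obtain ⟨γ, hγ⟩ : ∃ γ, Vel Γ₁.G.arr (fun t => Q.left_principal.div (b' t) (b 0)) γ :=
    ⟨_, Q.left_principal.div_smooth.vel hb' (hasVel_const (I := 𝓡 Q.P.dim) (b 0)) hbb'⟩
  have hgs : ∀ᶠ t in 𝓝 0, Γ₁.G.s (Q.left_principal.div (b' t) (b 0)) = B₁.μ (a' t) :=
    (hbb'.and hab').mono fun t ht => (Q.left_principal.s_div ht.1).trans ht.2.symm
  obtain ⟨v', ha''⟩ : ∃ v', Vel B₁.P
      (fun t => B₁.act (Q.left_principal.div (b' t) (b 0)) (a' t)) v' :=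
    ⟨_, B₁.principal.act_smooth.vel hγ ha' hgs⟩
  -- Translating the pair by the arrow from `b' t` to `b 0` leaves its class in the quotient
  -- unchanged and makes the second entry constant.
  set a'' : ℝ → B₁.P := fun t => B₁.act (Q.left_principal.div (b' t) (b 0)) (a' t) with ha''def
  have hab'' : ∀ᶠ t in 𝓝 0, B₁.μ (a'' t) = Q.μ₁ (b 0) := (hgs.and hbb').mono fun t ht => by
    rw [ha''def]; simp only
    rw [B₁.principal.moment_act _ _ ht.1, Q.left_principal.t_div ht.2]
  have hqq : ∀ᶠ t in 𝓝 0, D.q (a'' t, b 0) = D.q (a' t, b' t) :=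
    (hgs.and (hbb'.and hab')).mono fun t ht => by
      rw [← D.q_lact (x := (a' t, b' t)) ht.2.2 ht.1]
      simp only
      rw [Q.left_principal.act_div ht.2.1]
  have hz' := hz.congr hqq
  have hpt : D.q (a'' 0, b 0) = c 0 := by rw [hqq.self_of_nhds, ha'0, hb'0, hq]
  have hc0 := hasVel_const (I := 𝓡 Q.P.dim) (b 0)
  have hfib := hab''.self_of_nhds
  have e := D.form_q_vel ha'' hc0 hab'' hz' hfib (D.moment_q hfib) rfl
  rw [(D.form.ev_eq_zero_iff hpt _ _).2 h2, eq_comm, neg_eq_zero, diagForm_eq_zero_iff,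
    FormOn.ev_zero, eq_comm, B₁.θ.ev_eq_zero_iff rfl] at e
  refine D.proj_smooth.diff_eq_of_vel hz' hpt ?_
  have hk := (ker_iff_of_ker_eq (B₁.isPfaffian.ker_eq (a'' 0)) e).1
    (B₁.principal.moment_submersion.smooth.diff_eq_of_vel ha'' rfl
      ((hasVel_const (I := 𝓡 Γ₁.G.X.dim) (Q.μ₁ (b 0))).congr hab''))
  exact ((B₁.principal.proj_submersion.smooth.vel ha'').of_eq hk).congr
    (hab''.mono fun t ht => D.proj_q ht)

/-- The mirror image of the previous argument: the component in `P₁` is made constant, and the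
kernel condition of the left bundle `P` over `X₂` is used. -/
theorem ker_moment_of_ker_proj {y : D.Y} {z : EuclideanSpace ℝ (Fin D.Y.dim)}
    (h1 : (diff D.proj y z : EuclideanSpace ℝ (Fin M.dim)) = 0) (h2 : D.form y z = 0) :
    (diff D.moment y z : EuclideanSpace ℝ (Fin Γ₂.G.X.dim)) = 0 := by
  obtain ⟨c, rfl, hc⟩ := exists_vel y z
  obtain ⟨⟨a₀, b₀⟩, hx, hq⟩ := D.surj (c 0)
  obtain ⟨a, b, v, w, rfl, rfl, ha, hb, hab⟩ := D.exists_curve_lift hc hx hq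
  have hav : Vel M (fun t => B₁.proj (a t)) 0 :=
    ((D.proj_smooth.vel hc).of_eq h1).congr (hab.mono fun t ht =>
      (D.proj_q ht.1).symm.trans (congrArg D.proj ht.2))
  obtain ⟨a', ha'0, ha', haa'⟩ := B₁.principal.proj_submersion.exists_lift
    (hasVel_const (I := 𝓡 M.dim) (B₁.proj (a 0))) (a := a 0) rfl v
    (B₁.principal.proj_submersion.smooth.diff_eq_of_vel ha rfl hav)
  have hab1 : ∀ᶠ t in 𝓝 0, B₁.μ (a t) = Q.μ₁ (b t) := hab.mono fun t ht => ht.1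
  obtain ⟨b', hb'0, hb', hba'⟩ := Q.left_principal.moment_submersion.exists_lift
    (B₁.principal.moment_submersion.smooth.vel ha') (a := b 0)
    (by rw [ha'0]; exact hx.symm) w
    (Q.left_principal.moment_submersion.smooth.diff_eq_of_vel hb rfl
      (((B₁.principal.moment_submersion.smooth.vel ha).of_eq
        (B₁.principal.moment_submersion.smooth.diff_eq_of_vel ha ha'0.symm
          (B₁.principal.moment_submersion.smooth.vel ha)).symm).congr
            (hab1.mono fun t ht => ht.symm)))
  have hab' : ∀ᶠ t in 𝓝 0, B₁.μ (a' t) = Q.μ₁ (b' t) := hba'.mono fun t ht => ht.symm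
  have hz := D.vel_q_congr ha hb hab1 (hc.congr (hab.mono fun t ht => ht.2)) ha' hb' hab' ha'0 hb'0
  obtain ⟨γ, hγ⟩ : ∃ γ, Vel Γ₁.G.arr (fun t => B₁.principal.div (a' t) (a 0)) γ :=
    ⟨_, B₁.principal.div_smooth.vel ha' (hasVel_const (I := 𝓡 B₁.P.dim) (a 0)) haa'⟩
  have hgs : ∀ᶠ t in 𝓝 0, Γ₁.G.s (B₁.principal.div (a' t) (a 0)) = Q.μ₁ (b' t) :=
    (haa'.and hab').mono fun t ht => (B₁.principal.s_div ht.1).trans ht.2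
  obtain ⟨w', hb''⟩ : ∃ w', Vel Q.P (fun t => Q.lact (B₁.principal.div (a' t) (a 0)) (b' t)) w' :=
    ⟨_, Q.left_principal.act_smooth.vel hγ hb' hgs⟩
  set b'' : ℝ → Q.P := fun t => Q.lact (B₁.principal.div (a' t) (a 0)) (b' t) with hb''def
  have hab'' : ∀ᶠ t in 𝓝 0, B₁.μ (a 0) = Q.μ₁ (b'' t) := (hgs.and haa').mono fun t ht => by
    rw [hb''def]; simp only
    rw [Q.left_principal.moment_act _ _ ht.1, B₁.principal.t_div ht.2]
  have hqq : ∀ᶠ t in 𝓝 0, D.q (a 0, b'' t) = D.q (a' t, b' t) :=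
    (haa'.and hab').mono fun t ht => by
      rw [← D.q_lact (x := (a' t, b' t)) ht.2 (B₁.principal.s_div ht.1)]
      simp only
      rw [B₁.principal.act_div ht.1]
  have hz' := hz.congr hqq
  have hpt : D.q (a 0, b'' 0) = c 0 := by rw [hqq.self_of_nhds, ha'0, hb'0, hq]
  have hc0 := hasVel_const (I := 𝓡 B₁.P.dim) (a 0)
  have hfib := hab''.self_of_nhds
  have e := D.form_q_vel hc0 hb'' hab'' hz' hfib (D.moment_q hfib) rfl
  rw [(D.form.ev_eq_zero_iff hpt _ _).2 h2, eq_comm, neg_eq_zero, diagForm_eq_zero_iff,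
    FormOn.ev_zero, Q.θ.ev_eq_zero_iff rfl] at e
  refine D.moment_smooth.diff_eq_of_vel hz' hpt ?_
  have hk := (ker_iff_of_ker_eq (Q.left_pfaffian.ker_eq (b'' 0)) e).1
    (Q.left_principal.moment_submersion.smooth.diff_eq_of_vel hb'' rfl
      ((hasVel_const (I := 𝓡 Γ₁.G.X.dim) (B₁.μ (a 0))).congr
        (hab''.mono fun t ht => ht.symm)))
  exact ((Q.left_principal.proj_submersion.smooth.vel hb'').of_eq hk).congr
    (hab''.mono fun t ht => D.moment_q ht)

theorem isPfaffian [T2Space M] : IsLeftPfaffian Γ₂ D.moment D.proj D.act D.form := by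
  refine IsLeftPfaffian.of_curves D.principal ?_ fun y => ?_
  · intro g y γ z z' hg hy hgy hz hs hm
    obtain ⟨⟨a₀, b₀⟩, hx, hq⟩ := D.surj (y 0)
    obtain ⟨a, b, v, w, rfl, rfl, ha, hb, hab⟩ := D.exists_curve_lift hy hx hq
    have hgb : ∀ᶠ t in 𝓝 0, Γ₂.G.s (g t) = Q.μ₂ (b t) := (hgy.and hab).mono fun t ht => by
      rw [ht.1, ← ht.2.2, D.moment_q ht.2.1]
    have hab1 : ∀ᶠ t in 𝓝 0, B₁.μ (a t) = Q.μ₁ (b t) := hab.mono fun t ht => ht.1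
    have hab' : ∀ᶠ t in 𝓝 0, B₁.μ (a t) = Q.μ₁ (Q.ractInv (g t) (b t)) :=
      (hgb.and hab1).mono fun t ht => mem_ractInv (x := (a t, b t)) ht.2 ht.1
    obtain ⟨w', hb'⟩ : ∃ w', Vel Q.P (fun t => Q.ractInv (g t) (b t)) w' :=
      ⟨_, Q.ractInv_principal.act_smooth.vel hg hb hgb⟩
    have hact : ∀ᶠ t in 𝓝 0, D.q (a t, Q.ractInv (g t) (b t)) = D.act (g t) (y t) :=
      (hgb.and hab).mono fun t ht => by
        rw [← ht.2.2, D.act_q (x := (a t, b t)) ht.2.1 ht.1]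
    have hmy : Q.μ₂ (b 0) = D.moment (y 0) := by rw [← hq, D.moment_q hx]
    have e1 := D.form_q_vel ha hb hab1 (hy.congr (hab.mono fun t ht => ht.2)) hx
      (y := D.moment (y 0)) (by rw [hq]) hmy
    have e2 := D.form_q_vel ha hb' hab' (hz.congr hact) hab'.self_of_nhds
      (y := Γ₂.G.t (g 0)) (by rw [hact.self_of_nhds, hm])
      (Q.ractInv_principal.moment_act _ _ hgb.self_of_nhds)
    rw [D.form.ev_congr hq] at e1
    rw [D.form.ev_congr hact.self_of_nhds] at e2
    rw [e1, e2]
    exact diagForm_ractInv hg hb hgb hb' _ _ _ _ _ _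
  · exact ker_eq_of_ker_iff fun v hv =>
      ⟨fun h => D.ker_proj_of_ker_moment h hv, fun h => D.ker_moment_of_ker_proj h hv⟩

/-- The principal Pfaffian bundle on the quotient. -/
noncomputable def bundle [T2Space M] : PrincipalPfaffianBundle Γ₂ M where
  P := D.Y
  μ := D.moment
  proj := D.proj
  act := D.act
  principal := D.principal
  θ := D.form
  θ_smooth := D.form_smooth
  isPfaffian := D.isPfaffian

theorem isQuotientMap [T2Space M] : Q.IsQuotientMap B₁ D.bundle D.q where
  smooth := D.smooth
  surj := D.surj
  submersive a₀ b₀ h z := by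
    obtain ⟨c, hc0, hc⟩ := exists_vel (D.q (a₀, b₀)) z
    obtain ⟨a, b, v, w, rfl, rfl, ha, hb, hab⟩ := D.exists_curve_lift hc h hc0.symm
    have hab1 : ∀ᶠ t in 𝓝 0, B₁.μ (a t) = Q.μ₁ (b t) := hab.mono fun t ht => ht.1
    exact ⟨v, w, tangentToFib_of_curves B₁.principal.moment_submersion.smooth
      Q.left_principal.moment_submersion.smooth ha hb hab1,
      (D.smooth.vel ha hb hab1).unique (hc.congr (hab.mono fun t ht => ht.2))⟩
  orbits := D.orbits
  proj_eq _ hx := D.proj_q hx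
  moment_eq _ hx := D.moment_q hx
  equivariant x hx g hg := by
    refine Eq.trans ?_ (D.act_q hx ((Γ₂.G.s_inv g).trans hg.symm)).symm
    rw [PfaffianBibundle.ractInv, Γ₂.G.inv_inv]
  form_eq a₀ b₀ h hm v w hT := by
    obtain ⟨a, b, rfl, rfl, ha, hb, hab⟩ := exists_curve_fibProd B₁.principal.moment_submersion
      Q.left_principal.moment_submersion.smooth hT
    exact neg_eq_iff_eq_neg.2 (D.form_q_vel ha hb hab (D.smooth.vel ha hb hab) h hm rfl)

end DiagonalQuotient

/-! ### Uniqueness and symmetry of the transport relation -/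

namespace PfaffianBibundle.IsQuotientMap

variable {Γ₁ Γ₂ : PfaffianGroupoid.{u}} {Q : PfaffianBibundle Γ₁ Γ₂} {M : Mfd.{u}}
  {B₁ : PrincipalPfaffianBundle Γ₁ M} {B₂ B₂' : PrincipalPfaffianBundle Γ₂ M}
  {q : B₁.P × Q.P → B₂.P} {q' : B₁.P × Q.P → B₂'.P}

/-- The quotient map has local sections. -/
theorem exists_lift (h : Q.IsQuotientMap B₁ B₂ q) {x : B₁.P × Q.P} (hx : x ∈ Q.fib B₁) :
    ∃ (l : B₂.P → B₁.P × Q.P) (U : Set B₂.P), IsOpen U ∧ q x ∈ U ∧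
      ContMDiffOn (𝓡 B₂.P.dim) ((𝓡 B₁.P.dim).prod (𝓡 Q.P.dim)) ∞ l U ∧ l (q x) = x ∧
      ∀ y ∈ U, l y ∈ Q.fib B₁ ∧ q (l y) = y := by
  obtain ⟨a₀, b₀⟩ := x
  have hx : B₁.μ a₀ = Q.μ₁ b₀ := hx
  obtain ⟨lam, W, hW, haW, hlam, hlam1, hlam2⟩ := exists_submersion_lift isOpen_univ (mem_univ a₀)
    B₁.principal.moment_submersion.smooth.contMDiffOn
    (B₁.principal.moment_submersion.submersive a₀)
  have hμ₁ : Smooth Q.μ₁ := Q.left_principal.moment_submersion.smooth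
  set W' : Set (B₁.P × Q.P) := (fun z => (z.1, Q.μ₁ z.2)) ⁻¹' W with hW'
  have hW'o : IsOpen W' := hW.preimage
    (continuous_fst.prodMk (hμ₁.continuous.comp continuous_snd))
  have h0 : (a₀, b₀) ∈ W' := by
    change (a₀, Q.μ₁ b₀) ∈ W
    rw [← hx]
    exact haW
  -- `q` is controlled only on the fibred product. The local retraction `r` onto it makes `q ∘ r` a
  -- smooth map on an open set that is submersive at the given point, so that the local section
  -- theorem applies.
  set r : B₁.P × Q.P → B₁.P × Q.P := fun z => (lam (z.1, Q.μ₁ z.2), z.2) with hr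
  have hrs : ContMDiffOn ((𝓡 B₁.P.dim).prod (𝓡 Q.P.dim)) ((𝓡 B₁.P.dim).prod (𝓡 Q.P.dim)) ∞ r W' :=
    (hlam.comp (contMDiff_fst.prodMk (hμ₁.comp contMDiff_snd)).contMDiffOn
      fun z hz => hz).prodMk contMDiffOn_snd
  have hrf : ∀ z ∈ W', r z ∈ Q.fib B₁ := fun z hz => (hlam1 _ hz).2
  have hrid : ∀ a b, B₁.μ a = Q.μ₁ b → (a, b) ∈ W' → r (a, b) = (a, b) := by
    intro a b hab hz
    have hz : (a, Q.μ₁ b) ∈ W := hz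
    simp only [hr]
    rw [← hab] at hz ⊢
    rw [hlam2 a hz]
  have hf : ContMDiffOn ((𝓡 B₁.P.dim).prod (𝓡 Q.P.dim)) (𝓡 B₂.P.dim) ∞ (fun z => q (r z)) W' :=
    h.smooth.comp hrs hrf
  have hr0 := hrid a₀ b₀ hx h0
  have hsurj : Function.Surjective
      (mfderiv ((𝓡 B₁.P.dim).prod (𝓡 Q.P.dim)) (𝓡 B₂.P.dim) (fun z => q (r z)) (a₀, b₀)) := by
    intro z
    obtain ⟨v, w, hT, hvw⟩ := h.submersive a₀ b₀ hx z
    obtain ⟨a, b, rfl, rfl, ha, hb, hab⟩ := exists_curve_fibProd B₁.principal.moment_submersion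
      hμ₁ hT
    refine ⟨(v, w), ?_⟩
    have hp := ha.prodMk hb
    have h1 := hp.comp ((hf.contMDiffAt (hW'o.mem_nhds h0)).mdifferentiableAt (by simp))
    have h2 := (h.smooth.vel ha hb hab).of_eq hvw
    refine h1.unique (h2.congr ?_)
    filter_upwards [hab, hp.eventually_mem hW'o h0] with t ht ht'
    rw [hrid _ _ ht ht']
  obtain ⟨σ, O, hO, h0O, hσ, hσ0, hσO⟩ := exists_local_section hW'o h0 hf hsurj
  rw [hr0] at h0O hσ0
  exact ⟨fun y => r (σ y), O, hO, h0O, hrs.comp hσ fun y hy => (hσO y hy).1,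
    (congrArg r hσ0).trans hr0, fun y hy => ⟨hrf _ (hσO y hy).1, (hσO y hy).2⟩⟩

/-- The total space of the transported bundle, as a quotient. -/
def diagonalQuotient (h : Q.IsQuotientMap B₁ B₂ q) : DiagonalQuotient Q B₁ where
  Y := B₂.P
  q := q
  smooth := h.smooth
  surj := h.surj
  orbits := h.orbits
  lift _ hx := h.exists_lift hx

theorem act_q (h : Q.IsQuotientMap B₁ B₂ q) {x : B₁.P × Q.P} (hx : x ∈ Q.fib B₁) {g : Γ₂.G.arr}
    (hg : Γ₂.G.s g = Q.μ₂ x.2) : B₂.act g (q x) = q (x.1, Q.ractInv g x.2) := by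
  have := h.equivariant x hx (Γ₂.G.inv g) (hg.symm.trans (Γ₂.G.t_inv g).symm)
  rw [Γ₂.G.inv_inv] at this
  exact this.symm

theorem form_q_vel (h : Q.IsQuotientMap B₁ B₂ q) {a : ℝ → B₁.P} {b : ℝ → Q.P} {v w z}
    (ha : Vel B₁.P a v) (hb : Vel Q.P b w) (hab : ∀ᶠ t in 𝓝 0, B₁.μ (a t) = Q.μ₁ (b t))
    (hz : Vel B₂.P (fun t => q (a t, b t)) z) (hf : B₁.μ (a 0) = Q.μ₁ (b 0)) {y : Γ₂.G.X}
    (hy : B₂.μ (q (a 0, b 0)) = y) (hy' : Q.μ₂ (b 0) = y) :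
    B₂.θ.ev (q (a 0, b 0)) hy z = - diagForm Q B₁ hf hy' v w := by
  subst hy'
  have e := h.form_eq (a 0) (b 0) hf hy v w
    (tangentToFib_of_curves B₁.principal.moment_submersion.smooth
      Q.left_principal.moment_submersion.smooth ha hb hab)
  have hz' := hz.unique (h.smooth.vel ha hb hab)
  subst hz'
  exact neg_eq_iff_eq_neg.1 e

/-- The map between two transports of the same bundle. -/
noncomputable def compare (h : Q.IsQuotientMap B₁ B₂ q) (q' : B₁.P × Q.P → B₂'.P)
    (y : B₂.P) : B₂'.P :=
  q' (h.diagonalQuotient.rep y)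

theorem compare_q (h : Q.IsQuotientMap B₁ B₂ q) (h' : Q.IsQuotientMap B₁ B₂' q')
    {x : B₁.P × Q.P} (hx : x ∈ Q.fib B₁) : h.compare q' (q x) = q' x :=
  (h'.orbits _ (h.diagonalQuotient.rep_mem _) x hx).2
    ((h.orbits _ (h.diagonalQuotient.rep_mem _) x hx).1 (h.diagonalQuotient.q_rep (q x)))

theorem compare_smooth (h : Q.IsQuotientMap B₁ B₂ q) (h' : Q.IsQuotientMap B₁ B₂' q') :
    Smooth (h.compare q') :=
  h.diagonalQuotient.contMDiff_of_descends h'.smooth fun _ hx => h.compare_q h' hx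

theorem compare_compare (h : Q.IsQuotientMap B₁ B₂ q) (h' : Q.IsQuotientMap B₁ B₂' q') (y : B₂.P) :
    h'.compare q (h.compare q' y) = y := by
  obtain ⟨x, hx, rfl⟩ := h.surj y
  rw [h.compare_q h' hx, h'.compare_q h hx]

/-- The transport of a principal Pfaffian bundle is unique up to isomorphism. -/
theorem iso (h : Q.IsQuotientMap B₁ B₂ q) (h' : Q.IsQuotientMap B₁ B₂' q') : B₂.Iso B₂' := by
  have hμ : ∀ y, B₂'.μ (h.compare q' y) = B₂.μ y := by
    intro y
    obtain ⟨x, hx, rfl⟩ := h.surj y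
    rw [h.compare_q h' hx, h.moment_eq x hx, h'.moment_eq x hx]
  refine ⟨⟨⟨h.compare q', h'.compare q, h.compare_compare h', h'.compare_compare h⟩,
    h.compare_smooth h', h'.compare_smooth h⟩, fun y => ?_, fun g y hg => ?_, hμ, fun y z => ?_⟩
  · change B₂'.proj (h.compare q' y) = _
    obtain ⟨x, hx, rfl⟩ := h.surj y
    rw [h.compare_q h' hx, h.proj_eq x hx, h'.proj_eq x hx]
  · change h.compare q' (B₂.act g y) = B₂'.act g (h.compare q' y)
    obtain ⟨x, hx, rfl⟩ := h.surj y
    rw [h.moment_eq x hx] at hg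
    rw [h.compare_q h' hx, h.act_q hx hg, h'.act_q hx hg,
      h.compare_q h' (DiagonalQuotient.mem_ractInv hx hg)]
  · change B₂'.θ.val (h.compare q' y) (hμ y) (diff (h.compare q') y z) = _
    obtain ⟨c, rfl, hc⟩ := exists_vel y z
    obtain ⟨⟨a₀, b₀⟩, hx, hq⟩ := h.surj (c 0)
    obtain ⟨a, b, v, w, rfl, rfl, ha, hb, hab⟩ :=
      h.diagonalQuotient.exists_curve_lift hc hx hq
    have hab1 : ∀ᶠ t in 𝓝 0, B₁.μ (a t) = Q.μ₁ (b t) := hab.mono fun t ht => ht.1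
    have hab2 : ∀ᶠ t in 𝓝 0, q (a t, b t) = c t := hab.mono fun t ht => ht.2
    obtain ⟨z', hz', hz'e⟩ : ∃ z' : EuclideanSpace ℝ (Fin B₂'.P.dim),
        Vel B₂'.P (fun t => h.compare q' (c t)) z' ∧ z' = diff (h.compare q') (c 0) z :=
      ⟨_, (h.compare_smooth h').vel hc, rfl⟩
    have hq' : ∀ᶠ t in 𝓝 0, q' (a t, b t) = h.compare q' (c t) := hab.mono fun t ht => by
      rw [← h.compare_q h' (x := (a t, b t)) ht.1]
      exact congrArg _ ht.2
    have hm : Q.μ₂ (b 0) = B₂.μ (c 0) := by rw [← hq, h.moment_eq _ hx]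
    have e1 := h.form_q_vel ha hb hab1 (hc.congr hab2) hx (y := B₂.μ (c 0)) (by rw [hq]) hm
    have e2 := h'.form_q_vel ha hb hab1 (hz'.congr hq') hx (y := B₂.μ (c 0))
      (by rw [hq'.self_of_nhds, hμ]) hm
    have e1' := (B₂.θ.ev_congr hq _ z).symm.trans e1
    rw [B₂'.θ.ev_congr hq'.self_of_nhds] at e2
    rw [← hz'e]
    exact e2.trans e1'.symm

/-- The transport relation is invariant under isomorphism of the second bundle. -/
theorem exists_of_iso (h : Q.IsQuotientMap B₁ B₂ q) (hi : B₂.Iso B₂') :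
    ∃ q', Q.IsQuotientMap B₁ B₂' q' := by
  obtain ⟨F, hproj, hact, hμ, hθ⟩ := hi
  have hF : Smooth F := F.contMDiff
  have hFs : SmoothOn (fun x => F (q x)) (Q.fib B₁) := hF.comp_contMDiffOn h.smooth
  refine ⟨fun x => F (q x), hFs, fun y => ?_, fun a₀ b₀ hx z => ?_, fun x hx y hy => ?_,
    fun x hx => ?_, fun x hx => ?_, fun x hx g hg => ?_, fun a₀ b₀ hx hm v w hT => ?_⟩
  · obtain ⟨x, hx, hxy⟩ := h.surj (F.symm y)
    exact ⟨x, hx, by rw [hxy, F.apply_symm_apply]⟩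
  · obtain ⟨c, hc0, hc⟩ := exists_vel (F (q (a₀, b₀))) z
    have hFsm : Smooth F.symm := F.symm.contMDiff
    obtain ⟨a, b, v, w, rfl, rfl, ha, hb, hab⟩ :=
      h.diagonalQuotient.exists_curve_lift (hFsm.vel hc) hx
        (by rw [hc0, F.symm_apply_apply]; rfl)
    have hab1 : ∀ᶠ t in 𝓝 0, B₁.μ (a t) = Q.μ₁ (b t) := hab.mono fun t ht => ht.1
    refine ⟨v, w, tangentToFib_of_curves B₁.principal.moment_submersion.smooth
      Q.left_principal.moment_submersion.smooth ha hb hab1,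
      (hFs.vel ha hb hab1).unique (hc.congr (hab.mono fun t ht => ?_))⟩
    have ht2 : q (a t, b t) = F.symm (c t) := ht.2
    exact (congrArg F ht2).trans (F.apply_symm_apply _)
  · rw [← h.orbits x hx y hy]
    exact F.injective.eq_iff
  · rw [hproj, h.proj_eq x hx]
  · rw [hμ, h.moment_eq x hx]
  · rw [h.equivariant x hx g hg, hact]
    rw [Γ₂.G.s_inv, h.moment_eq x hx, hg]
  · obtain ⟨a, b, rfl, rfl, ha, hb, hab⟩ := exists_curve_fibProd B₁.principal.moment_submersion
      Q.left_principal.moment_submersion.smooth hT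
    obtain ⟨z, hz⟩ : ∃ z, Vel B₂.P (fun t => q (a t, b t)) z := ⟨_, h.smooth.vel ha hb hab⟩
    have e1 := h.form_q_vel ha hb hab hz hx (h.moment_eq _ hx) rfl
    have e2 := congrArg (Γ₂.R.E.tr (h.moment_eq _ hx)) (hθ (q (a 0, b 0)) z)
    have e3 : (diffOn (fun x => F (q x)) (Q.fib B₁) (a 0) (b 0) v w :
        EuclideanSpace ℝ (Fin B₂'.P.dim)) = diff F (q (a 0, b 0)) z :=
      (hFs.vel ha hb hab).unique (hF.vel hz)
    rw [neg_eq_iff_eq_neg]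
    refine Eq.trans ?_ e1
    refine Eq.trans ?_ e2
    refine Eq.trans ?_ (B₂'.θ.tr_ev (p := F (q (a 0, b 0))) (hμ _) (h.moment_eq _ hx)
      (diff F (q (a 0, b 0)) z)).symm
    exact congrArg (B₂'.θ.ev (F (q (a 0, b 0))) hm) e3

end PfaffianBibundle.IsQuotientMap

/-! ### Inverting the transport relation with the opposite bibundle -/

namespace PfaffianBibundle.IsQuotientMap

variable {Γ₁ Γ₂ : PfaffianGroupoid.{u}} {Q : PfaffianBibundle Γ₁ Γ₂} {M : Mfd.{u}}
  {B₁ : PrincipalPfaffianBundle Γ₁ M} {B₂ : PrincipalPfaffianBundle Γ₂ M}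
  {q : B₁.P × Q.P → B₂.P}

/-- Given `p₂` and `p` over the same point, the unique `p₁` with `q (p₁, p) = p₂`. -/
noncomputable def rev (h : Q.IsQuotientMap B₁ B₂ q) (z : B₂.P × Q.P) : B₁.P :=
  B₁.act (Q.left_principal.div (h.diagonalQuotient.rep z.1).2 z.2) (h.diagonalQuotient.rep z.1).1

/-- `Σ₁` acts transitively on the fibres of `μ₂`, so the orbit of `x` contains a pair with second
entry `p`. -/
theorem act_div_spec (h : Q.IsQuotientMap B₁ B₂ q) {x : B₁.P × Q.P} (hx : x ∈ Q.fib B₁) {p : Q.P}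
    (hp : B₂.μ (q x) = Q.μ₂ p) :
    (B₁.act (Q.left_principal.div x.2 p) x.1, p) ∈ Q.fib B₁ ∧
      q (B₁.act (Q.left_principal.div x.2 p) x.1, p) = q x := by
  have h1 : Q.μ₂ x.2 = Q.μ₂ p := (h.moment_eq x hx).symm.trans hp
  have hs : Γ₁.G.s (Q.left_principal.div x.2 p) = B₁.μ x.1 :=
    (Q.left_principal.s_div h1).trans (Eq.symm hx)
  have h2 := DiagonalQuotient.mem_lact hx hs
  have h3 := h.diagonalQuotient.q_lact hx hs
  rw [Q.left_principal.act_div h1] at h2 h3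
  exact ⟨h2, h3⟩

/-- The arrow that relates the two pairs fixes `p`; since the action on `P` is free, it is a unit.
-/
theorem left_unique (h : Q.IsQuotientMap B₁ B₂ q) {a a' : B₁.P} {p : Q.P}
    (ha : B₁.μ a = Q.μ₁ p) (ha' : B₁.μ a' = Q.μ₁ p) (he : q (a, p) = q (a', p)) : a = a' := by
  obtain ⟨g, hg, hga⟩ := (h.orbits (a, p) ha (a', p) ha').1 he
  rw [Prod.mk.injEq] at hga
  have hg1 := Q.left_principal.free g p (hg.trans ha) hga.2.symm
  rw [hga.1, hg1]
  exact (B₁.principal.act_one_of_eq ha.symm).symm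

theorem rev_spec (h : Q.IsQuotientMap B₁ B₂ q) {z : B₂.P × Q.P} (hz : z ∈ fibProd B₂.μ Q.μ₂) :
    B₁.μ (h.rev z) = Q.μ₁ z.2 ∧ q (h.rev z, z.2) = z.1 := by
  have hr : q (h.diagonalQuotient.rep z.1) = z.1 := h.diagonalQuotient.q_rep z.1
  have := h.act_div_spec (h.diagonalQuotient.rep_mem z.1) (p := z.2) (by rw [hr]; exact hz)
  rw [hr] at this
  exact this

theorem rev_eq (h : Q.IsQuotientMap B₁ B₂ q) {a : B₁.P} {p : Q.P} (ha : B₁.μ a = Q.μ₁ p) :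
    h.rev (q (a, p), p) = a := by
  have hz : (q (a, p), p) ∈ fibProd B₂.μ Q.μ₂ := h.moment_eq (a, p) ha
  exact h.left_unique (h.rev_spec hz).1 ha (h.rev_spec hz).2

/-- Lift the point of `P₂` by a smooth local section of `q` and translate by the division map of
`P`; by uniqueness the result is `rev`. -/
theorem rev_smooth (h : Q.IsQuotientMap B₁ B₂ q) : SmoothOn h.rev (fibProd B₂.μ Q.μ₂) := by
  rintro ⟨y₀, p₀⟩ hz
  obtain ⟨x₀, hx₀, rfl⟩ := h.surj y₀
  obtain ⟨l, U, hU, hyU, hl, -, hlU⟩ := h.exists_lift hx₀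
  set S := fibProd B₂.μ Q.μ₂ ∩ (Prod.fst ⁻¹' U) with hS
  have hlS : ContMDiffOn ((𝓡 B₂.P.dim).prod (𝓡 Q.P.dim)) ((𝓡 B₁.P.dim).prod (𝓡 Q.P.dim)) ∞
      (fun z : B₂.P × Q.P => l z.1) S := hl.comp contMDiffOn_fst fun z hz => hz.2
  have hm : ∀ z ∈ S, B₂.μ (q (l z.1)) = Q.μ₂ z.2 := by
    intro z hz
    rw [(hlU _ hz.2).2]
    exact hz.1
  have hm' : ∀ z ∈ S, Q.μ₂ (l z.1).2 = Q.μ₂ z.2 := fun z hz =>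
    (h.moment_eq _ (hlU _ hz.2).1).symm.trans (hm z hz)
  have h1 : ContMDiffOn ((𝓡 B₂.P.dim).prod (𝓡 Q.P.dim)) (𝓡 Γ₁.G.arr.dim) ∞
      (fun z : B₂.P × Q.P => Q.left_principal.div (l z.1).2 z.2) S :=
    ContMDiffOn.comp (g := fun z : Q.P × Q.P => Q.left_principal.div z.1 z.2)
      Q.left_principal.div_smooth ((contMDiff_snd.comp_contMDiffOn hlS).prodMk contMDiffOn_snd) hm'
  have h2 : ContMDiffOn ((𝓡 B₂.P.dim).prod (𝓡 Q.P.dim)) (𝓡 B₁.P.dim) ∞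
      (fun z : B₂.P × Q.P => B₁.act (Q.left_principal.div (l z.1).2 z.2) (l z.1).1) S :=
    ContMDiffOn.comp (g := fun z : Γ₁.G.arr × B₁.P => B₁.act z.1 z.2) B₁.principal.act_smooth
      (h1.prodMk (contMDiff_fst.comp_contMDiffOn hlS))
      fun z hz => (Q.left_principal.s_div (hm' z hz)).trans (Eq.symm (hlU _ hz.2).1)
  have h3 : ∀ z ∈ S, h.rev z = B₁.act (Q.left_principal.div (l z.1).2 z.2) (l z.1).1 := by
    intro z hz
    obtain ⟨e1, e2⟩ := h.act_div_spec (hlU _ hz.2).1 (hm z hz)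
    rw [(hlU _ hz.2).2] at e2
    have := h.rev_eq e1
    rwa [e2] at this
  have hSn : S ∈ 𝓝[fibProd B₂.μ Q.μ₂] (q x₀, p₀) :=
    inter_mem self_mem_nhdsWithin
      (mem_nhdsWithin_of_mem_nhds ((hU.preimage continuous_fst).mem_nhds hyU))
  exact ((h2.congr h3) _ ⟨hz, hyU⟩).mono_of_mem_nhdsWithin hSn

/-- If two pairs give the same `p₁`, their entries in `P` lie over the same point of `X₁`, so an
arrow of `Σ₂` relates them. Equivariance of `q` shows that the same arrow relates the entries in
`P₂`. -/
theorem rev_orbits (h : Q.IsQuotientMap B₁ B₂ q) (x : B₂.P × Q.P) (hx : x ∈ fibProd B₂.μ Q.μ₂)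
    (y : B₂.P × Q.P) (hy : y ∈ fibProd B₂.μ Q.μ₂) :
    h.rev x = h.rev y ↔ ∃ g, Γ₂.G.s g = B₂.μ x.1 ∧ y = (B₂.act g x.1, Q.ractInv g x.2) := by
  obtain ⟨y₁, p⟩ := x
  obtain ⟨y₂, p'⟩ := y
  have hx : B₂.μ y₁ = Q.μ₂ p := hx
  obtain ⟨e1, e2⟩ := h.rev_spec (z := (y₁, p)) hx
  obtain ⟨e3, e4⟩ := h.rev_spec (z := (y₂, p')) hy
  constructor
  · intro he
    rw [← he] at e3 e4
    have hp : Q.μ₁ p = Q.μ₁ p' := e1.symm.trans e3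
    refine ⟨Q.ractInv_principal.div p p', (Q.ractInv_principal.s_div hp).trans hx.symm, ?_⟩
    refine Prod.ext ?_ (Q.ractInv_principal.act_div hp).symm
    have := h.act_q (x := (h.rev (y₁, p), p)) e1 (Q.ractInv_principal.s_div hp)
    rw [e2] at this
    simp only at e4 this
    rw [Q.ractInv_principal.act_div hp, e4] at this
    exact this.symm
  · rintro ⟨g, hg, he⟩
    have hgp : Γ₂.G.s g = Q.μ₂ p := hg.trans hx
    have h1 := h.act_q (x := (h.rev (y₁, p), p)) e1 hgp
    rw [e2] at h1
    have h2 := h.rev_eq (DiagonalQuotient.mem_ractInv (x := (h.rev (y₁, p), p)) e1 hgp)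
    simp only at h1 h2
    rw [← h1] at h2
    rw [he]
    exact h2.symm

/-- The equation `-q^*θ₂ = Φ ∘ (θ - θ₁)`, solved for `θ₁` along curves of the form `(rev (y, b),
b)`. -/
theorem rev_form (h : Q.IsQuotientMap B₁ B₂ q) {y₀ : B₂.P} {p₀ : Q.P} (hx : B₂.μ y₀ = Q.μ₂ p₀)
    (hm : B₁.μ (h.rev (y₀, p₀)) = Q.μ₁ p₀) (v : EuclideanSpace ℝ (Fin B₂.P.dim))
    (w : EuclideanSpace ℝ (Fin Q.P.dim))
    (hT : TangentToFib B₂.μ Q.μ₂ (a := y₀) (b := p₀) v w) :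
    - Q.Φ p₀ (Q.θ p₀ w) - B₂.θ.ev y₀ hx v =
      Q.Φ p₀ (- B₁.θ.ev (h.rev (y₀, p₀)) hm
        (diffOn h.rev (fibProd B₂.μ Q.μ₂) y₀ p₀ v w)) := by
  obtain ⟨y, b, rfl, rfl, hy, hb, hyb⟩ := exists_curve_fibProd
    B₂.principal.moment_submersion Q.left_principal.proj_submersion.smooth hT
  obtain ⟨z, hz, hze⟩ : ∃ z : EuclideanSpace ℝ (Fin B₁.P.dim),
      Vel B₁.P (fun t => h.rev (y t, b t)) z ∧
        z = diffOn h.rev (fibProd B₂.μ Q.μ₂) (y 0) (b 0) v w :=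
    ⟨_, h.rev_smooth.vel hy hb hyb, rfl⟩
  have hfib : ∀ᶠ t in 𝓝 0, B₁.μ (h.rev (y t, b t)) = Q.μ₁ (b t) :=
    hyb.mono fun t ht => (h.rev_spec (z := (y t, b t)) ht).1
  have hqy : ∀ᶠ t in 𝓝 0, q (h.rev (y t, b t), b t) = y t :=
    hyb.mono fun t ht => (h.rev_spec (z := (y t, b t)) ht).2
  have e := h.form_q_vel hz hb hfib (hy.congr hqy) hfib.self_of_nhds
    (y := Q.μ₂ (b 0)) (by rw [hqy.self_of_nhds, hx]) rfl
  have e' := (B₂.θ.ev_congr hqy.self_of_nhds _ v).symm.trans e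
  have e'' : B₂.θ.ev (y 0) hx v = - Q.Φ (b 0) (Q.θ (b 0) w -
    B₁.θ.ev (h.rev (y 0, b 0)) hm z) := e'
  rw [e'', ← hze, map_sub, map_neg]
  abel

/-- Transport through the opposite bibundle is the inverse relation. -/
theorem op (h : Q.IsQuotientMap B₁ B₂ q) : Q.op.IsQuotientMap B₂ B₁ h.rev where
  smooth := h.rev_smooth
  surj a := by
    obtain ⟨p, hp⟩ := Q.left_principal.moment_submersion.surj (B₁.μ a)
    exact ⟨(q (a, p), p), h.moment_eq (a, p) hp.symm, h.rev_eq hp.symm⟩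
  submersive y₀ p₀ hx z := by
    obtain ⟨e1, e2⟩ := h.rev_spec (z := (y₀, p₀)) hx
    obtain ⟨a, ha0, ha⟩ := exists_vel (h.rev (y₀, p₀)) z
    obtain ⟨b, w, hb0, hb, hba⟩ := Q.left_principal.moment_submersion.exists_lift'
      (B₁.principal.moment_submersion.smooth.vel ha) (a := p₀) (by rw [ha0, e1])
    have hab : ∀ᶠ t in 𝓝 0, B₁.μ (a t) = Q.μ₁ (b t) := hba.mono fun t ht => ht.symm
    obtain ⟨v, hv⟩ : ∃ v, Vel B₂.P (fun t => q (a t, b t)) v := ⟨_, h.smooth.vel ha hb hab⟩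
    have hy0 : q (a 0, b 0) = y₀ := by rw [ha0, hb0]; exact e2
    subst hb0 hy0
    have hfib : ∀ᶠ t in 𝓝 0, B₂.μ (q (a t, b t)) = Q.μ₂ (b t) :=
      hab.mono fun t ht => h.moment_eq (a t, b t) ht
    exact ⟨v, w, tangentToFib_of_curves B₂.principal.moment_submersion.smooth
      Q.left_principal.proj_submersion.smooth hv hb hfib,
      (h.rev_smooth.vel hv hb hfib).unique (ha.congr (hab.mono fun t ht => h.rev_eq ht))⟩
  orbits := h.rev_orbits
  proj_eq x hx := by
    obtain ⟨e1, e2⟩ := h.rev_spec hx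
    have := h.proj_eq (h.rev x, x.2) e1
    rw [e2] at this
    exact this.symm
  moment_eq x hx := (h.rev_spec hx).1
  equivariant x hx g hg := by
    obtain ⟨y, p⟩ := x
    obtain ⟨e1, e2⟩ := h.rev_spec hx
    have hs : Γ₁.G.s (Γ₁.G.inv g) = B₁.μ (h.rev (y, p)) :=
      (Γ₁.G.s_inv g).trans (hg.symm.trans e1.symm)
    have h1 := h.rev_eq (DiagonalQuotient.mem_lact (x := (h.rev (y, p), p)) e1 hs)
    have h2 := h.diagonalQuotient.q_lact (x := (h.rev (y, p), p)) e1 hs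
    have h3 : q (B₁.act (Γ₁.G.inv g) (h.rev (y, p)), Q.lact (Γ₁.G.inv g) p) = y := h2.trans e2
    simp only at h1
    rw [h3] at h1
    exact h1
  form_eq y₀ p₀ hx hm v w hT := by
    -- The bundle isomorphism of the opposite bibundle is `Φ⁻¹`; applying `Φ` to both sides leaves
    -- `rev_form`.
    refine ((LinearEquiv.symm_apply_eq (Q.Φ p₀)).2 ?_).symm
    exact h.rev_form hx hm v w hT

end PfaffianBibundle.IsQuotientMap

/-! ### The bijection on isomorphism classes -/

namespace PfaffianBibundle

variable {Γ₁ Γ₂ : PfaffianGroupoid.{u}} (Q : PfaffianBibundle Γ₁ Γ₂) {M : Mfd.{u}}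

/-- The bundle `B₂` is the transport of `B₁` through `Q`. -/
def Transports (B₁ : PrincipalPfaffianBundle Γ₁ M) (B₂ : PrincipalPfaffianBundle Γ₂ M) : Prop :=
  ∃ q, Q.IsQuotientMap B₁ B₂ q

variable {Q}

theorem exists_transports [T2Space M] (Q : PfaffianBibundle Γ₁ Γ₂)
    (B₁ : PrincipalPfaffianBundle Γ₁ M) : ∃ B₂, Q.Transports B₁ B₂ :=
  (DiagonalQuotient.nonempty Q B₁).elim fun D => ⟨D.bundle, D.q, D.isQuotientMap⟩

theorem Transports.op {B₁ : PrincipalPfaffianBundle Γ₁ M} {B₂ : PrincipalPfaffianBundle Γ₂ M}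
    (h : Q.Transports B₁ B₂) : Q.op.Transports B₂ B₁ :=
  h.elim fun _ hq => ⟨_, hq.op⟩

theorem Transports.of_op {B₁ : PrincipalPfaffianBundle Γ₁ M} {B₂ : PrincipalPfaffianBundle Γ₂ M}
    (h : Q.op.Transports B₂ B₁) : Q.Transports B₁ B₂ :=
  h.op.elim fun q hq => ⟨q, IsQuotientMap.of_op_op Q hq⟩

theorem Transports.iso {B₁ : PrincipalPfaffianBundle Γ₁ M} {B₂ B₂' : PrincipalPfaffianBundle Γ₂ M}
    (h : Q.Transports B₁ B₂) (h' : Q.Transports B₁ B₂') : B₂.Iso B₂' :=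
  h.elim fun _ hq => h'.elim fun _ hq' => hq.iso hq'

theorem Transports.of_iso_right {B₁ : PrincipalPfaffianBundle Γ₁ M}
    {B₂ B₂' : PrincipalPfaffianBundle Γ₂ M} (h : Q.Transports B₁ B₂) (hi : B₂.Iso B₂') :
    Q.Transports B₁ B₂' :=
  h.elim fun _ hq => hq.exists_of_iso hi

/-- For the opposite bibundle the first bundle is the target, where invariance under isomorphism is
known. -/
theorem Transports.of_iso_left {B₁ B₁' : PrincipalPfaffianBundle Γ₁ M}
    {B₂ : PrincipalPfaffianBundle Γ₂ M} (h : Q.Transports B₁ B₂) (hi : B₁.Iso B₁') :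
    Q.Transports B₁' B₂ :=
  (h.op.of_iso_right hi).of_op

/-- Transport through a bibundle, on isomorphism classes. -/
noncomputable def transport [T2Space M] (Q : PfaffianBibundle Γ₁ Γ₂) :
    IsoClasses Γ₁ M → IsoClasses Γ₂ M :=
  Quotient.lift (fun B₁ => (Q.exists_transports B₁).choose.cls) fun B₁ B₁' hi =>
    Quotient.sound (Transports.iso ((Q.exists_transports B₁).choose_spec.of_iso_left hi)
      (Q.exists_transports B₁').choose_spec)

theorem transport_eq_iff [T2Space M] (B₁ : PrincipalPfaffianBundle Γ₁ M)
    (B₂ : PrincipalPfaffianBundle Γ₂ M) : Q.transport B₁.cls = B₂.cls ↔ Q.Transports B₁ B₂ :=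
  ⟨fun h => (Q.exists_transports B₁).choose_spec.of_iso_right (Quotient.exact h),
    fun h => Quotient.sound ((Q.exists_transports B₁).choose_spec.iso h)⟩

/-- Injectivity is uniqueness of transport through the opposite bibundle, and surjectivity is
existence of such a transport. -/
theorem transport_bijective [T2Space M] (Q : PfaffianBibundle Γ₁ Γ₂) :
    Function.Bijective (Q.transport (M := M)) := by
  constructor
  · rintro ⟨B₁⟩ ⟨B₁'⟩ h
    obtain ⟨B₂, hB₂⟩ := Q.exists_transports B₁'
    have h' : Q.transport B₁.cls = B₂.cls := Eq.trans h ((transport_eq_iff B₁' B₂).2 hB₂)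
    exact Quotient.sound (((transport_eq_iff B₁ B₂).1 h').op.iso hB₂.op)
  · rintro ⟨B₂⟩
    obtain ⟨B₁, hB₁⟩ := Q.op.exists_transports B₂
    exact ⟨B₁.cls, (transport_eq_iff B₁ B₂).2 hB₁.of_op⟩

end PfaffianBibundle

end Pfaffian

theorem mainTheorem2 (Γ₁ Γ₂ : Pfaffian.PfaffianGroupoid.{u})
    (Q : Pfaffian.PfaffianBibundle Γ₁ Γ₂) (M : Pfaffian.Mfd.{u}) [T2Space M]
    [SecondCountableTopology M] :
    ∃ e : Pfaffian.IsoClasses Γ₁ M ≃ Pfaffian.IsoClasses Γ₂ M,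
      ∀ (B₁ : Pfaffian.PrincipalPfaffianBundle Γ₁ M) (B₂ : Pfaffian.PrincipalPfaffianBundle Γ₂ M),
        e B₁.cls = B₂.cls ↔ ∃ q, Q.IsQuotientMap B₁ B₂ q :=
  ⟨Equiv.ofBijective _ Q.transport_bijective,
    fun B₁ B₂ => Pfaffian.PfaffianBibundle.transport_eq_iff B₁ B₂⟩
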